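/- Let $L>0$, $\gamma<0$, $p>1$ and $\omega>\gamma^2/4$, and let $\mathbb S_L=\mathbb R\times[0,L]$. For complex-valued $u\in H^1(\mathbb S_L)$, write $u(0,\cdot)\in L^2(0,L)$ for the trace of $u$ on the section $x=0$, and set \[ S_{\omega,\gamma}(u)=\tfrac12\|\nabla u\|_{L^2(\mathbb S_L)}^2+\tfrac{\omega}{2}\|u\|_{L^2(\mathbb S_L)}^2+\tfrac{\gamma}{2}\int_0^L|u(0,y)|^2\,dy-\tfrac1{p+1}\|u\|_{L^{p+1}(\mathbb S_L)}^{p+1}, \] \[ I_{\omega,\gamma}(u)=\|\nabla u\|_{L^2(\mathbb S_L)}^2+\omega\|u\|_{L^2(\mathbb S_L)}^2+\gamma\int_0^L|u(0,y)|^2\,dy-\|u\|_{L^{p+1}(\mathbb S_L)}^{p+1}. \] Then there exists a minimizer $u$ of the problem \[ \inf\{S_{\omega,\gamma}(v): v\in H^1(\mathbb S_L)\setminus\{0\},\ I_{\omega,\gamma}(v)=0\} \] that is real-valued and positive; here $u$ is identified with its precise representative (the limit, where it exists, of the averages of $u$ over the sets $B(z,r)\cap\mathbb S_L$ as $r\to0$,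 and $0$ elsewhere), which is real and strictly positive at every point $z$ of $\mathbb S_L$. Moreover, this minimizer is a weak solution in $H^1(\mathbb S_L)$ of \[ -\partial_{xx}u-\partial_{yy}u+\omega u+\gamma\delta_0(x)u-|u|^{p-1}u=0\ \text{ in }\mathbb S_L,\qquad \partial_\nu u=0\ \text{ on }\partial\mathbb S_L=\mathbb R\times\{0,L\}, \] that is, for every $v\in H^1(\mathbb S_L)$, \[ \mathrm{Re}\int_{\mathbb S_L}\nabla u\cdot\overline{\nabla v}+\omega\,\mathrm{Re}\int_{\mathbb S_L}u\overline v+\gamma\,\mathrm{Re}\int_0^L u(0,y)\overline{v(0,y)}\,dy-\mathrm{Re}\int_{\mathbb S_L}|u|^{p-1}u\overline v=0 . \] -/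

import Mathlib

open MeasureTheory Filter Topology

noncomputable section

namespace DeltaStrip

/-- The closed strip `ℝ × [0, L]`. -/
def strip (L : ℝ) : Set (ℝ × ℝ) := Set.univ ×ˢ Set.Icc 0 L

/-- The interior `ℝ × (0, L)` of the strip, on which test functions are supported. -/
def openStrip (L : ℝ) : Set (ℝ × ℝ) := Set.univ ×ˢ Set.Ioo 0 L

/-- Lebesgue measure on the strip. -/
def stripMeasure (L : ℝ) : Measure (ℝ × ℝ) := volume.restrict (strip L)

/-- Lebesgue measure on the section `{0} × [0, L]`, identified with `[0, L]`. -/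
def sectionMeasure (L : ℝ) : Measure ℝ := volume.restrict (Set.Icc 0 L)

/-- The coordinate direction of the lengthwise variable `x`. -/
def ex : ℝ × ℝ := (1, 0)

/-- The coordinate direction of the transverse variable `y`. -/
def ey : ℝ × ℝ := (0, 1)

/-- `φ` is a test function: smooth, with compact support inside the open strip. -/
def IsTest (L : ℝ) (φ : ℝ × ℝ → ℝ) : Prop :=
  ContDiff ℝ (⊤ : ℕ∞) φ ∧ HasCompactSupport φ ∧ tsupport φ ⊆ openStrip L

/-- `g` is a square integrable weak derivative of `u` in the direction `e` on the strip. -/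
def HasWeakDeriv (L : ℝ) (e : ℝ × ℝ) (u g : ℝ × ℝ → ℂ) : Prop :=
  MemLp g 2 (stripMeasure L) ∧
    ∀ φ : ℝ × ℝ → ℝ, IsTest L φ →
      ∫ z, (fderiv ℝ φ z e : ℂ) * u z ∂(stripMeasure L)
        = - ∫ z, (φ z : ℂ) * g z ∂(stripMeasure L)

/-- `u` belongs to `H¹` of the strip (complex valued functions, considered up to null sets). -/
def MemH1 (L : ℝ) (u : ℝ × ℝ → ℂ) : Prop :=
  MemLp u 2 (stripMeasure L) ∧
    (∃ g, HasWeakDeriv L ex u g) ∧ (∃ g, HasWeakDeriv L ey u g)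

open Classical in
/-- The weak derivative of `u` in the direction `e` (unique up to null sets). -/
def weakDeriv (L : ℝ) (e : ℝ × ℝ) (u : ℝ × ℝ → ℂ) : ℝ × ℝ → ℂ :=
  if h : ∃ g, HasWeakDeriv L e u g then h.choose else 0

/-- `t ∈ L²(0, L)` is the trace of `u` on the section `x = 0`: it is the `L²(0, L)` limit of the
restrictions `φ n (0, ·)` for some sequence of smooth, compactly supported functions `φ n` on `ℝ²`
(not required to vanish on the boundary of the strip) that converges to `u` in `H¹` of the strip. -/
def IsTrace (L : ℝ) (u : ℝ × ℝ → ℂ) (t : ℝ → ℂ) : Prop :=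
  MemLp t 2 (sectionMeasure L) ∧
    ∃ φ : ℕ → ℝ × ℝ → ℂ,
      (∀ n, ContDiff ℝ (⊤ : ℕ∞) (φ n) ∧ HasCompactSupport (φ n)) ∧
      Tendsto (fun n => eLpNorm (fun z => φ n z - u z) 2 (stripMeasure L)) atTop (𝓝 0) ∧
      Tendsto (fun n => eLpNorm (fun z => fderiv ℝ (φ n) z ex - weakDeriv L ex u z) 2
        (stripMeasure L)) atTop (𝓝 0) ∧
      Tendsto (fun n => eLpNorm (fun z => fderiv ℝ (φ n) z ey - weakDeriv L ey u z) 2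
        (stripMeasure L)) atTop (𝓝 0) ∧
      Tendsto (fun n => eLpNorm (fun y => φ n (0, y) - t y) 2 (sectionMeasure L)) atTop (𝓝 0)

open Classical in
/-- The trace `u(0, ·)` of a function `u` in `H¹` of the strip (unique up to null sets). -/
def trace (L : ℝ) (u : ℝ × ℝ → ℂ) : ℝ → ℂ :=
  if h : ∃ t, IsTrace L u t then h.choose else 0

/-- `‖∇u‖²` in `L²` of the strip. -/
def gradSq (L : ℝ) (u : ℝ × ℝ → ℂ) : ℝ :=
  ∫ z, (‖weakDeriv L ex u z‖ ^ 2 + ‖weakDeriv L ey u z‖ ^ 2) ∂(stripMeasure L)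

/-- `‖u‖²` in `L²` of the strip. -/
def massSq (L : ℝ) (u : ℝ × ℝ → ℂ) : ℝ :=
  ∫ z, ‖u z‖ ^ 2 ∂(stripMeasure L)

/-- The integral over `(0, L)` of `|u(0, y)|²`. -/
def traceSq (L : ℝ) (u : ℝ × ℝ → ℂ) : ℝ :=
  ∫ y, ‖trace L u y‖ ^ 2 ∂(sectionMeasure L)

/-- The `(p + 1)`-th power of the `L^{p+1}` norm of `u` on the strip. -/
def potential (L p : ℝ) (u : ℝ × ℝ → ℂ) : ℝ :=
  ∫ z, ‖u z‖ ^ (p + 1) ∂(stripMeasure L)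

/-- The action functional. -/
def action (L ω γ p : ℝ) (u : ℝ × ℝ → ℂ) : ℝ :=
  1 / 2 * gradSq L u + ω / 2 * massSq L u + γ / 2 * traceSq L u - 1 / (p + 1) * potential L p u

/-- The Nehari functional. -/
def nehari (L ω γ p : ℝ) (u : ℝ × ℝ → ℂ) : ℝ :=
  gradSq L u + ω * massSq L u + γ * traceSq L u - potential L p u

/-- The nonzero elements of the Nehari manifold in `H¹` of the strip. -/
def nehariManifold (L ω γ p : ℝ) : Set (ℝ × ℝ → ℂ) :=
  {u | MemH1 L u ∧ ¬ (u =ᵐ[stripMeasure L] 0) ∧ nehari L ω γ p u = 0}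

/-- Action ground states: minimizers of the action over the nonzero elements of the Nehari
manifold. -/
def IsActionGroundState (L ω γ p : ℝ) (u : ℝ × ℝ → ℂ) : Prop :=
  u ∈ nehariManifold L ω γ p ∧ IsMinOn (action L ω γ p) (nehariManifold L ω γ p) u

/-- `u ∈ H¹` solves `-Δu + ω u + γ δ₀(x) u - |u|^(p-1) u = 0` on the strip with Neumann boundary
conditions, in the weak sense: the test functions `v` run over the whole of `H¹` of the strip,
with no condition on the boundary, which encodes the Neumann condition. -/
def IsSolution (L ω γ p : ℝ) (u : ℝ × ℝ → ℂ) : Prop :=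
  MemH1 L u ∧
    ∀ v : ℝ × ℝ → ℂ, MemH1 L v →
      ∫ z, (weakDeriv L ex u z * star (weakDeriv L ex v z)
            + weakDeriv L ey u z * star (weakDeriv L ey v z)).re ∂(stripMeasure L)
        + ω * ∫ z, (u z * star (v z)).re ∂(stripMeasure L)
        + γ * ∫ y, (trace L u y * star (trace L v y)).re ∂(sectionMeasure L)
        - ∫ z, ‖u z‖ ^ (p - 1) * (u z * star (v z)).re ∂(stripMeasure L) = 0

/-- The part inside the closed strip of the Euclidean disc of centre `z` and radius `r`. -/
def stripDisc (L : ℝ) (z : ℝ × ℝ) (r : ℝ) : Set (ℝ × ℝ) :=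
  {w | w ∈ strip L ∧ (w.1 - z.1) ^ 2 + (w.2 - z.2) ^ 2 < r ^ 2}

open Classical in
/-- The precise representative of `u`: the limit of the averages of `u` over shrinking discs in the
strip where this limit exists, and `0` elsewhere. -/
def preciseRep (L : ℝ) (u : ℝ × ℝ → ℂ) (z : ℝ × ℝ) : ℂ :=
  if h : ∃ l : ℂ, Tendsto (fun r : ℝ => ⨍ w in stripDisc L z r, u w) (𝓝[>] 0) (𝓝 l)
  then h.choose else 0

end DeltaStrip

end

/-! Write q for the quadratic part of the Nehari functional and P for the integral of |u|^r, where r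
= p + 1. On the Nehari set q = P, so the action is (1/2 - 1/r) P, and it suffices to minimize q on
{P = 1} and rescale. With m the infimum, homogeneity gives m P^(2/r) ≤ q on the whole space
(`minLevel_mul_le`). The trace inequality ∫ |u(0,y)|² dy ≤ (a ‖u‖² + ‖∂ₓu‖² / a) / 2, with a chosen
suitably, makes q coercive for ω > γ²/4 (`exists_coercive`).

Compactness can only fail by escape along x. A minimizing sequence is written U + W_n with W_n
weakly null. Local compactness makes the trace of W_n vanish, and both P and q split
(`tendsto_pInt_add_sub`). If W_n keeps a positive amount of P, some section of it carries L² mass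
bounded below (`exists_large_slice`). Translating that section to x = 0 lets the attractive delta
lower the energy by a fixed amount, so the form without delta exceeds m P^(2/r) by some c > 0 on W_n
(`exists_gap`). As t ≤ t^(2/r) on [0, 1], this would give m ≥ m + c. Hence P(U) = 1 and U is a
minimizer (`exists_minimizer`). The modulus does not raise q (`exists_abs`), the inequality m
P^(2/r) ≤ q has equality at U and yields the Euler–Lagrange equation (`euler_lagrange`), and
multiplication by m^(1/(r-2)) removes the multiplier (`exists_ground_state`).

Positivity at every point comes from mean values against a smooth radial kernel of radius a^(-1/2),
summed with its reflections in the two sides so that test functions satisfy the Neumann condition.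
The derivative in a of such a mean is an integral of u against a Laplacian (`hasDerivAt_mean`),
hence O(a^(-5/4)) by the equation. The means therefore converge uniformly
(`IsNonnegSol.exists_limit`), and the continuous limit is a constant multiple of u almost everywhere
(`ae_eq_limit`). Since γ < 0 and u ≥ 0, Δu ≤ ωu weakly, so the mean times exp(-ω/(4a)) is
nondecreasing in a (`IsNonnegSol.monotoneOn`). A zero of the limit then makes u vanish on a disc of
radius L, and by connectedness everywhere (`IsNonnegSol.limit_pos`).

The variational analysis takes place in the closure of the quadruples (φ, ∂ₓφ, ∂ᵧφ, φ(0,·)) of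
smooth functions. `exists_quad_of_memH1` identifies this closure with H¹, its weak derivatives and
its traces, by cut-off, contraction of the strip and mollification. -/

namespace DeltaStrip

/-! ### Slices, Cauchy–Schwarz and Gagliardo-type inequalities. -/

/-- A smooth compactly supported function on the plane. -/
structure IsCc (φ : ℝ × ℝ → ℂ) : Prop where
  smooth : ContDiff ℝ (⊤ : ℕ∞) φ
  cpt : HasCompactSupport φ

theorem stripMeasure_eq (L : ℝ) : stripMeasure L = (volume : Measure ℝ).prod (sectionMeasure L) := by
  have h := Measure.prod_restrict (μ := (volume : Measure ℝ)) (ν := (volume : Measure ℝ))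
    Set.univ (Set.Icc 0 L)
  rw [Measure.restrict_univ] at h
  rw [stripMeasure, sectionMeasure, strip, h]
  rfl

instance (L : ℝ) : IsFiniteMeasureOnCompacts (stripMeasure L) := by
  unfold stripMeasure; infer_instance

instance (L : ℝ) : SFinite (stripMeasure L) := by
  unfold stripMeasure; infer_instance

instance (L : ℝ) : IsLocallyFiniteMeasure (stripMeasure L) := by
  unfold stripMeasure; infer_instance

instance (L : ℝ) : IsFiniteMeasure (sectionMeasure L) := by
  unfold sectionMeasure; infer_instance

theorem hasCompactSupport_of_imp {α F G : Type*} [TopologicalSpace α] [Zero F] [Zero G]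
    {f : α → F} {g : α → G} (hf : HasCompactSupport f) (h : ∀ z, f z = 0 → g z = 0) :
    HasCompactSupport g :=
  hf.mono fun z hz hz' => hz (h z hz')

section Slices

variable {F : Type*} [NormedAddCommGroup F] [NormedSpace ℝ F]

theorem hasDerivAt_slice_fst {f : ℝ × ℝ → F} {x y : ℝ} (hf : DifferentiableAt ℝ f (x, y)) :
    HasDerivAt (fun s => f (s, y)) (fderiv ℝ f (x, y) ex) x := by
  have h := hf.hasFDerivAt.comp_hasDerivAt (f := fun s : ℝ => (s, y)) x
    ((hasDerivAt_id x).prodMk (hasDerivAt_const x y))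
  exact h

theorem hasDerivAt_slice_snd {f : ℝ × ℝ → F} {x y : ℝ} (hf : DifferentiableAt ℝ f (x, y)) :
    HasDerivAt (fun s => f (x, s)) (fderiv ℝ f (x, y) ey) y := by
  have h := hf.hasFDerivAt.comp_hasDerivAt (f := fun s : ℝ => (x, s)) y
    ((hasDerivAt_const y x).prodMk (hasDerivAt_id y))
  exact h

theorem hasCompactSupport_slice_fst {f : ℝ × ℝ → F} (hf : HasCompactSupport f) (y : ℝ) :
    HasCompactSupport (fun s => f (s, y)) :=
  hf.comp_isClosedEmbedding (g := fun s : ℝ => (s, y))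
    ⟨isEmbedding_prodMkLeft y, by
      have : Set.range (fun s : ℝ => (s, y)) = Set.univ ×ˢ {y} := by ext ⟨a, b⟩; simp [eq_comm]
      rw [this]; exact isClosed_univ.prod isClosed_singleton⟩

theorem hasCompactSupport_slice_snd {f : ℝ × ℝ → F} (hf : HasCompactSupport f) (x : ℝ) :
    HasCompactSupport (fun s => f (x, s)) :=
  hf.comp_isClosedEmbedding (g := fun s : ℝ => (x, s))
    ⟨isEmbedding_prodMkRight x, by
      have : Set.range (fun s : ℝ => (x, s)) = {x} ×ˢ Set.univ := by ext ⟨a, b⟩; simp [eq_comm]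
      rw [this]; exact isClosed_singleton.prod isClosed_univ⟩

theorem continuous_fderiv_dir {f : ℝ × ℝ → F} (hf : ContDiff ℝ 1 f) (e : ℝ × ℝ) :
    Continuous (fun z => fderiv ℝ f z e) :=
  (hf.continuous_fderiv one_ne_zero).clm_apply continuous_const

theorem hasCompactSupport_fderiv_dir {f : ℝ × ℝ → F} (hf : HasCompactSupport f) (e : ℝ × ℝ) :
    HasCompactSupport (fun z => fderiv ℝ f z e) :=
  (hf.fderiv (𝕜 := ℝ)).comp_left (g := fun T : (ℝ × ℝ) →L[ℝ] F => T e) rfl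

theorem deriv_slice_fst {f : ℝ × ℝ → F} (hf : ContDiff ℝ 1 f) (y : ℝ) :
    deriv (fun s => f (s, y)) = fun x => fderiv ℝ f (x, y) ex :=
  funext fun _ => (hasDerivAt_slice_fst (hf.differentiable one_ne_zero _)).deriv

theorem deriv_slice_snd {f : ℝ × ℝ → F} (hf : ContDiff ℝ 1 f) (x : ℝ) :
    deriv (fun s => f (x, s)) = fun y => fderiv ℝ f (x, y) ey :=
  funext fun _ => (hasDerivAt_slice_snd (hf.differentiable one_ne_zero _)).deriv

end Slices

/-- Twice the value is the integral of f' over the left half-line minus that over the right one. The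
factor 1/2 is responsible for the threshold γ²/4 in `exists_coercive`. -/
theorem le_half_integral_abs_deriv {f : ℝ → ℝ} (hf : ContDiff ℝ 1 f) (hc : HasCompactSupport f)
    (x : ℝ) : f x ≤ 1 / 2 * ∫ s, |deriv f s| := by
  have h1 := hc.integral_Iic_deriv_eq hf x
  have h2 := hc.integral_Ioi_deriv_eq hf x
  have hi : Integrable (deriv f) :=
    (hf.continuous_deriv le_rfl).integrable_of_hasCompactSupport hc.deriv
  have h3 := integral_add_compl (measurableSet_Iic (a := x)) hi.abs
  rw [Set.compl_Iic] at h3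
  have h4 : ∫ s in Set.Iic x, deriv f s ≤ ∫ s in Set.Iic x, |deriv f s| :=
    integral_mono hi.integrableOn hi.abs.integrableOn fun s => le_abs_self _
  have h5 : -∫ s in Set.Ioi x, deriv f s ≤ ∫ s in Set.Ioi x, |deriv f s| := by
    rw [← integral_neg]
    exact integral_mono hi.neg.integrableOn hi.abs.integrableOn fun s => neg_le_abs _
  linarith

theorem abs_sub_le_integral_abs_deriv {F : Type*} [NormedAddCommGroup F] [NormedSpace ℝ F]
    [CompleteSpace F] {f : ℝ → F} (hf : ContDiff ℝ 1 f) {a b y η : ℝ}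
    (hy : y ∈ Set.Icc a b) (hη : η ∈ Set.Icc a b) :
    ‖f y - f η‖ ≤ ∫ s in Set.Icc a b, ‖deriv f s‖ := by
  have hcd := hf.continuous_deriv le_rfl
  have h1 : ∫ s in η..y, deriv f s = f y - f η :=
    intervalIntegral.integral_deriv_eq_sub (fun s _ => hf.differentiable one_ne_zero s)
      (hcd.intervalIntegrable _ _)
  rw [← h1]
  refine (intervalIntegral.norm_integral_le_integral_norm_uIoc).trans ?_
  refine setIntegral_mono_set (hcd.norm.integrableOn_Icc)
    (Eventually.of_forall fun s => norm_nonneg _) ?_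
  refine LE.le.eventuallyLE ?_
  exact Set.uIoc_subset_uIcc.trans (Set.uIcc_subset_Icc hη hy)

/-- Cauchy–Schwarz: the integral of (t f + g)² is a nonnegative quadratic polynomial in t, so its
discriminant is nonpositive. -/
theorem integral_mul_sq_le {α : Type*} [MeasurableSpace α] {μ : Measure α} {f g : α → ℝ}
    (hf : Integrable (fun z => f z ^ 2) μ) (hg : Integrable (fun z => g z ^ 2) μ)
    (hfg : Integrable (fun z => f z * g z) μ) :
    (∫ z, f z * g z ∂μ) ^ 2 ≤ (∫ z, f z ^ 2 ∂μ) * ∫ z, g z ^ 2 ∂μ := by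
  have key : ∀ t : ℝ, 0 ≤ (∫ z, f z ^ 2 ∂μ) * (t * t) + (2 * ∫ z, f z * g z ∂μ) * t
      + ∫ z, g z ^ 2 ∂μ := by
    intro t
    have : (∫ z, f z ^ 2 ∂μ) * (t * t) + (2 * ∫ z, f z * g z ∂μ) * t + ∫ z, g z ^ 2 ∂μ
        = ∫ z, (t * f z + g z) ^ 2 ∂μ := by
      have e : (fun z => (t * f z + g z) ^ 2)
          = fun z => (t * t) * f z ^ 2 + (2 * t) * (f z * g z) + g z ^ 2 := by
        funext z; ring
      rw [e, integral_add (f := fun z => (t * t) * f z ^ 2 + (2 * t) * (f z * g z))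
        ((hf.const_mul _).add (hfg.const_mul _)) hg,
        integral_add (hf.const_mul _) (hfg.const_mul _), integral_const_mul, integral_const_mul]
      ring
    rw [this]
    exact integral_nonneg fun z => sq_nonneg _
  have := discrim_le_zero key
  rw [discrim] at this
  nlinarith

section Nonneg

variable {L : ℝ} {w : ℝ × ℝ → ℝ}

theorem le_integral_slice_fst (hw : ContDiff ℝ 1 w) (hc : HasCompactSupport w) (x y : ℝ) :
    w (x, y) ≤ 1 / 2 * ∫ s, |fderiv ℝ w (s, y) ex| := by
  have h := le_half_integral_abs_deriv (f := fun s => w (s, y))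
    (hw.comp (contDiff_prodMk_left y)) (hasCompactSupport_slice_fst hc y) x
  rwa [deriv_slice_fst hw] at h

/-- Nothing vanishes on the sides of the strip, so w(x, y) is compared with every w(x, η) and the
result averaged over η. This produces the zeroth-order term with 1/L. -/
theorem le_integral_slice_snd (hL : 0 < L) (hw : ContDiff ℝ 1 w) (x : ℝ) {y : ℝ}
    (hy : y ∈ Set.Icc 0 L) :
    w (x, y) ≤ ∫ s, (1 / L * w (x, s) + |fderiv ℝ w (x, s) ey|) ∂(sectionMeasure L) := by
  have hc1 : Continuous (fun s => w (x, s)) := hw.continuous.comp (by fun_prop)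
  have hc2 : Continuous (fun s => fderiv ℝ w (x, s) ey) :=
    (continuous_fderiv_dir hw ey).comp (by fun_prop)
  have h1 : ∀ η ∈ Set.Icc 0 L, w (x, y) ≤
      w (x, η) + ∫ s, |fderiv ℝ w (x, s) ey| ∂(sectionMeasure L) := by
    intro η hη
    have h := abs_sub_le_integral_abs_deriv (f := fun s => w (x, s))
      (hw.comp (contDiff_prodMk_right x)) hy hη
    rw [deriv_slice_snd hw] at h
    have := (abs_le.1 h).2
    rw [sectionMeasure]
    simp only [Real.norm_eq_abs] at this
    linarith
  have h2 : ∫ _η in Set.Icc 0 L, w (x, y) ≤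
      ∫ η in Set.Icc 0 L, (w (x, η) + ∫ s, |fderiv ℝ w (x, s) ey| ∂(sectionMeasure L)) := by
    refine setIntegral_mono_on (integrable_const _)
      (hc1.integrableOn_Icc.add (integrable_const _)) measurableSet_Icc h1
  rw [integral_add hc1.integrableOn_Icc (integrable_const _)] at h2
  simp only [integral_const, smul_eq_mul, Measure.real, Measure.restrict_apply MeasurableSet.univ,
    Set.univ_inter, Real.volume_Icc, sub_zero, ENNReal.toReal_ofReal hL.le] at h2
  rw [sectionMeasure] at h2 ⊢
  rw [integral_add (hc1.integrableOn_Icc.const_mul _) hc2.abs.integrableOn_Icc,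
    integral_const_mul]
  have := mul_le_mul_of_nonneg_left h2 (by positivity : 0 ≤ 1 / L)
  have e : 1 / L * (L * w (x, y)) = w (x, y) := by field_simp
  rw [e, mul_add] at this
  refine this.trans (le_of_eq ?_)
  field_simp

theorem integrable_strip {F : Type*} [NormedAddCommGroup F] {f : ℝ × ℝ → F}
    (hf : Continuous f) (hc : HasCompactSupport f) : Integrable f (stripMeasure L) :=
  hf.integrable_of_hasCompactSupport hc

theorem ae_section {P : ℝ → Prop} (h : ∀ y ∈ Set.Icc 0 L, P y) : ∀ᵐ y ∂(sectionMeasure L), P y :=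
  (ae_restrict_iff' measurableSet_Icc).2 (Eventually.of_forall h)

theorem integrable_section {F : Type*} [NormedAddCommGroup F] {f : ℝ → F} (hf : Continuous f) :
    Integrable f (sectionMeasure L) := hf.integrableOn_Icc

/-- Gagliardo's argument: in w² = w · w one factor is bounded by a function of y alone and the other
by a function of x alone, and Fubini turns the integral into a product. -/
theorem integral_sq_le_mul (hL : 0 < L) (hw : ContDiff ℝ 1 w) (hc : HasCompactSupport w)
    (h0 : ∀ z, 0 ≤ w z) :
    ∫ z, w z ^ 2 ∂(stripMeasure L) ≤ (1 / 2 * ∫ z, |fderiv ℝ w z ex| ∂(stripMeasure L)) *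
      ∫ z, (1 / L * w z + |fderiv ℝ w z ey|) ∂(stripMeasure L) := by
  have i1 : Integrable (fun z => |fderiv ℝ w z ex|) (stripMeasure L) :=
    (integrable_strip (continuous_fderiv_dir hw ex) (hasCompactSupport_fderiv_dir hc ex)).abs
  have i2 : Integrable (fun z => 1 / L * w z + |fderiv ℝ w z ey|) (stripMeasure L) :=
    ((integrable_strip hw.continuous hc).const_mul _).add
    (integrable_strip (continuous_fderiv_dir hw ey) (hasCompactSupport_fderiv_dir hc ey)).abs
  have i3 : Integrable (fun z => w z ^ 2) (stripMeasure L) :=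
    integrable_strip (hw.continuous.pow 2) (hasCompactSupport_of_imp hc fun z hz => by simp [hz])
  have e1 : ∫ z, |fderiv ℝ w z ex| ∂(stripMeasure L)
      = ∫ y, (∫ x, |fderiv ℝ w (x, y) ex|) ∂(sectionMeasure L) := by
    rw [stripMeasure_eq] at i1 ⊢
    exact integral_prod_symm _ i1
  have i1' : Integrable (fun y => ∫ x, |fderiv ℝ w (x, y) ex|) (sectionMeasure L) := by
    rw [stripMeasure_eq] at i1
    exact i1.integral_prod_right
  rw [e1]
  rw [stripMeasure_eq] at i2 i3 ⊢
  rw [integral_prod _ i2, integral_prod _ i3, ← integral_const_mul]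
  refine integral_mono i3.integral_prod_left (i2.integral_prod_left.const_mul _) fun x => ?_
  have e2 : ∀ G : ℝ, 1 / 2 * (∫ y, (∫ x, |fderiv ℝ w (x, y) ex|) ∂(sectionMeasure L)) * G
      = ∫ y, (1 / 2 * ∫ x, |fderiv ℝ w (x, y) ex|) * G ∂(sectionMeasure L) := by
    intro G
    rw [integral_mul_const, integral_const_mul]
  dsimp only
  rw [e2]
  refine integral_mono_ae (integrable_section ((hw.continuous.comp (by fun_prop)).pow 2))
    ((i1'.const_mul _).mul_const _) (ae_section fun y hy => ?_)
  dsimp only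
  rw [sq]
  exact mul_le_mul (le_integral_slice_fst hw hc x y) (le_integral_slice_snd hL hw x hy) (h0 _)
    (by have : 0 ≤ ∫ x, |fderiv ℝ w (x, y) ex| := integral_nonneg fun _ => abs_nonneg _
        positivity)

/-- The first factor of w · w is now kept and integrated over the section, so that smallness of all
sections becomes smallness of the integral of w². -/
theorem integral_sq_le_of_slice (hL : 0 < L) (hw : ContDiff ℝ 1 w) (hc : HasCompactSupport w)
    (h0 : ∀ z, 0 ≤ w z) {A : ℝ} (hA : ∀ x, ∫ y, w (x, y) ∂(sectionMeasure L) ≤ A) :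
    ∫ z, w z ^ 2 ∂(stripMeasure L) ≤ A *
      ∫ z, (1 / L * w z + |fderiv ℝ w z ey|) ∂(stripMeasure L) := by
  have i2 : Integrable (fun z => 1 / L * w z + |fderiv ℝ w z ey|) (stripMeasure L) :=
    ((integrable_strip hw.continuous hc).const_mul _).add
    (integrable_strip (continuous_fderiv_dir hw ey) (hasCompactSupport_fderiv_dir hc ey)).abs
  have i3 : Integrable (fun z => w z ^ 2) (stripMeasure L) :=
    integrable_strip (hw.continuous.pow 2) (hasCompactSupport_of_imp hc fun z hz => by simp [hz])
  rw [stripMeasure_eq] at i2 i3 ⊢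
  rw [integral_prod _ i2, integral_prod _ i3, ← integral_const_mul]
  refine integral_mono i3.integral_prod_left (i2.integral_prod_left.const_mul _) fun x => ?_
  dsimp only
  set G := ∫ y, (1 / L * w (x, y) + |fderiv ℝ w (x, y) ey|) ∂(sectionMeasure L) with hG
  have hG0 : 0 ≤ G := integral_nonneg fun y =>
    add_nonneg (mul_nonneg (by positivity) (h0 _)) (abs_nonneg _)
  calc ∫ y, w (x, y) ^ 2 ∂(sectionMeasure L) ≤ ∫ y, w (x, y) * G ∂(sectionMeasure L) := by
        refine integral_mono_ae (integrable_section ((hw.continuous.comp (by fun_prop)).pow 2))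
          ((integrable_section (hw.continuous.comp (by fun_prop))).mul_const _)
          (ae_section fun y hy => ?_)
        dsimp only
        rw [sq]
        exact mul_le_mul_of_nonneg_left (le_integral_slice_snd hL hw x hy) (h0 _)
    _ = (∫ y, w (x, y) ∂(sectionMeasure L)) * G := integral_mul_const _ _
    _ ≤ A * G := mul_le_mul_of_nonneg_right (hA x) hG0

end Nonneg

end DeltaStrip

/-! ### Trace inequalities and Sobolev embedding for smooth functions. -/

namespace DeltaStrip

namespace IsCc

variable {φ : ℝ × ℝ → ℂ} (h : IsCc φ)
include h

theorem contDiff_one : ContDiff ℝ 1 φ := h.smooth.of_le (by exact_mod_cast le_top)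

theorem continuous : Continuous φ := h.smooth.continuous

theorem continuous_fderiv (e : ℝ × ℝ) : Continuous (fun z => fderiv ℝ φ z e) :=
  continuous_fderiv_dir h.contDiff_one e

theorem hasCompactSupport_fderiv (e : ℝ × ℝ) : HasCompactSupport (fun z => fderiv ℝ φ z e) :=
  hasCompactSupport_fderiv_dir h.cpt e

theorem differentiable : Differentiable ℝ φ := h.contDiff_one.differentiable one_ne_zero

theorem contDiff_norm_sq_pow (j : ℕ) : ContDiff ℝ 1 (fun z => (‖φ z‖ ^ 2) ^ j) :=
  (h.contDiff_one.norm_sq ℝ).pow j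

theorem hasCompactSupport_norm_sq_pow {j : ℕ} (hj : j ≠ 0) :
    HasCompactSupport (fun z => (‖φ z‖ ^ 2) ^ j) :=
  hasCompactSupport_of_imp h.cpt fun z hz => by simp [hz, hj]

theorem abs_fderiv_norm_sq_pow_le {j : ℕ} (hj : j ≠ 0) (z e : ℝ × ℝ) :
    |fderiv ℝ (fun z => (‖φ z‖ ^ 2) ^ j) z e| ≤
      2 * j * (‖φ z‖ ^ (2 * j - 1) * ‖fderiv ℝ φ z e‖) := by
  have h1 := ((h.differentiable z).hasFDerivAt.norm_sq).pow j
  rw [h1.fderiv]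
  simp only [_root_.smul_apply, ContinuousLinearMap.comp_apply, innerSL_apply_apply,
    smul_eq_mul, nsmul_eq_mul, Nat.cast_ofNat]
  have h2 := abs_real_inner_le_norm (φ z) (fderiv ℝ φ z e)
  rw [abs_mul, abs_mul, abs_mul, abs_two]
  obtain ⟨i, rfl⟩ : ∃ i, j = i + 1 := ⟨j - 1, by omega⟩
  have e1 : 2 * (i + 1) - 1 = 2 * i + 1 := by omega
  rw [e1, Nat.add_sub_cancel, Nat.abs_cast, abs_of_nonneg (a := (‖φ z‖ ^ 2) ^ i) (by positivity)]
  calc ((i + 1 : ℕ) : ℝ) * (‖φ z‖ ^ 2) ^ i * (2 * |inner ℝ (φ z) (fderiv ℝ φ z e)|)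
      ≤ ((i + 1 : ℕ) : ℝ) * (‖φ z‖ ^ 2) ^ i * (2 * (‖φ z‖ * ‖fderiv ℝ φ z e‖)) := by gcongr
    _ = _ := by rw [← pow_mul]; ring

end IsCc

/-- The square of the `H¹` norm on the strip of a smooth function. -/
noncomputable def smoothSq (L : ℝ) (φ : ℝ × ℝ → ℂ) : ℝ :=
  ∫ z, ‖φ z‖ ^ 2 ∂(stripMeasure L) + ∫ z, ‖fderiv ℝ φ z ex‖ ^ 2 ∂(stripMeasure L)
    + ∫ z, ‖fderiv ℝ φ z ey‖ ^ 2 ∂(stripMeasure L)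

theorem integrable_norm_pow {L : ℝ} {f : ℝ × ℝ → ℂ} (hf : Continuous f)
    (hc : HasCompactSupport f) {n : ℕ} (hn : n ≠ 0) :
    Integrable (fun z => ‖f z‖ ^ n) (stripMeasure L) :=
  integrable_strip (hf.norm.pow n) (hasCompactSupport_of_imp hc fun z hz => by simp [hz, hn])

theorem integrable_norm_pow_mul {L : ℝ} {f g : ℝ × ℝ → ℂ} (hf : Continuous f) (hg : Continuous g)
    (hc : HasCompactSupport g) (n : ℕ) :
    Integrable (fun z => ‖f z‖ ^ n * ‖g z‖) (stripMeasure L) :=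
  integrable_strip ((hf.norm.pow n).mul hg.norm)
    (hasCompactSupport_of_imp hc fun z hz => by simp [hz])

/-- The slice bound for |φ|² combined with 2 |φ| |∂ₓφ| ≤ a |φ|² + |∂ₓφ|² / a. The weight a stays
free, to be chosen in terms of γ and ω. -/
theorem slice_sq_le {L : ℝ} {φ : ℝ × ℝ → ℂ} (h : IsCc φ) (x : ℝ) {a : ℝ} (ha : 0 < a) :
    ∫ y, ‖φ (x, y)‖ ^ 2 ∂(sectionMeasure L) ≤
      1 / 2 * (a * ∫ z, ‖φ z‖ ^ 2 ∂(stripMeasure L)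
        + 1 / a * ∫ z, ‖fderiv ℝ φ z ex‖ ^ 2 ∂(stripMeasure L)) := by
  have i1 := integrable_norm_pow (L := L) h.continuous h.cpt two_ne_zero
  have i2 := integrable_norm_pow (L := L) (h.continuous_fderiv ex) (h.hasCompactSupport_fderiv ex)
    two_ne_zero
  have i3 : Integrable (fun z => 1 / 2 * (a * ‖φ z‖ ^ 2 + 1 / a * ‖fderiv ℝ φ z ex‖ ^ 2))
      (stripMeasure L) := ((i1.const_mul a).add (i2.const_mul (1 / a))).const_mul _
  have e : 1 / 2 * (a * ∫ z, ‖φ z‖ ^ 2 ∂(stripMeasure L)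
        + 1 / a * ∫ z, ‖fderiv ℝ φ z ex‖ ^ 2 ∂(stripMeasure L)) =
      ∫ z, 1 / 2 * (a * ‖φ z‖ ^ 2 + 1 / a * ‖fderiv ℝ φ z ex‖ ^ 2) ∂(stripMeasure L) := by
    rw [integral_const_mul, integral_add (i1.const_mul a) (i2.const_mul (1 / a)),
      integral_const_mul, integral_const_mul]
  rw [e]
  rw [stripMeasure_eq] at i3 ⊢
  rw [integral_prod_symm _ i3]
  refine integral_mono (integrable_section ((h.continuous.comp (by fun_prop)).norm.pow 2))
    i3.integral_prod_right fun y => ?_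
  dsimp only
  have h1 := le_integral_slice_fst (h.contDiff_norm_sq_pow 1)
    (h.hasCompactSupport_norm_sq_pow one_ne_zero) x y
  simp only [pow_one] at h1
  refine h1.trans ?_
  rw [← integral_const_mul]
  have c1 : Continuous (fun s => ‖φ (s, y)‖ ^ 2) :=
    (h.continuous.comp (by fun_prop)).norm.pow 2
  have c2 : Continuous (fun s => ‖fderiv ℝ φ (s, y) ex‖ ^ 2) :=
    ((h.continuous_fderiv ex).comp (by fun_prop)).norm.pow 2
  have s1 : HasCompactSupport (fun s => ‖φ (s, y)‖ ^ 2) :=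
    hasCompactSupport_of_imp (hasCompactSupport_slice_fst h.cpt y) fun z hz => by simp [hz]
  have s2 : HasCompactSupport (fun s => ‖fderiv ℝ φ (s, y) ex‖ ^ 2) :=
    hasCompactSupport_of_imp (hasCompactSupport_slice_fst (h.hasCompactSupport_fderiv ex) y)
      fun z hz => by simp [hz]
  have hcd := h.contDiff_norm_sq_pow 1
  have hcs := h.hasCompactSupport_norm_sq_pow one_ne_zero
  simp only [pow_one] at hcd hcs
  refine integral_mono ?_ ?_ fun s => ?_
  · refine Integrable.const_mul (Integrable.abs ?_) _
    refine Continuous.integrable_of_hasCompactSupport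
      ((continuous_fderiv_dir hcd ex).comp (by fun_prop))
      (hasCompactSupport_slice_fst (hasCompactSupport_fderiv_dir hcs ex) y)
  · exact (((c1.integrable_of_hasCompactSupport s1).const_mul _).add
      ((c2.integrable_of_hasCompactSupport s2).const_mul _)).const_mul _
  · have h2 := h.abs_fderiv_norm_sq_pow_le one_ne_zero (s, y) ex
    simp only [pow_one, Nat.cast_one, mul_one, Nat.add_one_sub_one] at h2
    dsimp only
    refine mul_le_mul_of_nonneg_left (h2.trans ?_) (by norm_num)
    have h3 := sq_nonneg (a * ‖φ (s, y)‖ - ‖fderiv ℝ φ (s, y) ex‖)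
    have h4 : a * ‖φ (s, y)‖ ^ 2 + 1 / a * ‖fderiv ℝ φ (s, y) ex‖ ^ 2
        - 2 * (‖φ (s, y)‖ * ‖fderiv ℝ φ (s, y) ex‖)
        = 1 / a * (a * ‖φ (s, y)‖ - ‖fderiv ℝ φ (s, y) ex‖) ^ 2 := by
      field_simp; ring
    have : 0 ≤ 1 / a * (a * ‖φ (s, y)‖ - ‖fderiv ℝ φ (s, y) ex‖) ^ 2 := by positivity
    linarith

/-- The part of the plane with bounded lengthwise variable. -/
def slab (R : ℝ) : Set (ℝ × ℝ) := Set.Icc (-R) R ×ˢ Set.univ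

theorem measurableSet_slab (R : ℝ) : MeasurableSet (slab R) :=
  measurableSet_Icc.prod MeasurableSet.univ

/-- Here the derivative carries a small weight and the mass is taken over |x| ≤ 1 only; with local
L² compactness this makes the trace a compact map. -/
theorem slice_sq_le_slab {L : ℝ} {φ : ℝ × ℝ → ℂ} (h : IsCc φ) {δ : ℝ} (hδ : 0 < δ) :
    ∫ y, ‖φ (0, y)‖ ^ 2 ∂(sectionMeasure L) ≤
      (1 + 1 / δ) * ∫ z in slab 1, ‖φ z‖ ^ 2 ∂(stripMeasure L)
        + δ * ∫ z, ‖fderiv ℝ φ z ex‖ ^ 2 ∂(stripMeasure L) := by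
  have i1 := (integrable_norm_pow (L := L) h.continuous h.cpt two_ne_zero).integrableOn
    (s := slab 1)
  have i2 := (integrable_norm_pow (L := L) (h.continuous_fderiv ex) (h.hasCompactSupport_fderiv ex)
    two_ne_zero).integrableOn (s := slab 1)
  have hle : ∫ z in slab 1, ‖fderiv ℝ φ z ex‖ ^ 2 ∂(stripMeasure L) ≤
      ∫ z, ‖fderiv ℝ φ z ex‖ ^ 2 ∂(stripMeasure L) :=
    setIntegral_le_integral (integrable_norm_pow (L := L) (h.continuous_fderiv ex)
      (h.hasCompactSupport_fderiv ex) two_ne_zero) (Eventually.of_forall fun z => by positivity)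
  refine le_trans ?_ (add_le_add_right (mul_le_mul_of_nonneg_left hle hδ.le) _)
  have i3 : IntegrableOn (fun z => (1 + 1 / δ) * ‖φ z‖ ^ 2 + δ * ‖fderiv ℝ φ z ex‖ ^ 2)
    (slab 1) (stripMeasure L) := (i1.const_mul _).add (i2.const_mul _)
  have e : (1 + 1 / δ) * ∫ z in slab 1, ‖φ z‖ ^ 2 ∂(stripMeasure L)
        + δ * ∫ z in slab 1, ‖fderiv ℝ φ z ex‖ ^ 2 ∂(stripMeasure L) =
      ∫ z in slab 1, ((1 + 1 / δ) * ‖φ z‖ ^ 2 + δ * ‖fderiv ℝ φ z ex‖ ^ 2) ∂(stripMeasure L) := by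
    rw [integral_add (i1.const_mul _) (i2.const_mul _), integral_const_mul, integral_const_mul]
  rw [e]
  have em : (stripMeasure L).restrict (slab 1) =
      (volume.restrict (Set.Icc (-1) 1)).prod (sectionMeasure L) := by
    have := Measure.prod_restrict (μ := (volume : Measure ℝ)) (ν := sectionMeasure L)
      (Set.Icc (-1) 1) Set.univ
    rw [Measure.restrict_univ] at this
    rw [stripMeasure_eq, slab, this]
  rw [IntegrableOn] at i3
  rw [em] at i3 ⊢
  rw [integral_prod_symm _ i3]
  refine integral_mono (integrable_section ((h.continuous.comp (by fun_prop)).norm.pow 2))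
    i3.integral_prod_right fun y => ?_
  dsimp only
  have c1 : Continuous (fun s => ‖φ (s, y)‖ ^ 2) :=
    (h.continuous.comp (by fun_prop)).norm.pow 2
  have c2 : Continuous (fun s => ‖fderiv ℝ φ (s, y) ex‖ ^ 2) :=
    ((h.continuous_fderiv ex).comp (by fun_prop)).norm.pow 2
  have hcd := h.contDiff_norm_sq_pow 1
  simp only [pow_one] at hcd
  have c3 : Continuous (fun s => |fderiv ℝ (fun z => ‖φ z‖ ^ 2) (s, y) ex|) :=
    ((continuous_fderiv_dir hcd ex).comp (by fun_prop)).abs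
  -- The value at 0 is compared with the value at each ξ in [0, 1], to be averaged over ξ.
  have key : ∀ ξ ∈ Set.Icc (0 : ℝ) 1, ‖φ (0, y)‖ ^ 2 ≤ ‖φ (ξ, y)‖ ^ 2 +
      ∫ s in Set.Icc (0 : ℝ) 1, |fderiv ℝ (fun z => ‖φ z‖ ^ 2) (s, y) ex| := by
    intro ξ hξ
    have := abs_sub_le_integral_abs_deriv (f := fun s => ‖φ (s, y)‖ ^ 2)
      (hcd.comp (contDiff_prodMk_left y)) (a := 0) (b := 1) (y := 0) (η := ξ) (by simp) hξ
    rw [deriv_slice_fst hcd] at this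
    have := (abs_le.1 this).2
    simp only [Real.norm_eq_abs] at this
    linarith
  have h2 := setIntegral_mono_on (μ := volume) (integrable_const _)
      (c1.integrableOn_Icc.add (integrable_const _)) measurableSet_Icc key
  rw [integral_add' c1.integrableOn_Icc (integrable_const _)] at h2
  simp only [integral_const, smul_eq_mul, Measure.real, Measure.restrict_apply MeasurableSet.univ,
    Set.univ_inter, Real.volume_Icc, sub_zero, ENNReal.toReal_ofReal zero_le_one, one_mul] at h2
  rw [← integral_add c1.integrableOn_Icc c3.integrableOn_Icc] at h2
  refine h2.trans ?_
  have c4 : Continuous (fun s => (1 + 1 / δ) * ‖φ (s, y)‖ ^ 2 + δ * ‖fderiv ℝ φ (s, y) ex‖ ^ 2) :=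
    (c1.const_mul _).add (c2.const_mul _)
  refine le_trans ?_ (setIntegral_mono_set (s := Set.Icc (0:ℝ) 1) c4.integrableOn_Icc
    (Eventually.of_forall fun s => by positivity)
    (LE.le.eventuallyLE (Set.Icc_subset_Icc (by norm_num) le_rfl)))
  refine integral_mono (c1.add c3).integrableOn_Icc c4.integrableOn_Icc fun s => ?_
  have h2 := h.abs_fderiv_norm_sq_pow_le one_ne_zero (s, y) ex
  simp only [pow_one, Nat.cast_one, mul_one, Nat.add_one_sub_one] at h2
  dsimp only
  have h4 : 1 / δ * ‖φ (s, y)‖ ^ 2 + δ * ‖fderiv ℝ φ (s, y) ex‖ ^ 2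
        - 2 * (‖φ (s, y)‖ * ‖fderiv ℝ φ (s, y) ex‖)
        = 1 / δ * (‖φ (s, y)‖ - δ * ‖fderiv ℝ φ (s, y) ex‖) ^ 2 := by
      field_simp; ring
  have : 0 ≤ 1 / δ * (‖φ (s, y)‖ - δ * ‖fderiv ℝ φ (s, y) ex‖) ^ 2 := by positivity
  linarith

/-- Above 1/ε the higher power dominates, below it the linear term does. It serves to absorb an
intermediate power. -/
theorem pow_le_eps_add {T ε : ℝ} (hT : 0 ≤ T) (hε : 0 < ε) (n : ℕ) :
    T ^ (n + 1) ≤ ε * T ^ (n + 2) + (1 / ε) ^ n * T := by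
  rcases le_total (1 / ε) T with h | h
  · have h1 : 1 ≤ ε * T := by
      have := mul_le_mul_of_nonneg_left h hε.le
      rwa [mul_one_div_cancel hε.ne'] at this
    have h2 := mul_le_mul_of_nonneg_right h1 (pow_nonneg hT (n + 1))
    have : 0 ≤ (1 / ε) ^ n * T := by positivity
    calc T ^ (n + 1) = 1 * T ^ (n + 1) := by ring
      _ ≤ ε * T * T ^ (n + 1) := h2
      _ = ε * T ^ (n + 2) := by ring
      _ ≤ _ := by linarith
  · have h1 : T ^ n ≤ (1 / ε) ^ n := pow_le_pow_left₀ hT h n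
    have h2 := mul_le_mul_of_nonneg_right h1 hT
    have : 0 ≤ ε * T ^ (n + 2) := by positivity
    calc T ^ (n + 1) = T ^ n * T := by ring
      _ ≤ (1 / ε) ^ n * T := h2
      _ ≤ _ := by linarith

theorem integral_mul_le_sqrt {L : ℝ} {f g : ℝ × ℝ → ℂ} (hf : Continuous f) (hg : Continuous g)
    (hcf : HasCompactSupport f) (hc : HasCompactSupport g) {n : ℕ} (hn : n ≠ 0) :
    ∫ z, ‖f z‖ ^ n * ‖g z‖ ∂(stripMeasure L) ≤
      √((∫ z, ‖f z‖ ^ (2 * n) ∂(stripMeasure L)) * ∫ z, ‖g z‖ ^ 2 ∂(stripMeasure L)) := by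
  refine Real.le_sqrt_of_sq_le ?_
  have h := integral_mul_sq_le (μ := stripMeasure L) (f := fun z => ‖f z‖ ^ n)
    (g := fun z => ‖g z‖)
    (by simpa only [← pow_mul] using integrable_norm_pow hf hcf (n := n * 2) (by omega))
    (integrable_norm_pow hg hc two_ne_zero) (integrable_norm_pow_mul hf hg hc n)
  simpa only [← pow_mul, mul_comm n 2] using h

/-- Embedding of H¹ in L^(4j), with j = i + 1, by Gagliardo's inequality for |φ|^(2j). The
derivatives of this function are of size |φ|^(2j-1) |∂φ|, so Cauchy–Schwarz brings in S, the
integral of |φ|^(4j-2), and gives a ≤ B S for the wanted integral a. As 2 ≤ 4j - 2 < 4j, S is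
interpolated and half of a absorbed. -/
theorem integral_pow_le {L : ℝ} (hL : 0 < L) (i : ℕ) (M : ℝ) (hM : 0 < M) :
    ∃ C : ℝ, 0 ≤ C ∧ ∀ φ, IsCc φ → smoothSq L φ ≤ M →
      ∫ z, ‖φ z‖ ^ (4 * (i + 1)) ∂(stripMeasure L) ≤ C := by
  set j := i + 1 with hj
  -- B collects the constants 2j/2 and 1/L + 2j of the two Gagliardo factors and the bound M from
  -- Cauchy–Schwarz. K is the interpolation constant for ε = 1/(2B), which turns a ≤ B S into a ≤
  -- a/2 + B K M.
  set B : ℝ := j * (1 / L + 2 * j) * M with hB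
  have hBpos : 0 < B := by positivity
  set K : ℝ := (2 * B) ^ (2 * i) with hK
  refine ⟨2 * B * K * M, by positivity, fun φ h hφ => ?_⟩
  set w : ℝ × ℝ → ℝ := fun z => (‖φ z‖ ^ 2) ^ j with hw
  have hj0 : j ≠ 0 := by omega
  have hn0 : 2 * j - 1 ≠ 0 := by omega
  have hwc := h.contDiff_norm_sq_pow j
  have hws := h.hasCompactSupport_norm_sq_pow hj0
  have m0 : 0 ≤ ∫ z, ‖φ z‖ ^ 2 ∂(stripMeasure L) := integral_nonneg fun _ => by positivity
  have m1 : 0 ≤ ∫ z, ‖fderiv ℝ φ z ex‖ ^ 2 ∂(stripMeasure L) :=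
    integral_nonneg fun _ => by positivity
  have m2 : 0 ≤ ∫ z, ‖fderiv ℝ φ z ey‖ ^ 2 ∂(stripMeasure L) :=
    integral_nonneg fun _ => by positivity
  rw [smoothSq] at hφ
  set S := ∫ z, ‖φ z‖ ^ (2 * (2 * j - 1)) ∂(stripMeasure L) with hS
  have hS0 : 0 ≤ S := integral_nonneg fun _ => by positivity
  set a := ∫ z, ‖φ z‖ ^ (4 * j) ∂(stripMeasure L) with ha
  have key := integral_sq_le_mul hL hwc hws (fun z => by positivity)
  have d : ∀ e, ∫ z, ‖fderiv ℝ φ z e‖ ^ 2 ∂(stripMeasure L) ≤ M →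
      ∫ z, |fderiv ℝ w z e| ∂(stripMeasure L) ≤ 2 * j * √(S * M) := by
    intro e he
    calc ∫ z, |fderiv ℝ w z e| ∂(stripMeasure L)
        ≤ ∫ z, 2 * j * (‖φ z‖ ^ (2 * j - 1) * ‖fderiv ℝ φ z e‖) ∂(stripMeasure L) := by
          refine integral_mono (integrable_strip (continuous_fderiv_dir hwc e)
            (hasCompactSupport_fderiv_dir hws e)).abs ?_
            fun z => h.abs_fderiv_norm_sq_pow_le hj0 z e
          exact (integrable_norm_pow_mul h.continuous (h.continuous_fderiv e)
            (h.hasCompactSupport_fderiv e) _).const_mul _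
      _ = 2 * j * ∫ z, (‖φ z‖ ^ (2 * j - 1) * ‖fderiv ℝ φ z e‖) ∂(stripMeasure L) :=
          integral_const_mul _ _
      _ ≤ 2 * j * √(S * M) := by
          refine mul_le_mul_of_nonneg_left ((integral_mul_le_sqrt h.continuous
            (h.continuous_fderiv e) h.cpt (h.hasCompactSupport_fderiv e) hn0).trans ?_)
            (by positivity)
          exact Real.sqrt_le_sqrt (mul_le_mul_of_nonneg_left he hS0)
  have d1 := d ex (by linarith)
  have d2 := d ey (by linarith)
  have d3 : ∫ z, w z ∂(stripMeasure L) ≤ √(S * M) := by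
    have e : ∀ z, w z = ‖φ z‖ ^ (2 * j - 1) * ‖φ z‖ := by
      intro z
      rw [← pow_succ]
      change (‖φ z‖ ^ 2) ^ j = _
      rw [← pow_mul]
      congr 1
    simp only [e]
    refine ((integral_mul_le_sqrt h.continuous h.continuous h.cpt h.cpt hn0).trans ?_)
    exact Real.sqrt_le_sqrt (mul_le_mul_of_nonneg_left (by linarith) hS0)
  have e4 : ∫ z, w z ^ 2 ∂(stripMeasure L) = a := by
    refine integral_congr_ae (Eventually.of_forall fun z => ?_)
    simp only [hw, ← pow_mul]
    congr 1; ring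
  have e5 : ∫ z, (1 / L * w z + |fderiv ℝ w z ey|) ∂(stripMeasure L) =
      1 / L * ∫ z, w z ∂(stripMeasure L) + ∫ z, |fderiv ℝ w z ey| ∂(stripMeasure L) := by
    rw [integral_add ((integrable_strip hwc.continuous hws).const_mul _)
      (integrable_strip (continuous_fderiv_dir hwc ey) (hasCompactSupport_fderiv_dir hws ey)).abs,
      integral_const_mul]
  have p3 : 0 ≤ ∫ z, |fderiv ℝ w z ex| ∂(stripMeasure L) := integral_nonneg fun _ => abs_nonneg _
  have a1 : a ≤ B * S := by
    rw [← e4]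
    refine key.trans ?_
    rw [e5]
    calc _ ≤ (1 / 2 * (2 * j * √(S * M))) * (1 / L * √(S * M) + 2 * j * √(S * M)) := by
          gcongr
      _ = j * (1 / L + 2 * j) * (√(S * M) * √(S * M)) := by ring
      _ = B * S := by rw [Real.mul_self_sqrt (by positivity), hB]; ring
  have a2 : S ≤ 1 / (2 * B) * a + K * M := by
    have i2 := integrable_norm_pow (L := L) h.continuous h.cpt (n := 4 * j) (by omega)
    have i3 := integrable_norm_pow (L := L) h.continuous h.cpt two_ne_zero
    calc S ≤ ∫ z, (1 / (2 * B) * ‖φ z‖ ^ (4 * j) + K * ‖φ z‖ ^ 2) ∂(stripMeasure L) := by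
          refine integral_mono (integrable_norm_pow (L := L) h.continuous h.cpt (by omega))
            ((i2.const_mul _).add (i3.const_mul _)) fun z => ?_
          have := pow_le_eps_add (T := ‖φ z‖ ^ 2) (ε := 1 / (2 * B)) (by positivity)
            (by positivity) (2 * i)
          simp only [← pow_mul, one_div_one_div] at this
          have t1 : 2 * (2 * j - 1) = 2 * (2 * i + 1) := by omega
          have t2 : 4 * j = 2 * (2 * i + 2) := by omega
          rw [t2]
          dsimp only
          rw [t1]
          exact this
      _ = 1 / (2 * B) * a + K * ∫ z, ‖φ z‖ ^ 2 ∂(stripMeasure L) := by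
          rw [integral_add (i2.const_mul _) (i3.const_mul _), integral_const_mul,
            integral_const_mul]
      _ ≤ _ := by gcongr; linarith
  have a3 : B * S ≤ B * (1 / (2 * B) * a + K * M) := by gcongr
  have a4 : B * (1 / (2 * B) * a + K * M) = a / 2 + B * K * M := by field_simp
  linarith

/-- Substitute for Lions' vanishing lemma: if all sections have small L² mass, the L⁴ norm is small.
-/
theorem integral_pow_four_le_of_slice {L : ℝ} (hL : 0 < L) {φ : ℝ × ℝ → ℂ} (h : IsCc φ) {A : ℝ}
    (hA : ∀ x, ∫ y, ‖φ (x, y)‖ ^ 2 ∂(sectionMeasure L) ≤ A) :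
    ∫ z, ‖φ z‖ ^ 4 ∂(stripMeasure L) ≤ A * ((1 / L + 1) * smoothSq L φ) := by
  have hwc := h.contDiff_norm_sq_pow 1
  have hws := h.hasCompactSupport_norm_sq_pow one_ne_zero
  have key := integral_sq_le_of_slice hL hwc hws (fun z => by positivity) (A := A)
    (by simpa using hA)
  have hA0 : 0 ≤ A := (integral_nonneg fun _ => by positivity).trans (hA 0)
  simp only [pow_one] at key hwc hws
  have e : ∀ z, (‖φ z‖ ^ 2) ^ 2 = ‖φ z‖ ^ 4 := fun z => by ring
  simp only [e] at key
  refine key.trans (mul_le_mul_of_nonneg_left ?_ hA0)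
  have i1 := integrable_norm_pow (L := L) h.continuous h.cpt two_ne_zero
  have i2 := integrable_norm_pow (L := L) (h.continuous_fderiv ey) (h.hasCompactSupport_fderiv ey)
    two_ne_zero
  have m0 : 0 ≤ ∫ z, ‖φ z‖ ^ 2 ∂(stripMeasure L) := integral_nonneg fun _ => by positivity
  have m1 : 0 ≤ ∫ z, ‖fderiv ℝ φ z ex‖ ^ 2 ∂(stripMeasure L) :=
    integral_nonneg fun _ => by positivity
  have m2 : 0 ≤ ∫ z, ‖fderiv ℝ φ z ey‖ ^ 2 ∂(stripMeasure L) :=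
    integral_nonneg fun _ => by positivity
  calc _ ≤ ∫ z, ((1 / L + 1) * ‖φ z‖ ^ 2 + ‖fderiv ℝ φ z ey‖ ^ 2) ∂(stripMeasure L) := by
        refine integral_mono ((i1.const_mul _).add (integrable_strip (continuous_fderiv_dir hwc ey)
          (hasCompactSupport_fderiv_dir hws ey)).abs) ((i1.const_mul _).add i2) fun z => ?_
        have h2 := h.abs_fderiv_norm_sq_pow_le one_ne_zero z ey
        simp only [pow_one, Nat.cast_one, mul_one, Nat.add_one_sub_one] at h2
        dsimp only
        nlinarith [sq_nonneg (‖φ z‖ - ‖fderiv ℝ φ z ey‖)]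
    _ = (1 / L + 1) * ∫ z, ‖φ z‖ ^ 2 ∂(stripMeasure L)
        + ∫ z, ‖fderiv ℝ φ z ey‖ ^ 2 ∂(stripMeasure L) := by
        rw [integral_add (i1.const_mul _) i2, integral_const_mul]
    _ ≤ (1 / L + 1) * smoothSq L φ := by
        rw [smoothSq]
        have : 0 < 1 / L := by positivity
        nlinarith

end DeltaStrip

/-! ### Poincaré inequality on a grid of cells. -/

namespace DeltaStrip

/-- h k φ(z) minus the integral of φ is the integral over z' of φ(z) - φ(z'), which is bounded by
path integrals of the gradient; Cauchy–Schwarz converts these to L² norms. The factor 3 comes from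
the square of a sum of three terms. -/
theorem integral_sq_cell_le {φ : ℝ × ℝ → ℂ} (hφ : ContDiff ℝ 1 φ) (a b : ℝ) {h k : ℝ}
    (hh : 0 < h) (hk : 0 < k) :
    ∫ z in Set.Icc a (a + h) ×ˢ Set.Icc b (b + k), ‖φ z‖ ^ 2 ≤
      3 / (h * k) * ‖∫ z in Set.Icc a (a + h) ×ˢ Set.Icc b (b + k), φ z‖ ^ 2
      + 3 * h ^ 2 * (∫ z in Set.Icc a (a + h) ×ˢ Set.Icc b (b + k), ‖fderiv ℝ φ z ex‖ ^ 2)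
      + 3 * k ^ 2 * ∫ z in Set.Icc a (a + h) ×ˢ Set.Icc b (b + k), ‖fderiv ℝ φ z ey‖ ^ 2 := by
  set I := Set.Icc a (a + h) with hI
  set J := Set.Icc b (b + k) with hJ
  have hC : IsCompact (I ×ˢ J) := isCompact_Icc.prod isCompact_Icc
  have hCm : MeasurableSet (I ×ˢ J) := measurableSet_Icc.prod measurableSet_Icc
  have cx := continuous_fderiv_dir hφ ex
  have cy := continuous_fderiv_dir hφ ey
  have ig : ∀ {G : Type} [NormedAddCommGroup G] {f : ℝ × ℝ → G}, Continuous f →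
      IntegrableOn f (I ×ˢ J) := fun hf => hf.continuousOn.integrableOn_compact hC
  have vI : volume.real I = h := by simp [hI, hh.le]
  have vJ : volume.real J = k := by simp [hJ, hk.le]
  have vC : volume.real (I ×ˢ J) = h * k := by
    rw [Measure.volume_eq_prod, measureReal_prod_prod, vI, vJ]
  have iC : ∀ {G : Type} [NormedAddCommGroup G] [NormedSpace ℝ G] [CompleteSpace G] (v : G),
      ∫ _z in I ×ˢ J, v = (h * k) • v := by
    intro G _ _ _ v
    rw [setIntegral_const, vC]
  set α : ℝ → ℝ := fun y => ∫ s in I, ‖fderiv ℝ φ (s, y) ex‖ with hα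
  set β : ℝ → ℝ := fun x => ∫ s in J, ‖fderiv ℝ φ (x, s) ey‖ with hβ
  set α2 : ℝ → ℝ := fun y => ∫ s in I, ‖fderiv ℝ φ (s, y) ex‖ ^ 2 with hα2
  have cβ : Continuous β := continuous_parametric_integral_of_continuous
    (f := fun x s => ‖fderiv ℝ φ (x, s) ey‖) cy.norm isCompact_Icc
  have cα2 : Continuous α2 := continuous_parametric_integral_of_continuous
    (f := fun y s => ‖fderiv ℝ φ (s, y) ex‖ ^ 2)
    (by have := cx.comp continuous_swap; exact this.norm.pow 2) isCompact_Icc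
  -- The path from z to z' runs horizontally at the height of z, then vertically at the abscissa of
  -- z'. The bound is thus a function of z.2 plus a function of z'.1.
  have hdiff : ∀ z ∈ I ×ˢ J, ∀ z' ∈ I ×ˢ J, ‖φ z - φ z'‖ ≤ α z.2 + β z'.1 := by
    rintro ⟨x, y⟩ ⟨hx, hy⟩ ⟨x', y'⟩ ⟨hx', hy'⟩
    have h1 := abs_sub_le_integral_abs_deriv (f := fun s => φ (s, y))
      (hφ.comp (contDiff_prodMk_left y)) hx hx'
    have h2 := abs_sub_le_integral_abs_deriv (f := fun s => φ (x', s))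
      (hφ.comp (contDiff_prodMk_right x')) hy hy'
    rw [deriv_slice_fst hφ] at h1
    rw [deriv_slice_snd hφ] at h2
    calc ‖φ (x, y) - φ (x', y')‖ = ‖(φ (x, y) - φ (x', y)) + (φ (x', y) - φ (x', y'))‖ := by
          congr 1; ring
      _ ≤ _ := norm_add_le _ _
      _ ≤ _ := add_le_add h1 h2
  set B1 := ∫ z in I ×ˢ J, ‖fderiv ℝ φ z ey‖ with hB1
  have iβ : IntegrableOn (fun z : ℝ × ℝ => β z.1) (I ×ˢ J) := ig (cβ.comp continuous_fst)
  have iα2 : IntegrableOn (fun z : ℝ × ℝ => α2 z.2) (I ×ˢ J) := ig (cα2.comp continuous_snd)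
  have eβ : ∫ z in I ×ˢ J, β z.1 = k * B1 := by
    have e1 : ∫ z in I ×ˢ J, β z.1 = ∫ z in I ×ˢ J, β z.1 * 1 := by simp
    rw [e1, Measure.volume_eq_prod, setIntegral_prod_mul β (fun _ => (1 : ℝ)), hB1, Measure.volume_eq_prod,
      setIntegral_prod]
    · rw [setIntegral_const, vJ]; simp [hβ, mul_comm]
    · exact ig cy.norm
  have eα2 : ∫ z in I ×ˢ J, α2 z.2 = h * ∫ z in I ×ˢ J, ‖fderiv ℝ φ z ex‖ ^ 2 := by
    have e1 : ∫ z in I ×ˢ J, α2 z.2 = ∫ z in I ×ˢ J, 1 * α2 z.2 := by simp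
    rw [e1, Measure.volume_eq_prod, setIntegral_prod_mul (fun _ => (1 : ℝ))]
    rw [← Measure.prod_restrict, integral_prod_symm]
    · rw [setIntegral_const, vI]; simp [hα2]
    · have := ig (cx.norm.pow 2)
      rwa [IntegrableOn, Measure.volume_eq_prod, ← Measure.prod_restrict] at this
  set S := ∫ z in I ×ˢ J, φ z with hS
  set B2 := ∫ z in I ×ˢ J, ‖fderiv ℝ φ z ey‖ ^ 2 with hB2
  have hB12 : B1 ^ 2 ≤ h * k * B2 := by
    have := integral_mul_sq_le (μ := volume.restrict (I ×ˢ J)) (f := fun _ => (1 : ℝ))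
      (g := fun z => ‖fderiv ℝ φ z ey‖) (ig continuous_const) (ig (cy.norm.pow 2))
      (ig (continuous_const.mul cy.norm))
    simp only [one_mul, one_pow] at this
    rwa [iC, smul_eq_mul, mul_one] at this
  have hα12 : ∀ y, α y ^ 2 ≤ h * α2 y := by
    intro y
    have c : Continuous (fun s => ‖fderiv ℝ φ (s, y) ex‖) := (cx.comp (by fun_prop)).norm
    have := integral_mul_sq_le (μ := volume.restrict I) (f := fun _ => (1 : ℝ))
      (g := fun s => ‖fderiv ℝ φ (s, y) ex‖) (continuous_const.integrableOn_Icc)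
      ((c.pow 2).integrableOn_Icc) ((continuous_const.mul c).integrableOn_Icc)
    simp only [one_mul, one_pow] at this
    rwa [setIntegral_const, vI, smul_eq_mul, mul_one] at this
  have hB10 : 0 ≤ B1 := integral_nonneg fun _ => norm_nonneg _
  have pt : ∀ z ∈ I ×ˢ J, (h * k) ^ 2 * ‖φ z‖ ^ 2 ≤
      3 * ‖S‖ ^ 2 + 3 * (h * k) ^ 2 * h * α2 z.2 + 3 * k ^ 2 * (h * k) * B2 := by
    intro z hz
    have h1 : (h * k) • φ z - S = ∫ z' in I ×ˢ J, (φ z - φ z') := by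
      rw [integral_sub (ig continuous_const) (ig hφ.continuous), iC]
    have h2 : ‖(h * k) • φ z - S‖ ≤ h * k * α z.2 + k * B1 := by
      rw [h1]
      calc _ ≤ ∫ z' in I ×ˢ J, ‖φ z - φ z'‖ := norm_integral_le_integral_norm _
        _ ≤ ∫ z' in I ×ˢ J, (α z.2 + β z'.1) :=
            setIntegral_mono_on (ig (continuous_const.sub hφ.continuous).norm)
              ((ig continuous_const).add iβ) hCm (hdiff z hz)
        _ = _ := by
            rw [integral_add (ig continuous_const) iβ, iC, eβ, smul_eq_mul]
    have h3 : h * k * ‖φ z‖ ≤ ‖S‖ + h * k * α z.2 + k * B1 := by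
      have e : h * k * ‖φ z‖ = ‖(h * k) • φ z‖ := by
        rw [norm_smul, Real.norm_of_nonneg (by positivity)]
      rw [e]
      have := norm_add_le ((h * k) • φ z - S) S
      rw [sub_add_cancel] at this
      linarith
    have h4 : (h * k * ‖φ z‖) ^ 2 ≤ (‖S‖ + h * k * α z.2 + k * B1) ^ 2 :=
      pow_le_pow_left₀ (by positivity) h3 2
    have h5 := hα12 z.2
    have h6 : (h * k * α z.2) ^ 2 ≤ (h * k) ^ 2 * (h * α2 z.2) := by
      rw [mul_pow]; gcongr
    have h7 : (k * B1) ^ 2 ≤ k ^ 2 * (h * k * B2) := by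
      rw [mul_pow]; gcongr
    nlinarith [sq_nonneg (‖S‖ - h * k * α z.2), sq_nonneg (‖S‖ - k * B1),
      sq_nonneg (h * k * α z.2 - k * B1)]
  have isq : IntegrableOn (fun z => ‖φ z‖ ^ 2) (I ×ˢ J) := ig (hφ.continuous.norm.pow 2)
  have fin := setIntegral_mono_on (isq.const_mul ((h * k) ^ 2))
    (((ig continuous_const).add (iα2.const_mul (3 * (h * k) ^ 2 * h))).add
      (ig continuous_const)) hCm pt
  rw [integral_add' ((ig continuous_const).add (iα2.const_mul _)) (ig continuous_const),
    integral_add' (ig continuous_const) (iα2.const_mul _), integral_const_mul,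
    integral_const_mul] at fin
  simp only [integral_const_mul, iC, smul_eq_mul, eα2] at fin
  have hc : 0 < (h * k) ^ 2 := by positivity
  refine le_of_mul_le_mul_left (fin.trans (le_of_eq ?_)) hc
  field_simp

/-- A cell of the `n × n` grid of the rectangle `[-R, R] × [0, L]`. -/
def cell (L R : ℝ) (n i j : ℕ) : Set (ℝ × ℝ) :=
  Set.Icc (-R + i * (2 * R / n)) (-R + i * (2 * R / n) + 2 * R / n) ×ˢ
    Set.Icc (j * (L / n)) (j * (L / n) + L / n)

theorem setIntegral_rect_eq {g : ℝ × ℝ → ℝ} (hg : Continuous g) {a a' b b' : ℝ} (ha : a ≤ a')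
    (hb : b ≤ b') :
    ∫ z in Set.Icc a a' ×ˢ Set.Icc b b', g z = ∫ x in a..a', ∫ y in b..b', g (x, y) := by
  rw [Measure.volume_eq_prod, setIntegral_prod, integral_Icc_eq_integral_Ioc,
    intervalIntegral.integral_of_le ha]
  · simp only [integral_Icc_eq_integral_Ioc, intervalIntegral.integral_of_le hb]
  · exact hg.continuousOn.integrableOn_compact (isCompact_Icc.prod isCompact_Icc)

theorem sum_cell {g : ℝ × ℝ → ℝ} (hg : Continuous g) {L R : ℝ} (hL : 0 < L) (hR : 0 < R) {n : ℕ}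
    (hn : 0 < n) :
    ∑ i ∈ Finset.range n, ∑ j ∈ Finset.range n, ∫ z in cell L R n i j, g z =
      ∫ z in Set.Icc (-R) R ×ˢ Set.Icc 0 L, g z := by
  have hn' : (0 : ℝ) < n := by exact_mod_cast hn
  have e : ∀ i j, ∫ z in cell L R n i j, g z =
      ∫ x in (-R + (i : ℕ) * (2 * R / n))..(-R + (i + 1 : ℕ) * (2 * R / n)),
        ∫ y in ((j : ℕ) * (L / n))..((j + 1 : ℕ) * (L / n)), g (x, y) := by
    intro i j
    rw [cell, setIntegral_rect_eq hg (by simp; positivity) (by simp; positivity)]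
    have e1 : -R + (i : ℝ) * (2 * R / n) + 2 * R / n = -R + (i + 1 : ℕ) * (2 * R / n) := by
      push_cast; ring
    have e2 : (j : ℝ) * (L / n) + L / n = (j + 1 : ℕ) * (L / n) := by push_cast; ring
    rw [e1, e2]
  have cin : ∀ b b' : ℝ, Continuous (fun x => ∫ y in b..b', g (x, y)) := fun b b' => by
    have := intervalIntegral.continuous_parametric_intervalIntegral_of_continuous'
      (f := fun (x y : ℝ) => g (x, y)) (μ := volume) hg b b'
    exact this
  simp only [e]
  have e1 : ∀ i ∈ Finset.range n, ∑ j ∈ Finset.range n,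
      ∫ x in (-R + (i : ℕ) * (2 * R / n))..(-R + (i + 1 : ℕ) * (2 * R / n)),
        ∫ y in ((j : ℕ) * (L / n))..((j + 1 : ℕ) * (L / n)), g (x, y) =
      ∫ x in (-R + (i : ℕ) * (2 * R / n))..(-R + (i + 1 : ℕ) * (2 * R / n)),
        ∫ y in (0 : ℝ)..L, g (x, y) := by
    intro i _
    rw [← intervalIntegral.integral_finsetSum fun j _ => (cin _ _).intervalIntegrable _ _]
    refine intervalIntegral.integral_congr fun x _ => ?_
    have hs := intervalIntegral.sum_integral_adjacent_intervals (f := fun y => g (x, y))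
      (μ := volume) (a := fun j : ℕ => (j : ℝ) * (L / n)) (n := n)
      fun k _ => (hg.comp (by fun_prop : Continuous fun y : ℝ => (x, y))).intervalIntegrable _ _
    rw [hs]
    congr 1
    · simp
    · field_simp
  rw [Finset.sum_congr rfl e1]
  have hs := intervalIntegral.sum_integral_adjacent_intervals
      (f := fun x => ∫ y in (0 : ℝ)..L, g (x, y))
      (μ := volume) (a := fun i : ℕ => -R + (i : ℝ) * (2 * R / n)) (n := n)
      fun k _ => (cin _ _).intervalIntegrable _ _
  rw [hs, setIntegral_rect_eq hg (by linarith) hL.le]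
  congr 1
  · simp
  · field_simp; ring

theorem slab_inter_strip (L R : ℝ) : slab R ∩ strip L = Set.Icc (-R) R ×ˢ Set.Icc 0 L := by
  ext ⟨x, y⟩
  simp only [slab, strip, Set.mem_inter_iff, Set.mem_prod, Set.mem_univ]
  tauto

theorem measurableSet_strip (L : ℝ) : MeasurableSet (strip L) :=
  MeasurableSet.univ.prod measurableSet_Icc

theorem setIntegral_slab_eq {F : Type*} [NormedAddCommGroup F] [NormedSpace ℝ F] (L R : ℝ)
    (g : ℝ × ℝ → F) :
    ∫ z in slab R, g z ∂(stripMeasure L) = ∫ z in Set.Icc (-R) R ×ˢ Set.Icc 0 L, g z := by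
  rw [stripMeasure, Measure.restrict_restrict (measurableSet_slab R), slab_inter_strip]

theorem cell_subset_strip {L R : ℝ} (hL : 0 < L) {n i j : ℕ} (hj : j < n) :
    cell L R n i j ⊆ strip L := by
  rintro ⟨x, y⟩ ⟨-, hy1, hy2⟩
  have hn' : (0 : ℝ) < n := by exact_mod_cast (by omega : 0 < n)
  refine ⟨trivial, le_trans (by positivity) hy1, hy2.trans ?_⟩
  have : ((j : ℝ) + 1) ≤ n := by exact_mod_cast hj
  calc (j : ℝ) * (L / n) + L / n = (j + 1) * (L / n) := by ring
    _ ≤ n * (L / n) := by gcongr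
    _ = L := by field_simp

theorem measurableSet_cell (L R : ℝ) (n i j : ℕ) : MeasurableSet (cell L R n i j) :=
  measurableSet_Icc.prod measurableSet_Icc

theorem setIntegral_cell_eq {F : Type*} [NormedAddCommGroup F] [NormedSpace ℝ F] {L R : ℝ}
    (hL : 0 < L) {n i j : ℕ} (hj : j < n) (g : ℝ × ℝ → F) :
    ∫ z in cell L R n i j, g z ∂(stripMeasure L) = ∫ z in cell L R n i j, g z := by
  rw [stripMeasure, Measure.restrict_restrict (measurableSet_cell L R n i j),
    Set.inter_eq_left.2 (cell_subset_strip hL hj)]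

/-- All that is needed of Rellich's theorem: up to a gradient error of order 1/n², the local mass is
controlled by finitely many cell integrals, and these are weakly continuous. -/
theorem integral_sq_slab_le {φ : ℝ × ℝ → ℂ} (h : IsCc φ) {L R : ℝ} (hL : 0 < L) (hR : 0 < R)
    {n : ℕ} (hn : 0 < n) :
    ∫ z in slab R, ‖φ z‖ ^ 2 ∂(stripMeasure L) ≤
      ∑ i ∈ Finset.range n, ∑ j ∈ Finset.range n, 3 / (2 * R / n * (L / n)) *
        ‖∫ z in cell L R n i j, φ z ∂(stripMeasure L)‖ ^ 2
      + 3 * (2 * R / n) ^ 2 * ∫ z, ‖fderiv ℝ φ z ex‖ ^ 2 ∂(stripMeasure L)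
      + 3 * (L / n) ^ 2 * ∫ z, ‖fderiv ℝ φ z ey‖ ^ 2 ∂(stripMeasure L) := by
  have hn' : (0 : ℝ) < n := by exact_mod_cast hn
  have hle : ∀ e, ∫ z in Set.Icc (-R) R ×ˢ Set.Icc 0 L, ‖fderiv ℝ φ z e‖ ^ 2 ≤
      ∫ z, ‖fderiv ℝ φ z e‖ ^ 2 ∂(stripMeasure L) := by
    intro e
    rw [← setIntegral_slab_eq]
    exact setIntegral_le_integral (integrable_norm_pow (L := L) (h.continuous_fderiv e)
      (h.hasCompactSupport_fderiv e) two_ne_zero) (Eventually.of_forall fun z => by positivity)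
  have hx := mul_le_mul_of_nonneg_left (hle ex) (by positivity : 0 ≤ 3 * (2 * R / n) ^ 2)
  have hy := mul_le_mul_of_nonneg_left (hle ey) (by positivity : 0 ≤ 3 * (L / n) ^ 2)
  refine le_trans ?_ (add_le_add (add_le_add le_rfl hx) hy)
  have s0 := sum_cell (g := fun z => ‖φ z‖ ^ 2) (h.continuous.norm.pow 2) hL hR hn
  have s1 := sum_cell (g := fun z => ‖fderiv ℝ φ z ex‖ ^ 2)
    ((h.continuous_fderiv ex).norm.pow 2) hL hR hn
  have s2 := sum_cell (g := fun z => ‖fderiv ℝ φ z ey‖ ^ 2)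
    ((h.continuous_fderiv ey).norm.pow 2) hL hR hn
  rw [setIntegral_slab_eq, ← s0, ← s1, ← s2]
  simp only [Finset.mul_sum, ← Finset.sum_add_distrib]
  refine Finset.sum_le_sum fun i hi => Finset.sum_le_sum fun j hj => ?_
  rw [setIntegral_cell_eq hL (Finset.mem_range.1 hj)]
  exact integral_sq_cell_le h.contDiff_one _ _ (by positivity) (by positivity)

end DeltaStrip

/-! ### Weak convergence along ultrafilters and the energy space. -/

namespace DeltaStrip

section Weak

variable {E F : Type*} [NormedAddCommGroup E] [NormedSpace ℝ E] [NormedAddCommGroup F]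
  [NormedSpace ℝ F]

/-- Weak convergence along a filter. -/
def WeakTendsto {ι : Type*} (f : ι → E) (l : Filter ι) (x : E) : Prop :=
  ∀ T : E →L[ℝ] ℝ, Tendsto (fun n => T (f n)) l (𝓝 (T x))

namespace WeakTendsto

variable {ι : Type*} {f : ι → E} {l : Filter ι} {x : E}

theorem map (h : WeakTendsto f l x) (T : E →L[ℝ] F) : WeakTendsto (fun n => T (f n)) l (T x) :=
  fun S => h (S.comp T)

theorem tendsto_complex {f : ι → ℂ} {x : ℂ} (h : WeakTendsto f l x) : Tendsto f l (𝓝 x) := by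
  have h1 := h Complex.reCLM
  have h2 := h Complex.imCLM
  have h3 := (Complex.continuous_ofReal.tendsto _).comp h1
  have h4 := ((Complex.continuous_ofReal.tendsto _).comp h2).mul_const Complex.I
  have h5 := h3.add h4
  simp only [Function.comp_def, Complex.reCLM_apply, Complex.imCLM_apply, Complex.re_add_im] at h5
  exact h5

theorem of_tendsto (h : Tendsto f l (𝓝 x)) : WeakTendsto f l x :=
  fun T => (T.continuous.tendsto x).comp h

theorem sub_const (h : WeakTendsto f l x) (y : E) : WeakTendsto (fun n => f n - y) l (x - y) := by
  intro T
  simp only [map_sub]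
  exact (h T).sub_const _

theorem prodMk {g : ι → F} {y : F} (h : WeakTendsto f l x) (h' : WeakTendsto g l y) :
    WeakTendsto (fun n => (f n, g n)) l (x, y) := by
  intro T
  have e : ∀ a b, T (a, b) = T.comp (ContinuousLinearMap.inl ℝ E F) a +
      T.comp (ContinuousLinearMap.inr ℝ E F) b := by
    intro a b
    simp [← map_add]
  simp only [e]
  exact (h _).add (h' _)

/-- Mazur's theorem: a functional strictly separating x from s would contradict the convergence of
its values. -/
theorem mem_of_isClosed [l.NeBot] (h : WeakTendsto f l x) {s : Set E} (hs : Convex ℝ s)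
    (hc : IsClosed s) (hf : ∀ n, f n ∈ s) : x ∈ s := by
  by_contra hx
  obtain ⟨T, u, h1, h2⟩ := geometric_hahn_banach_closed_point hs hc hx
  exact absurd h2 (not_lt.2 (le_of_tendsto (h T) (Eventually.of_forall fun n => (h1 _ (hf n)).le)))

/-- Tested with a functional that norms x. The bounds are allowed to vary with n because
`exists_abs` compares derivatives with those of a convergent sequence. -/
theorem norm_le [l.NeBot] (h : WeakTendsto f l x) {c : ι → ℝ} {C : ℝ} (hf : ∀ n, ‖f n‖ ≤ c n)
    (hc : Tendsto c l (𝓝 C)) : ‖x‖ ≤ C := by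
  rcases eq_or_ne x 0 with rfl | hx
  · rw [norm_zero]
    exact ge_of_tendsto hc (Eventually.of_forall fun n => (norm_nonneg _).trans (hf n))
  obtain ⟨T, h1, h2⟩ := exists_dual_vector ℝ x (norm_ne_zero_iff.2 hx)
  have h3 := h T
  rw [h2] at h3
  refine le_of_tendsto_of_tendsto h3 hc (Eventually.of_forall fun n => ?_)
  have := T.le_opNorm (f n)
  rw [h1, one_mul] at this
  exact (le_abs_self _).trans (this.trans (hf n))

theorem unique [l.NeBot] (h : WeakTendsto f l x) {y : E} (h' : WeakTendsto f l y) : x = y := by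
  have h1 := h.sub_const y
  have h2 : WeakTendsto (fun n => f n - y) l 0 := by simpa using h'.sub_const y
  by_contra hne
  obtain ⟨T, -, h4⟩ := exists_dual_vector ℝ (x - y) (norm_ne_zero_iff.2 (sub_ne_zero.2 hne))
  have := tendsto_nhds_unique (h1 T) (h2 T)
  rw [h4, map_zero] at this
  exact hne (sub_eq_zero.1 (norm_eq_zero.1 this))

end WeakTendsto

/-- Along an ultrafilter every bounded scalar family converges, so the limits of the inner products
define a bounded functional, represented by a vector through Riesz. No subsequence has to be
extracted. -/
theorem exists_weakTendsto {E : Type*} [NormedAddCommGroup E] [InnerProductSpace ℝ E]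
    [CompleteSpace E] {ι : Type*} (l : Ultrafilter ι) {f : ι → E} {C : ℝ} (hf : ∀ n, ‖f n‖ ≤ C) :
    ∃ x, WeakTendsto f l x := by
  have h1 : ∀ v : E, ∃ c ∈ Set.Icc (-(C * ‖v‖)) (C * ‖v‖),
      Tendsto (fun n => inner ℝ (f n) v) l (𝓝 c) := by
    intro v
    have hb : ∀ n, inner ℝ (f n) v ∈ Set.Icc (-(C * ‖v‖)) (C * ‖v‖) := fun n =>
      abs_le.1 ((abs_real_inner_le_norm _ _).trans (by gcongr; exact hf n))
    obtain ⟨c, hc, hle⟩ := isCompact_Icc.ultrafilter_le_nhds (l.map fun n => inner ℝ (f n) v)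
      (by
        rw [le_principal_iff]
        exact (Eventually.of_forall hb : ∀ᶠ n in (l : Filter ι), _))
    exact ⟨c, hc, hle⟩
  choose g hg hlim using h1
  let G : E →ₗ[ℝ] ℝ :=
    { toFun := g
      map_add' := fun v w => by
        refine tendsto_nhds_unique (hlim (v + w)) ?_
        simp only [inner_add_right]
        exact (hlim v).add (hlim w)
      map_smul' := fun c v => by
        refine tendsto_nhds_unique (hlim (c • v)) ?_
        simp only [inner_smul_right, RingHom.id_apply, smul_eq_mul]
        exact (hlim v).const_mul c }
  let G' : E →L[ℝ] ℝ := G.mkContinuous C fun v => abs_le.2 (hg v)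
  refine ⟨(InnerProductSpace.toDual ℝ E).symm G', fun T => ?_⟩
  have hT : ∀ v, T v = inner ℝ v ((InnerProductSpace.toDual ℝ E).symm T) := by
    intro v
    rw [real_inner_comm]
    exact (InnerProductSpace.toDual_symm_apply (𝕜 := ℝ)).symm
  simp only [hT]
  have e : inner ℝ ((InnerProductSpace.toDual ℝ E).symm G')
      ((InnerProductSpace.toDual ℝ E).symm T) = g ((InnerProductSpace.toDual ℝ E).symm T) :=
    InnerProductSpace.toDual_symm_apply (𝕜 := ℝ)
  rw [e]
  exact hlim _

end Weak

/-- Quadruples made of a function on the strip, two candidate derivatives and a candidate trace. -/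
abbrev Quad (L : ℝ) : Type :=
  Lp ℂ 2 (stripMeasure L) × Lp ℂ 2 (stripMeasure L) × Lp ℂ 2 (stripMeasure L) ×
    Lp ℂ 2 (sectionMeasure L)

theorem norm_sq_eq_integral {α : Type*} [MeasurableSpace α] {μ : Measure α} (f : Lp ℂ 2 μ) :
    ‖f‖ ^ 2 = ∫ z, ‖f z‖ ^ 2 ∂μ := by
  rw [← real_inner_self_eq_norm_sq, L2.inner_def]
  simp only [real_inner_self_eq_norm_sq]

theorem norm_toLp_sq {α : Type*} [MeasurableSpace α] {μ : Measure α} {f : α → ℂ}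
    (hf : MemLp f 2 μ) : ‖hf.toLp f‖ ^ 2 = ∫ z, ‖f z‖ ^ 2 ∂μ := by
  rw [norm_sq_eq_integral]
  refine integral_congr_ae ?_
  filter_upwards [hf.coeFn_toLp] with z hz
  rw [hz]

theorem integrable_norm_sq {α : Type*} [MeasurableSpace α] {μ : Measure α} (f : Lp ℂ 2 μ) :
    Integrable (fun z => ‖f z‖ ^ 2) μ :=
  (memLp_two_iff_integrable_sq_norm (Lp.aestronglyMeasurable f)).1 (Lp.memLp f)

namespace IsCc

variable {φ ψ : ℝ × ℝ → ℂ} (L : ℝ)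

theorem memLp (h : IsCc φ) : MemLp φ 2 (stripMeasure L) :=
  h.continuous.memLp_of_hasCompactSupport h.cpt

theorem memLp_fderiv (h : IsCc φ) (e : ℝ × ℝ) :
    MemLp (fun z => fderiv ℝ φ z e) 2 (stripMeasure L) :=
  (h.continuous_fderiv e).memLp_of_hasCompactSupport (h.hasCompactSupport_fderiv e)

theorem memLp_slice (h : IsCc φ) : MemLp (fun y => φ (0, y)) 2 (sectionMeasure L) :=
  (h.continuous.comp (by fun_prop : Continuous fun y : ℝ => ((0 : ℝ), y))).memLp_of_hasCompactSupport
    (hasCompactSupport_slice_snd h.cpt 0)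

/-- The quadruple of a smooth compactly supported function. -/
noncomputable def quad (h : IsCc φ) : Quad L :=
  ((h.memLp L).toLp φ, (h.memLp_fderiv L ex).toLp _, (h.memLp_fderiv L ey).toLp _,
    (h.memLp_slice L).toLp _)

theorem add (h : IsCc φ) (h' : IsCc ψ) : IsCc (φ + ψ) := ⟨h.smooth.add h'.smooth, h.cpt.add h'.cpt⟩

theorem smul (h : IsCc φ) (c : ℝ) : IsCc (c • φ) :=
  ⟨h.smooth.const_smul c, hasCompactSupport_of_imp h.cpt fun z hz => by simp [hz]⟩

theorem zero : IsCc (0 : ℝ × ℝ → ℂ) := ⟨contDiff_const, HasCompactSupport.zero⟩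

theorem quad_add (h : IsCc φ) (h' : IsCc ψ) : (h.add h').quad L = h.quad L + h'.quad L := by
  have e : ∀ v z, fderiv ℝ (φ + ψ) z v = fderiv ℝ φ z v + fderiv ℝ ψ z v := fun v z => by
    rw [fderiv_add (h.differentiable z) (h'.differentiable z)]; rfl
  have e' : ∀ v, (fun z => fderiv ℝ (φ + ψ) z v) =
      (fun z => fderiv ℝ φ z v) + fun z => fderiv ℝ ψ z v := fun v => funext (e v)
  refine Prod.ext ?_ (Prod.ext ?_ (Prod.ext ?_ ?_))
  · exact MemLp.toLp_add (h.memLp L) (h'.memLp L)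
  · exact (MemLp.toLp_congr ((h.add h').memLp_fderiv L ex)
      ((h.memLp_fderiv L ex).add (h'.memLp_fderiv L ex)) (by rw [e'])).trans
      (MemLp.toLp_add (h.memLp_fderiv L ex) (h'.memLp_fderiv L ex))
  · exact (MemLp.toLp_congr ((h.add h').memLp_fderiv L ey)
      ((h.memLp_fderiv L ey).add (h'.memLp_fderiv L ey)) (by rw [e'])).trans
      (MemLp.toLp_add (h.memLp_fderiv L ey) (h'.memLp_fderiv L ey))
  · exact MemLp.toLp_add (h.memLp_slice L) (h'.memLp_slice L)

theorem quad_smul (h : IsCc φ) (c : ℝ) : (h.smul c).quad L = c • h.quad L := by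
  have e : ∀ v z, fderiv ℝ (c • φ) z v = c • fderiv ℝ φ z v := fun v z => by
    rw [fderiv_const_smul (h.differentiable z)]; rfl
  have e' : ∀ v, (fun z => fderiv ℝ (c • φ) z v) = c • (fun z => fderiv ℝ φ z v) :=
    fun v => funext (e v)
  refine Prod.ext ?_ (Prod.ext ?_ (Prod.ext ?_ ?_))
  · exact MemLp.toLp_const_smul c (h.memLp L)
  · exact (MemLp.toLp_congr ((h.smul c).memLp_fderiv L ex)
      ((h.memLp_fderiv L ex).const_smul c) (by rw [e'])).trans
      (MemLp.toLp_const_smul c (h.memLp_fderiv L ex))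
  · exact (MemLp.toLp_congr ((h.smul c).memLp_fderiv L ey)
      ((h.memLp_fderiv L ey).const_smul c) (by rw [e'])).trans
      (MemLp.toLp_const_smul c (h.memLp_fderiv L ey))
  · exact MemLp.toLp_const_smul c (h.memLp_slice L)

end IsCc

/-- The quadruples of smooth compactly supported functions. -/
noncomputable def smoothQuads (L : ℝ) : Submodule ℝ (Quad L) where
  carrier := {U | ∃ (φ : ℝ × ℝ → ℂ) (h : IsCc φ), U = h.quad L}
  add_mem' := by
    rintro _ _ ⟨φ, h, rfl⟩ ⟨ψ, h', rfl⟩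
    exact ⟨_, h.add h', (h.quad_add L h').symm⟩
  zero_mem' := ⟨(0 : ℝ) • 0, IsCc.zero.smul 0, by
    rw [IsCc.quad_smul (h := IsCc.zero), zero_smul]⟩
  smul_mem' := by
    rintro c _ ⟨φ, h, rfl⟩
    exact ⟨_, h.smul c, (h.quad_smul L c).symm⟩

/-- The energy space: functions in `H¹` of the strip together with their weak derivatives and
their trace. -/
noncomputable def energySpace (L : ℝ) : Submodule ℝ (Quad L) := (smoothQuads L).topologicalClosure

variable {L : ℝ}

theorem isClosed_energySpace : IsClosed (energySpace L : Set (Quad L)) :=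
  Submodule.isClosed_topologicalClosure _

theorem quad_mem {φ : ℝ × ℝ → ℂ} (h : IsCc φ) : h.quad L ∈ energySpace L :=
  Submodule.le_topologicalClosure _ ⟨φ, h, rfl⟩

/-- Density principle: a closed condition satisfied by smooth functions holds on the closure. The
integral inequalities above pass to the energy space in this way. -/
theorem energySpace_induction {P : Quad L → Prop} (hc : IsClosed {U | P U})
    (hs : ∀ (φ : ℝ × ℝ → ℂ) (h : IsCc φ), P (h.quad L)) : ∀ U ∈ energySpace L, P U := by
  intro U hU
  exact closure_minimal (s := (smoothQuads L : Set (Quad L)))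
    (by rintro _ ⟨φ, h, rfl⟩; exact hs φ h) hc hU

theorem exists_seq_quad {U : Quad L} (hU : U ∈ energySpace L) :
    ∃ (φ : ℕ → ℝ × ℝ → ℂ) (h : ∀ n, IsCc (φ n)), Tendsto (fun n => (h n).quad L) atTop (𝓝 U) := by
  obtain ⟨V, hV, hlim⟩ := mem_closure_iff_seq_limit.1 (show U ∈ closure (smoothQuads L : Set _) from hU)
  choose φ h e using hV
  exact ⟨φ, h, by simpa only [← e] using hlim⟩

theorem trace_sq_le {U : Quad L} (hU : U ∈ energySpace L) {a : ℝ} (ha : 0 < a) :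
    ‖U.2.2.2‖ ^ 2 ≤ 1 / 2 * (a * ‖U.1‖ ^ 2 + 1 / a * ‖U.2.1‖ ^ 2) := by
  refine energySpace_induction (P := fun U => ‖U.2.2.2‖ ^ 2 ≤ 1 / 2 * (a * ‖U.1‖ ^ 2 +
    1 / a * ‖U.2.1‖ ^ 2)) (isClosed_le (by fun_prop) (by fun_prop)) (fun φ h => ?_) U hU
  simp only [IsCc.quad, norm_toLp_sq]
  exact slice_sq_le h 0 ha

/-- The integral of the square over a bounded part of the strip. -/
noncomputable def slabSq (R : ℝ) (f : Lp ℂ 2 (stripMeasure L)) : ℝ :=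
  ∫ z in slab R, ‖f z‖ ^ 2 ∂(stripMeasure L)

theorem continuous_slabSq (R : ℝ) : Continuous (slabSq (L := L) R) := by
  have e : slabSq (L := L) R = fun f =>
      ‖LpToLpRestrictCLM (ℝ × ℝ) ℂ ℝ (stripMeasure L) 2 (slab R) f‖ ^ 2 := by
    funext f
    rw [norm_sq_eq_integral, slabSq]
    refine integral_congr_ae ?_
    filter_upwards [LpToLpRestrictCLM_coeFn (F := ℂ) ℝ (μ := stripMeasure L) (p := 2) (slab R) f]
      with z hz
    rw [hz]
  rw [e]
  fun_prop

theorem slabSq_toLp {R : ℝ} {f : ℝ × ℝ → ℂ} (hf : MemLp f 2 (stripMeasure L)) :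
    slabSq R (hf.toLp f) = ∫ z in slab R, ‖f z‖ ^ 2 ∂(stripMeasure L) := by
  refine integral_congr_ae ?_
  filter_upwards [ae_restrict_of_ae hf.coeFn_toLp] with z hz
  rw [hz]

theorem trace_sq_le_slab {U : Quad L} (hU : U ∈ energySpace L) {δ : ℝ} (hδ : 0 < δ) :
    ‖U.2.2.2‖ ^ 2 ≤ (1 + 1 / δ) * slabSq 1 U.1 + δ * ‖U.2.1‖ ^ 2 := by
  have := continuous_slabSq (L := L) 1
  refine energySpace_induction (P := fun U => ‖U.2.2.2‖ ^ 2 ≤ (1 + 1 / δ) * slabSq 1 U.1 +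
    δ * ‖U.2.1‖ ^ 2) (isClosed_le (by fun_prop) (by fun_prop)) (fun φ h => ?_) U hU
  simp only [IsCc.quad, norm_toLp_sq, slabSq_toLp]
  exact slice_sq_le_slab h hδ

theorem stripMeasure_cell_lt_top (R : ℝ) (n i j : ℕ) : stripMeasure L (cell L R n i j) < ⊤ :=
  (isCompact_Icc.prod isCompact_Icc).measure_lt_top

/-- Integration over a cell, as a continuous functional. -/
noncomputable def cellInt (L R : ℝ) (n i j : ℕ) : Lp ℂ 2 (stripMeasure L) →L[ℝ] ℂ :=
  (innerSL ℂ (indicatorConstLp 2 (measurableSet_cell L R n i j)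
    (stripMeasure_cell_lt_top R n i j).ne (1 : ℂ))).restrictScalars ℝ

theorem cellInt_apply (R : ℝ) (n i j : ℕ) (f : Lp ℂ 2 (stripMeasure L)) :
    cellInt L R n i j f = ∫ z in cell L R n i j, f z ∂(stripMeasure L) :=
  L2.inner_indicatorConstLp_one (measurableSet_cell L R n i j) (stripMeasure_cell_lt_top R n i j).ne f

theorem slabSq_le_sum {U : Quad L} (hU : U ∈ energySpace L) {R : ℝ} (hL : 0 < L) (hR : 0 < R)
    {n : ℕ} (hn : 0 < n) :
    slabSq R U.1 ≤ ∑ i ∈ Finset.range n, ∑ j ∈ Finset.range n, 3 / (2 * R / n * (L / n)) *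
        ‖cellInt L R n i j U.1‖ ^ 2
      + 3 * (2 * R / n) ^ 2 * ‖U.2.1‖ ^ 2 + 3 * (L / n) ^ 2 * ‖U.2.2.1‖ ^ 2 := by
  have := continuous_slabSq (L := L) R
  refine energySpace_induction (P := fun U => slabSq R U.1 ≤ ∑ i ∈ Finset.range n,
    ∑ j ∈ Finset.range n, 3 / (2 * R / n * (L / n)) * ‖cellInt L R n i j U.1‖ ^ 2
      + 3 * (2 * R / n) ^ 2 * ‖U.2.1‖ ^ 2 + 3 * (L / n) ^ 2 * ‖U.2.2.1‖ ^ 2)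
    (isClosed_le (by fun_prop) (by fun_prop)) (fun φ h => ?_) U hU
  have e : ∀ i j, ∫ z in cell L R n i j, (h.memLp L).toLp φ z ∂(stripMeasure L)
      = ∫ z in cell L R n i j, φ z ∂(stripMeasure L) := by
    intro i j
    refine integral_congr_ae ?_
    filter_upwards [ae_restrict_of_ae (h.memLp L).coeFn_toLp] with z hz
    rw [hz]
  simp only [IsCc.quad, norm_toLp_sq, slabSq_toLp, cellInt_apply, e]
  exact integral_sq_slab_le h hL hR hn

/-- The square of the `H¹` norm. -/
noncomputable def hSq (U : Quad L) : ℝ := ‖U.1‖ ^ 2 + ‖U.2.1‖ ^ 2 + ‖U.2.2.1‖ ^ 2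

theorem continuous_hSq : Continuous (hSq (L := L)) := by unfold hSq; fun_prop

theorem hSq_nonneg (U : Quad L) : 0 ≤ hSq U := by unfold hSq; positivity

theorem hSq_quad {φ : ℝ × ℝ → ℂ} (h : IsCc φ) : hSq (h.quad L) = smoothSq L φ := by
  simp only [hSq, IsCc.quad, norm_toLp_sq, smoothSq]

/-- The smooth bound passes to the limit by Fatou along an almost everywhere convergent subsequence.
The constant is the one for M + 1 because the approximants satisfy the bound M only up to an error.
-/
theorem integrable_pow_of_hSq_le (hL : 0 < L) (i : ℕ) (M : ℝ) (hM : 0 < M) :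
    ∃ C : ℝ, 0 ≤ C ∧ ∀ U ∈ energySpace L, hSq U ≤ M →
      Integrable (fun z => ‖U.1 z‖ ^ (4 * (i + 1))) (stripMeasure L) ∧
      ∫ z, ‖U.1 z‖ ^ (4 * (i + 1)) ∂(stripMeasure L) ≤ C := by
  obtain ⟨C, hC0, hC⟩ := integral_pow_le hL i (M + 1) (by linarith)
  refine ⟨C, hC0, fun U hU hM' => ?_⟩
  obtain ⟨φ, h, hlim⟩ := exists_seq_quad hU
  have hev : ∀ᶠ n in atTop, smoothSq L (φ n) ≤ M + 1 := by
    have h1 := (continuous_hSq.tendsto U).comp hlim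
    filter_upwards [h1.eventually_le_const (show hSq U < M + 1 by linarith)] with n hn
    rwa [Function.comp_apply, hSq_quad] at hn
  have h1 : Tendsto (fun n => (h n).quad L |>.1) atTop (𝓝 U.1) :=
    (continuous_fst.tendsto U).comp hlim
  obtain ⟨ns, hns, hae⟩ := (tendstoInMeasure_of_tendsto_Lp h1).exists_seq_tendsto_ae
  have hcoe : ∀ᵐ z ∂(stripMeasure L), ∀ n, ((h n).quad L).1 z = φ n z :=
    ae_all_iff.2 fun n => ((h n).memLp L).coeFn_toLp
  have hae' : ∀ᵐ z ∂(stripMeasure L), Tendsto (fun n => φ (ns n) z) atTop (𝓝 (U.1 z)) := by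
    filter_upwards [hae, hcoe] with z hz hz'
    simpa only [hz'] using hz
  set k := 4 * (i + 1) with hk
  have hk0 : k ≠ 0 := by omega
  have hmeas : AEStronglyMeasurable (fun z => ‖U.1 z‖ ^ k) (stripMeasure L) :=
    (Lp.aestronglyMeasurable U.1).norm.pow k
  have hlint : ∫⁻ z, ENNReal.ofReal (‖U.1 z‖ ^ k) ∂(stripMeasure L) ≤ ENNReal.ofReal C := by
    calc ∫⁻ z, ENNReal.ofReal (‖U.1 z‖ ^ k) ∂(stripMeasure L)
        = ∫⁻ z, liminf (fun n => ENNReal.ofReal (‖φ (ns n) z‖ ^ k)) atTop ∂(stripMeasure L) := by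
          refine lintegral_congr_ae ?_
          filter_upwards [hae'] with z hz
          exact ((ENNReal.continuous_ofReal.tendsto _).comp ((hz.norm).pow k)).liminf_eq.symm
      _ ≤ liminf (fun n => ∫⁻ z, ENNReal.ofReal (‖φ (ns n) z‖ ^ k) ∂(stripMeasure L)) atTop := by
          refine lintegral_liminf_le fun n => ?_
          exact ENNReal.measurable_ofReal.comp ((h (ns n)).continuous.norm.pow k).measurable
      _ ≤ ENNReal.ofReal C := by
          refine liminf_le_of_le (by isBoundedDefault) fun b hb => ?_
          obtain ⟨n, hn1, hn2⟩ := (hb.and (hns.tendsto_atTop.eventually hev)).exists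
          refine hn1.trans ?_
          rw [← ofReal_integral_eq_lintegral_ofReal
            (integrable_norm_pow (h (ns n)).continuous (h (ns n)).cpt hk0)
            (Eventually.of_forall fun z => by positivity)]
          exact ENNReal.ofReal_le_ofReal (hC _ (h _) hn2)
  have hint : Integrable (fun z => ‖U.1 z‖ ^ k) (stripMeasure L) := by
    refine ⟨hmeas, ?_⟩
    rw [hasFiniteIntegral_iff_ofReal (Eventually.of_forall fun z => by positivity)]
    exact hlint.trans_lt ENNReal.ofReal_lt_top
  refine ⟨hint, ?_⟩
  rw [← ofReal_integral_eq_lintegral_ofReal hint (Eventually.of_forall fun z => by positivity)]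
    at hlint
  exact (ENNReal.ofReal_le_ofReal_iff hC0).1 hlint

end DeltaStrip

/-! ### Power inequalities, splitting of the potential and local compactness. -/

namespace DeltaStrip

section Elementary

theorem rpow_le_sq_add_pow {r t : ℝ} (hr : 2 ≤ r) {k : ℕ} (hk : r ≤ k) (ht : 0 ≤ t) :
    t ^ r ≤ t ^ 2 + t ^ k := by
  rcases le_total t 1 with h | h
  · rcases eq_or_lt_of_le ht with rfl | h0
    · rw [Real.zero_rpow (by linarith)]; positivity
    have : t ^ r ≤ t ^ (2 : ℝ) := Real.rpow_le_rpow_of_exponent_ge h0 h hr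
    rw [Real.rpow_two] at this
    have h2 : 0 ≤ t ^ k := by positivity
    linarith
  · have : t ^ r ≤ t ^ (k : ℝ) := Real.rpow_le_rpow_of_exponent_le h hk
    rw [Real.rpow_natCast] at this
    have h2 : 0 ≤ t ^ 2 := by positivity
    linarith

theorem exists_threshold_large {a δ : ℝ} (ha : 0 < a) (hδ : 0 < δ) :
    ∃ T : ℝ, 1 ≤ T ∧ ∀ t, T ≤ t → 1 ≤ δ * t ^ a := by
  refine ⟨max 1 ((1 / δ) ^ (1 / a)), le_max_left _ _, fun t ht => ?_⟩
  have h1 : (1 / δ) ^ (1 / a) ≤ t := (le_max_right _ _).trans ht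
  have h2 := Real.rpow_le_rpow (by positivity) h1 ha.le
  rw [← Real.rpow_mul (by positivity), one_div_mul_cancel ha.ne', Real.rpow_one] at h2
  calc (1 : ℝ) = δ * (1 / δ) := by field_simp
    _ ≤ δ * t ^ a := by gcongr

theorem rpow_le_eps_pow_add {r δ : ℝ} (hr : 2 ≤ r) {k : ℕ} (hk : r < k) (hδ : 0 < δ) :
    ∃ K : ℝ, 0 ≤ K ∧ ∀ t : ℝ, 0 ≤ t → t ^ r ≤ δ * t ^ k + K * t ^ 2 := by
  obtain ⟨T, hT1, hT⟩ := exists_threshold_large (sub_pos.2 hk) hδ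
  refine ⟨T ^ (r - 2), by positivity, fun t ht => ?_⟩
  have p1 : 0 ≤ δ * t ^ k := by positivity
  have p2 : 0 ≤ T ^ (r - 2) * t ^ 2 := by positivity
  rcases eq_or_lt_of_le ht with rfl | h0
  · rw [Real.zero_rpow (by linarith)]; linarith
  rcases le_total T t with h | h
  · have h1 := hT t h
    have h2 : t ^ r * 1 ≤ t ^ r * (δ * t ^ ((k : ℝ) - r)) := by gcongr
    have h3 : t ^ r * (δ * t ^ ((k : ℝ) - r)) = δ * t ^ k := by
      rw [← Real.rpow_natCast t k, mul_left_comm, ← Real.rpow_add h0]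
      congr 2; ring
    linarith
  · have h1 : t ^ r = t ^ (r - 2) * t ^ 2 := by
      rw [← Real.rpow_two, ← Real.rpow_add h0]; congr 1; ring
    rw [h1]
    have h2 : t ^ (r - 2) ≤ T ^ (r - 2) := Real.rpow_le_rpow ht h (by linarith)
    have := mul_le_mul_of_nonneg_right h2 (sq_nonneg t)
    linarith

/-- Near 0 the power t^r is negligible against t², near infinity against t^k; the middle range is
charged to t⁴, the quantity that small sections make small. -/
theorem rpow_le_eps_sq_add_pow_four {r δ : ℝ} (hr : 2 < r) {k : ℕ} (hk : r < k) (hδ : 0 < δ) :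
    ∃ K : ℝ, 0 ≤ K ∧ ∀ t : ℝ, 0 ≤ t → t ^ r ≤ δ * t ^ 2 + δ * t ^ k + K * t ^ 4 := by
  obtain ⟨T, hT1, hT⟩ := exists_threshold_large (sub_pos.2 hk) hδ
  obtain ⟨S, hS1, hS⟩ := exists_threshold_large (sub_pos.2 hr) hδ
  have hT0 : 0 < T := by linarith
  have hS0 : 0 < S := by linarith
  refine ⟨T ^ r * S ^ 4, by positivity, fun t ht => ?_⟩
  have p1 : 0 ≤ δ * t ^ k := by positivity
  have p2 : 0 ≤ T ^ r * S ^ 4 * t ^ 4 := by positivity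
  have p3 : 0 ≤ δ * t ^ 2 := by positivity
  rcases eq_or_lt_of_le ht with rfl | h0
  · rw [Real.zero_rpow (by linarith)]; linarith
  rcases le_total T t with h | h
  · have h1 := hT t h
    have h2 : t ^ r * 1 ≤ t ^ r * (δ * t ^ ((k : ℝ) - r)) := by gcongr
    have h3 : t ^ r * (δ * t ^ ((k : ℝ) - r)) = δ * t ^ k := by
      rw [← Real.rpow_natCast t k, mul_left_comm, ← Real.rpow_add h0]
      congr 2; ring
    linarith
  · rcases le_total S (1 / t) with h' | h'
    · have h1 := hS _ h'
      have h2 : t ^ r * 1 ≤ t ^ r * (δ * (1 / t) ^ (r - 2)) := by gcongr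
      have h3 : t ^ r * (δ * (1 / t) ^ (r - 2)) = δ * t ^ 2 := by
        rw [one_div, Real.inv_rpow ht, ← Real.rpow_neg ht, mul_left_comm, ← Real.rpow_add h0,
          ← Real.rpow_two]
        congr 2; ring
      linarith
    · have h1 : 1 ≤ S * t := by
        rw [div_le_iff₀ h0] at h'; exact h'
      have h2 : t ^ r ≤ T ^ r := Real.rpow_le_rpow ht h (by linarith)
      have h3 : 1 ≤ (S * t) ^ 4 := one_le_pow₀ h1
      have h4 : T ^ r * 1 ≤ T ^ r * (S * t) ^ 4 := by gcongr
      rw [mul_pow] at h4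
      linarith

theorem abs_rpow_sub_rpow_le {r x y M : ℝ} (hr : 1 ≤ r) (hx : 0 ≤ x) (hy : 0 ≤ y) (hxM : x ≤ M)
    (hyM : y ≤ M) : |x ^ r - y ^ r| ≤ r * M ^ (r - 1) * |x - y| := by
  have h := (convex_Icc 0 M).norm_image_sub_le_of_norm_hasDerivWithin_le
    (f := fun t : ℝ => t ^ r) (f' := fun t => r * t ^ (r - 1)) (C := r * M ^ (r - 1))
    (x := y) (y := x) (fun t _ => (Real.hasDerivAt_rpow_const (Or.inr hr)).hasDerivWithinAt)
    (fun t ht => by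
      rw [Real.norm_of_nonneg (mul_nonneg (by linarith) (Real.rpow_nonneg ht.1 _))]
      gcongr
      · exact ht.1
      · exact ht.2) ⟨hy, hyM⟩ ⟨hx, hxM⟩
  simpa [Real.norm_eq_abs] using h

theorem abs_norm_add_rpow_sub_le_aux {r : ℝ} (hr : 1 < r) {a b : ℂ} (h : ‖b‖ ≤ ‖a‖) :
    |‖a + b‖ ^ r - ‖a‖ ^ r - ‖b‖ ^ r| ≤ (r * 2 ^ (r - 1) + 1) * (‖a‖ ^ (r - 1) * ‖b‖) := by
  have h1 : ‖a + b‖ ≤ 2 * ‖a‖ := (norm_add_le a b).trans (by linarith)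
  have h2 := abs_rpow_sub_rpow_le hr.le (norm_nonneg (a + b)) (norm_nonneg a) h1
    (by linarith [norm_nonneg a])
  have h3 : |‖a + b‖ - ‖a‖| ≤ ‖b‖ := by
    have := abs_norm_sub_norm_le (a + b) a
    simpa using this
  have h4 : ‖b‖ ^ r ≤ ‖a‖ ^ (r - 1) * ‖b‖ := by
    have : ‖b‖ ^ r = ‖b‖ ^ (r - 1) * ‖b‖ := by
      rw [← Real.rpow_add_one' (norm_nonneg b) (by linarith)]; congr 1; ring
    rw [this]
    gcongr
  rw [Real.mul_rpow (by norm_num) (norm_nonneg a)] at h2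
  have h5 : 0 ≤ ‖b‖ ^ r := by positivity
  calc |‖a + b‖ ^ r - ‖a‖ ^ r - ‖b‖ ^ r| ≤ |‖a + b‖ ^ r - ‖a‖ ^ r| + |‖b‖ ^ r| := abs_sub _ _
    _ ≤ r * (2 ^ (r - 1) * ‖a‖ ^ (r - 1)) * ‖b‖ + ‖a‖ ^ (r - 1) * ‖b‖ := by
        rw [abs_of_nonneg h5]
        refine add_le_add (h2.trans ?_) h4
        gcongr
    _ = _ := by ring

/-- Only mixed terms remain, as in the Brezis–Lieb lemma. By symmetry |b| ≤ |a|; then the mean value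
theorem bounds |a + b|^r - |a|^r, and |b|^r is itself at most a mixed term. -/
theorem abs_norm_add_rpow_sub_le {r : ℝ} (hr : 1 < r) (a b : ℂ) :
    |‖a + b‖ ^ r - ‖a‖ ^ r - ‖b‖ ^ r| ≤
      (r * 2 ^ (r - 1) + 1) * (‖a‖ ^ (r - 1) * ‖b‖ + ‖a‖ * ‖b‖ ^ (r - 1)) := by
  have hc : 0 ≤ r * 2 ^ (r - 1) + 1 := by positivity
  have p1 : 0 ≤ ‖a‖ ^ (r - 1) * ‖b‖ := by positivity
  have p2 : 0 ≤ ‖a‖ * ‖b‖ ^ (r - 1) := by positivity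
  rcases le_total ‖b‖ ‖a‖ with h | h
  · exact (abs_norm_add_rpow_sub_le_aux hr h).trans (mul_le_mul_of_nonneg_left (by linarith) hc)
  · have := abs_norm_add_rpow_sub_le_aux hr h
    rw [add_comm b a, sub_right_comm] at this
    exact this.trans (mul_le_mul_of_nonneg_left (by linarith) hc)

/-- The mixed terms are small wherever either factor is: the small factor takes the large weight
1/δ. The roles of x and y are exchanged between the inside and the outside of a slab. -/
theorem mul_add_mul_le {r x y δ : ℝ} (hx : 0 ≤ x) (hy : 0 ≤ y) (hδ : 0 < δ) :
    x ^ (r - 1) * y + x * y ^ (r - 1) ≤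
      δ * (x ^ 2 + x ^ (2 * (r - 1))) + 1 / δ * (y ^ 2 + y ^ (2 * (r - 1))) := by
  have e : ∀ t : ℝ, 0 ≤ t → t ^ (2 * (r - 1)) = (t ^ (r - 1)) ^ 2 := by
    intro t ht
    rw [← Real.rpow_natCast, ← Real.rpow_mul ht]
    congr 1; push_cast; ring
  rw [e x hx, e y hy]
  have key : ∀ s t : ℝ, s * t ≤ δ * s ^ 2 + 1 / δ * t ^ 2 := by
    intro s t
    have h4 : δ * s ^ 2 + 1 / δ * t ^ 2 - 2 * (s * t) = 1 / δ * (δ * s - t) ^ 2 := by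
      field_simp; ring
    have h5 : δ * s ^ 2 + 1 / δ * t ^ 2 + 2 * (s * t) = 1 / δ * (δ * s + t) ^ 2 := by
      field_simp; ring
    have : 0 ≤ 1 / δ * (δ * s - t) ^ 2 := by positivity
    have : 0 ≤ 1 / δ * (δ * s + t) ^ 2 := by positivity
    linarith
  have h1 := key (x ^ (r - 1)) y
  have h2 := key x (y ^ (r - 1))
  linarith

end Elementary

variable {L : ℝ}

theorem aestronglyMeasurable_rpow {r : ℝ} (hr : 0 ≤ r) (f : Lp ℂ 2 (stripMeasure L)) :
    AEStronglyMeasurable (fun z => ‖f z‖ ^ r) (stripMeasure L) :=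
  (Real.continuous_rpow_const hr).comp_aestronglyMeasurable (Lp.aestronglyMeasurable f).norm

/-- The integral of a power of the modulus of the function component. -/
noncomputable def pInt (r : ℝ) (U : Quad L) : ℝ := ∫ z, ‖U.1 z‖ ^ r ∂(stripMeasure L)

theorem pInt_nonneg (r : ℝ) (U : Quad L) : 0 ≤ pInt r U := integral_nonneg fun _ => by positivity

theorem exists_bound_pInt (hL : 0 < L) {r : ℝ} (hr : 2 ≤ r) (M : ℝ) :
    ∃ C : ℝ, 0 ≤ C ∧ ∀ U ∈ energySpace L, hSq U ≤ M →
      Integrable (fun z => ‖U.1 z‖ ^ r) (stripMeasure L) ∧ pInt r U ≤ C := by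
  obtain ⟨i, hi⟩ := exists_nat_ge r
  obtain ⟨C, hC0, hC⟩ := integrable_pow_of_hSq_le hL i (|M| + 1) (by positivity)
  refine ⟨|M| + C, by positivity, fun U hU hM => ?_⟩
  obtain ⟨h1, h2⟩ := hC U hU (by linarith [le_abs_self M])
  have h3 := integrable_norm_sq U.1
  have hk : r ≤ (4 * (i + 1) : ℕ) := hi.trans (by push_cast; linarith [Nat.cast_nonneg (α := ℝ) i])
  have hle : ∀ z, ‖U.1 z‖ ^ r ≤ ‖U.1 z‖ ^ 2 + ‖U.1 z‖ ^ (4 * (i + 1)) := fun z =>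
    rpow_le_sq_add_pow hr hk (norm_nonneg _)
  have hint : Integrable (fun z => ‖U.1 z‖ ^ r) (stripMeasure L) := by
    refine (h3.add h1).mono' (aestronglyMeasurable_rpow (by linarith) _)
      (Eventually.of_forall fun z => ?_)
    rw [Real.norm_of_nonneg (by positivity)]
    exact hle z
  refine ⟨hint, ?_⟩
  calc pInt r U ≤ ∫ z, (‖U.1 z‖ ^ 2 + ‖U.1 z‖ ^ (4 * (i + 1))) ∂(stripMeasure L) :=
        integral_mono hint (h3.add h1) hle
    _ = ‖U.1‖ ^ 2 + ∫ z, ‖U.1 z‖ ^ (4 * (i + 1)) ∂(stripMeasure L) := by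
        rw [integral_add h3 h1, norm_sq_eq_integral]
    _ ≤ |M| + C := by
        refine add_le_add (le_trans ?_ (hM.trans (le_abs_self M))) h2
        rw [hSq]
        nlinarith [sq_nonneg ‖U.2.1‖, sq_nonneg ‖U.2.2.1‖]

theorem integrable_rpow (hL : 0 < L) {r : ℝ} (hr : 2 ≤ r) {U : Quad L} (hU : U ∈ energySpace L) :
    Integrable (fun z => ‖U.1 z‖ ^ r) (stripMeasure L) := by
  obtain ⟨C, -, hC⟩ := exists_bound_pInt hL hr (hSq U)
  exact (hC U hU le_rfl).1

/-- Interpolation: in t^r ≤ δ t^k + K t² the integral of the high power is bounded and the L²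
integral tends to zero. -/
theorem tendsto_setIntegral_rpow (hL : 0 < L) {r : ℝ} (hr : 2 ≤ r) {ι : Type*} {l : Filter ι}
    {W : ι → Quad L} (hW : ∀ n, W n ∈ energySpace L) {M : ℝ} (hM : ∀ᶠ n in l, hSq (W n) ≤ M)
    {s : Set (ℝ × ℝ)}
    (h0 : Tendsto (fun n => ∫ z in s, ‖(W n).1 z‖ ^ 2 ∂(stripMeasure L)) l (𝓝 0)) :
    Tendsto (fun n => ∫ z in s, ‖(W n).1 z‖ ^ r ∂(stripMeasure L)) l (𝓝 0) := by
  obtain ⟨i, hi⟩ := exists_nat_ge r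
  obtain ⟨C, hC0, hC⟩ := integrable_pow_of_hSq_le hL i (|M| + 1) (by positivity)
  have hk : r < (4 * (i + 1) : ℕ) := by
    push_cast; linarith [Nat.cast_nonneg (α := ℝ) i]
  refine Metric.tendsto_nhds.2 fun ε hε => ?_
  obtain ⟨K, hK0, hK⟩ := rpow_le_eps_pow_add hr hk (δ := ε / (2 * (C + 1))) (by positivity)
  have h1 : Tendsto (fun n => K * ∫ z in s, ‖(W n).1 z‖ ^ 2 ∂(stripMeasure L)) l (𝓝 0) := by
    simpa using h0.const_mul K
  filter_upwards [hM, h1.eventually_lt_const (show 0 < ε / 2 by linarith)] with n hn1 hn2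
  obtain ⟨g1, g2⟩ := hC (W n) (hW n) (by linarith [le_abs_self M])
  have g3 := integrable_norm_sq (W n).1
  have g4 : Integrable (fun z => ε / (2 * (C + 1)) * ‖(W n).1 z‖ ^ (4 * (i + 1)) +
      K * ‖(W n).1 z‖ ^ 2) (stripMeasure L) := (g1.const_mul _).add (g3.const_mul _)
  have hp : 0 ≤ ∫ z in s, ‖(W n).1 z‖ ^ r ∂(stripMeasure L) :=
    integral_nonneg fun _ => by positivity
  rw [Real.dist_eq, sub_zero, abs_of_nonneg hp]
  calc ∫ z in s, ‖(W n).1 z‖ ^ r ∂(stripMeasure L)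
      ≤ ∫ z in s, (ε / (2 * (C + 1)) * ‖(W n).1 z‖ ^ (4 * (i + 1)) + K * ‖(W n).1 z‖ ^ 2)
          ∂(stripMeasure L) :=
        integral_mono (integrable_rpow hL hr (hW n)).integrableOn
          g4.integrableOn fun z => hK _ (norm_nonneg _)
    _ = ε / (2 * (C + 1)) * ∫ z in s, ‖(W n).1 z‖ ^ (4 * (i + 1)) ∂(stripMeasure L)
        + K * ∫ z in s, ‖(W n).1 z‖ ^ 2 ∂(stripMeasure L) := by
        rw [integral_add (g1.const_mul _).integrableOn (g3.const_mul _).integrableOn,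
          integral_const_mul, integral_const_mul]
    _ < ε / (2 * (C + 1)) * C + ε / 2 := by
        refine add_lt_add_of_le_of_lt ?_ hn2
        gcongr
        exact (setIntegral_le_integral g1 (Eventually.of_forall fun z => by positivity)).trans g2
    _ ≤ ε := by
        have : ε / (2 * (C + 1)) * C ≤ ε / 2 := by
          rw [div_mul_eq_mul_div, div_le_div_iff₀ (by positivity) (by norm_num)]
          nlinarith
        linarith

theorem tendsto_pInt_zero (hL : 0 < L) {r : ℝ} (hr : 2 ≤ r) {ι : Type*} {l : Filter ι}
    {W : ι → Quad L} (hW : ∀ n, W n ∈ energySpace L) {M : ℝ} (hM : ∀ᶠ n in l, hSq (W n) ≤ M)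
    (h0 : Tendsto (fun n => ‖(W n).1‖) l (𝓝 0)) : Tendsto (fun n => pInt r (W n)) l (𝓝 0) := by
  have := tendsto_setIntegral_rpow hL hr hW hM (s := Set.univ) (by
    simp only [setIntegral_univ, ← norm_sq_eq_integral]
    simpa using h0.pow 2)
  simp only [setIntegral_univ] at this
  exact this

theorem tendsto_setIntegral_compl_slab {g : ℝ × ℝ → ℝ} (hg : Integrable g (stripMeasure L)) :
    Tendsto (fun n : ℕ => ∫ z in (slab (n + 1))ᶜ, g z ∂(stripMeasure L)) atTop (𝓝 0) := by
  have hmono : Monotone fun n : ℕ => slab ((n : ℝ) + 1) := by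
    intro m n hmn
    have : (m : ℝ) ≤ n := by exact_mod_cast hmn
    exact Set.prod_mono (Set.Icc_subset_Icc (by linarith) (by linarith)) le_rfl
  have hU : ⋃ n : ℕ, slab ((n : ℝ) + 1) = Set.univ := by
    refine Set.eq_univ_of_forall fun z => ?_
    obtain ⟨n, hn⟩ := exists_nat_ge |z.1|
    exact Set.mem_iUnion.2 ⟨n, ⟨by linarith [neg_abs_le z.1], by linarith [le_abs_self z.1]⟩, trivial⟩
  have h := tendsto_setIntegral_of_monotone (μ := stripMeasure L) (f := g)
    (fun n : ℕ => measurableSet_slab ((n : ℝ) + 1)) hmono (by rw [hU]; exact hg.integrableOn)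
  rw [hU, setIntegral_univ] at h
  have h2 := h.const_sub (∫ z, g z ∂(stripMeasure L))
  rw [sub_self] at h2
  refine h2.congr fun n => ?_
  rw [← integral_add_compl (measurableSet_slab ((n : ℝ) + 1)) hg]
  ring

/-- Asymptotic splitting of the potential energy. -/
theorem tendsto_pInt_add_sub (hL : 0 < L) {r : ℝ} (hr : 2 < r) {ι : Type*} {l : Filter ι}
    {U : Quad L} (hU : U ∈ energySpace L)
    {W : ι → Quad L} (hW : ∀ n, W n ∈ energySpace L) {M : ℝ} (hM : ∀ᶠ n in l, hSq (W n) ≤ M)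
    (h0 : ∀ R > 0, Tendsto (fun n => slabSq R (W n).1) l (𝓝 0)) :
    Tendsto (fun n => pInt r (U + W n) - pInt r U - pInt r (W n)) l (𝓝 0) := by
  set c := r * 2 ^ (r - 1) + 1 with hc
  have hc0 : 0 < c := by positivity
  set g : Quad L → ℝ × ℝ → ℝ := fun V z => ‖V.1 z‖ ^ 2 + ‖V.1 z‖ ^ (2 * (r - 1)) with hg
  have hr' : 2 ≤ 2 * (r - 1) := by linarith
  have ig : ∀ V ∈ energySpace L, Integrable (g V) (stripMeasure L) := fun V hV =>
    (integrable_norm_sq V.1).add (integrable_rpow hL hr' hV)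
  obtain ⟨B, hB0, hB⟩ := exists_bound_pInt hL hr' M
  have g0 : ∀ V z, 0 ≤ g V z := fun V z => by simp only [hg]; positivity
  set A := ∫ z, g U z ∂(stripMeasure L) with hA
  have hA0 : 0 ≤ A := integral_nonneg (g0 U)
  refine Metric.tendsto_nhds.2 fun ε hε => ?_
  -- δ is such that the contributions δ A and δ (|M| + B) of the functions that are merely bounded
  -- add up to at most ε/(4c).
  set δ := ε / (4 * c * (A + |M| + B + 1)) with hδ
  have hδ0 : 0 < δ := by positivity
  -- Outside this slab U is small; inside it W n is eventually small by hypothesis. The factor δ in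
  -- both thresholds compensates the weight 1/δ.
  obtain ⟨N, hN⟩ := ((tendsto_setIntegral_compl_slab (ig U hU)).eventually_lt_const
    (show 0 < δ * (ε / (4 * c)) by positivity)).exists
  set s := slab ((N : ℝ) + 1) with hs
  have hsm : MeasurableSet s := measurableSet_slab _
  have hslab : Tendsto (fun n => ∫ z in s, g (W n) z ∂(stripMeasure L)) l (𝓝 0) := by
    have h1 := h0 ((N : ℝ) + 1) (by positivity)
    have h2 := tendsto_setIntegral_rpow hL hr' hW hM h1
    have h3 := h1.add h2
    rw [add_zero] at h3
    refine h3.congr fun n => ?_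
    exact (integral_add (integrable_norm_sq (W n).1).integrableOn
      (integrable_rpow hL hr' (hW n)).integrableOn).symm
  filter_upwards [hM, hslab.eventually_lt_const (show 0 < δ * (ε / (4 * c)) by positivity)]
    with n hn1 hn2
  set w := W n with hw
  obtain ⟨b1, b2⟩ := hB w (hW n) hn1
  have hgw : ∫ z, g w z ∂(stripMeasure L) ≤ |M| + B := by
    have e : ∫ z, g w z ∂(stripMeasure L) = ‖w.1‖ ^ 2 + pInt (2 * (r - 1)) w := by
      rw [norm_sq_eq_integral, pInt, ← integral_add (integrable_norm_sq w.1) b1]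
    rw [e]
    refine add_le_add (le_trans ?_ (hn1.trans (le_abs_self M))) b2
    rw [hSq]
    nlinarith [sq_nonneg ‖w.2.1‖, sq_nonneg ‖w.2.2.1‖]
  have i1 := integrable_rpow hL hr.le hU
  have i2 := integrable_rpow hL hr.le (hW n)
  have i3 := integrable_rpow hL hr.le ((energySpace L).add_mem hU (hW n))
  set S : ℝ × ℝ → ℝ := fun z => ‖U.1 z‖ ^ (r - 1) * ‖w.1 z‖ + ‖U.1 z‖ * ‖w.1 z‖ ^ (r - 1) with hS
  have S0 : ∀ z, 0 ≤ S z := fun z => by simp only [hS]; positivity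
  have S1 : ∀ z, S z ≤ δ * g U z + 1 / δ * g w z := fun z =>
    mul_add_mul_le (norm_nonneg _) (norm_nonneg _) hδ0
  have S2 : ∀ z, S z ≤ 1 / δ * g U z + δ * g w z := fun z => by
    have := mul_add_mul_le (r := r) (norm_nonneg (w.1 z)) (norm_nonneg (U.1 z)) hδ0
    simp only [hS, hg]
    linarith
  have iS : Integrable S (stripMeasure L) := by
    refine (((ig U hU).const_mul δ).add ((ig w (hW n)).const_mul (1 / δ))).mono' ?_
      (Eventually.of_forall fun z => ?_)
    · exact ((aestronglyMeasurable_rpow (by linarith) _).mul (Lp.aestronglyMeasurable w.1).norm).add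
        ((Lp.aestronglyMeasurable U.1).norm.mul (aestronglyMeasurable_rpow (by linarith) _))
    · rw [Real.norm_of_nonneg (S0 z)]; exact S1 z
  have hSint : ∫ z, S z ∂(stripMeasure L) < ε / c := by
    rw [← integral_add_compl hsm iS]
    have t1 : ∫ z in s, S z ∂(stripMeasure L) ≤
        δ * ∫ z in s, g U z ∂(stripMeasure L) + 1 / δ * ∫ z in s, g w z ∂(stripMeasure L) := by
      rw [← integral_const_mul, ← integral_const_mul, ← integral_add
        ((ig U hU).const_mul δ).integrableOn ((ig w (hW n)).const_mul _).integrableOn]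
      exact integral_mono iS.integrableOn (((ig U hU).const_mul δ).integrableOn.add
        ((ig w (hW n)).const_mul _).integrableOn) S1
    have t2 : ∫ z in sᶜ, S z ∂(stripMeasure L) ≤
        1 / δ * ∫ z in sᶜ, g U z ∂(stripMeasure L) + δ * ∫ z in sᶜ, g w z ∂(stripMeasure L) := by
      rw [← integral_const_mul, ← integral_const_mul, ← integral_add
        ((ig U hU).const_mul _).integrableOn ((ig w (hW n)).const_mul _).integrableOn]
      exact integral_mono iS.integrableOn (((ig U hU).const_mul _).integrableOn.add
        ((ig w (hW n)).const_mul _).integrableOn) S2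
    have t3 : ∫ z in s, g U z ∂(stripMeasure L) ≤ A :=
      setIntegral_le_integral (ig U hU) (Eventually.of_forall (g0 U))
    have t4 : ∫ z in sᶜ, g w z ∂(stripMeasure L) ≤ |M| + B :=
      (setIntegral_le_integral (ig w (hW n)) (Eventually.of_forall (g0 w))).trans hgw
    have t5 : 1 / δ * ∫ z in s, g w z ∂(stripMeasure L) < ε / (4 * c) := by
      rw [one_div_mul_eq_div, div_lt_iff₀ hδ0]; linarith
    have t6 : 1 / δ * ∫ z in sᶜ, g U z ∂(stripMeasure L) < ε / (4 * c) := by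
      rw [one_div_mul_eq_div, div_lt_iff₀ hδ0]; linarith
    have t7 : δ * A + δ * (|M| + B) ≤ ε / (4 * c) := by
      have : δ * (A + |M| + B + 1) = ε / (4 * c) := by
        rw [hδ]; field_simp
      linarith
    have t8 := mul_le_mul_of_nonneg_left t3 hδ0.le
    have t9 := mul_le_mul_of_nonneg_left t4 hδ0.le
    have t10 : ε / c = 4 * (ε / (4 * c)) := by field_simp
    have t11 : 0 < ε / (4 * c) := by positivity
    linarith
  have e : pInt r (U + w) - pInt r U - pInt r w =
      ∫ z, (‖(U + w).1 z‖ ^ r - ‖U.1 z‖ ^ r - ‖w.1 z‖ ^ r) ∂(stripMeasure L) := by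
    have e1 := integral_sub (i3.sub i1) i2
    have e2 := integral_sub i3 i1
    simp only [Pi.sub_apply] at e1
    rw [e1, e2]; rfl
  rw [Real.dist_eq, sub_zero, e]
  calc |∫ z, (‖(U + w).1 z‖ ^ r - ‖U.1 z‖ ^ r - ‖w.1 z‖ ^ r) ∂(stripMeasure L)|
      ≤ ∫ z, |‖(U + w).1 z‖ ^ r - ‖U.1 z‖ ^ r - ‖w.1 z‖ ^ r| ∂(stripMeasure L) :=
        abs_integral_le_integral_abs
    _ ≤ ∫ z, c * S z ∂(stripMeasure L) := by
        refine integral_mono_ae ((i3.sub i1).sub i2).abs (iS.const_mul c) ?_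
        filter_upwards [Lp.coeFn_add U.1 w.1] with z hz
        have : (U + w).1 z = U.1 z + w.1 z := hz
        rw [this]
        exact abs_norm_add_rpow_sub_le (by linarith) _ _
    _ = c * ∫ z, S z ∂(stripMeasure L) := integral_const_mul _ _
    _ < c * (ε / c) := by gcongr
    _ = ε := by field_simp

theorem slabSq_le_norm_sq (R : ℝ) (f : Lp ℂ 2 (stripMeasure L)) : slabSq R f ≤ ‖f‖ ^ 2 := by
  rw [norm_sq_eq_integral]
  exact setIntegral_le_integral (integrable_norm_sq f) (Eventually.of_forall fun z => by positivity)

theorem slabSq_nonneg (R : ℝ) (f : Lp ℂ 2 (stripMeasure L)) : 0 ≤ slabSq R f :=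
  integral_nonneg fun _ => by positivity

/-- Norm continuity of the potential, read off from the splitting with the remainder V n - U tending
to zero. -/
theorem tendsto_pInt (hL : 0 < L) {r : ℝ} (hr : 2 < r) {ι : Type*} {l : Filter ι}
    {U : Quad L} (hU : U ∈ energySpace L) {V : ι → Quad L} (hV : ∀ n, V n ∈ energySpace L)
    (h : Tendsto V l (𝓝 U)) : Tendsto (fun n => pInt r (V n)) l (𝓝 (pInt r U)) := by
  have h1 : Tendsto (fun n => V n - U) l (𝓝 0) := by simpa using h.sub_const U
  have hW : ∀ n, V n - U ∈ energySpace L := fun n => (energySpace L).sub_mem (hV n) hU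
  have h2 : Tendsto (fun n => hSq (V n - U)) l (𝓝 (hSq (0 : Quad L))) :=
    (continuous_hSq.tendsto _).comp h1
  have hz : hSq (0 : Quad L) = 0 := by simp [hSq]
  rw [hz] at h2
  have hM : ∀ᶠ n in l, hSq (V n - U) ≤ 1 := h2.eventually_le_const one_pos
  have h3 : Tendsto (fun n => ‖(V n - U).1‖) l (𝓝 0) := by
    have := (continuous_fst.norm.tendsto (0 : Quad L)).comp h1
    rw [Prod.fst_zero, norm_zero] at this
    exact this
  have h4 := tendsto_pInt_zero hL hr.le hW hM h3
  have h5 := tendsto_pInt_add_sub hL hr hU hW hM (fun R _ => by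
    refine squeeze_zero (fun n => slabSq_nonneg R _) (fun n => slabSq_le_norm_sq R _) ?_
    simpa using h3.pow 2)
  have h6 := (h5.add h4).add_const (pInt r U)
  simp only [add_sub_cancel, zero_add] at h6
  refine h6.congr fun n => ?_
  ring

/-- The grid size n is fixed first, so that the Poincaré error is below ε/2 uniformly along the
sequence; the finitely many cell integrals then tend to zero by weak convergence. -/
theorem tendsto_slabSq (hL : 0 < L) {ι : Type*} {l : Filter ι} {W : ι → Quad L}
    (hW : ∀ n, W n ∈ energySpace L) {M : ℝ} (hM : ∀ᶠ n in l, hSq (W n) ≤ M)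
    (h : WeakTendsto W l 0) {R : ℝ} (hR : 0 < R) :
    Tendsto (fun n => slabSq R (W n).1) l (𝓝 0) := by
  refine Metric.tendsto_nhds.2 fun ε hε => ?_
  have hlim : Tendsto (fun n : ℕ => (3 * (2 * R) ^ 2 * |M| + 3 * L ^ 2 * |M|) / (n : ℝ) ^ 2)
      atTop (𝓝 0) :=
    tendsto_const_nhds.div_atTop ((tendsto_pow_atTop two_ne_zero).comp tendsto_natCast_atTop_atTop)
  obtain ⟨n, hn1, hn2⟩ := ((hlim.eventually_lt_const (show 0 < ε / 2 by linarith)).and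
    (eventually_gt_atTop 0)).exists
  have hn' : (0 : ℝ) < n := by exact_mod_cast hn2
  have hcell : Tendsto (fun k => ∑ i ∈ Finset.range n, ∑ j ∈ Finset.range n,
      3 / (2 * R / n * (L / n)) * ‖cellInt L R n i j (W k).1‖ ^ 2) l (𝓝 0) := by
    have : ∀ i j, Tendsto (fun k => 3 / (2 * R / n * (L / n)) *
        ‖cellInt L R n i j (W k).1‖ ^ 2) l (𝓝 0) := by
      intro i j
      have h1 := ((h.map (ContinuousLinearMap.fst ℝ _ _)).map (cellInt L R n i j)).tendsto_complex
      have h2 := (h1.norm.pow 2).const_mul (3 / (2 * R / n * (L / n)))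
      simpa using h2
    have h3 := tendsto_finsetSum (Finset.range n) fun i _ =>
      tendsto_finsetSum (Finset.range n) fun j _ => this i j
    simpa using h3
  filter_upwards [hM, hcell.eventually_lt_const (show 0 < ε / 2 by linarith)] with k hk1 hk2
  rw [Real.dist_eq, sub_zero, abs_of_nonneg (slabSq_nonneg _ _)]
  have h1 := slabSq_le_sum (hW k) hL hR hn2
  have m0 : 0 ≤ ‖(W k).1‖ ^ 2 := by positivity
  have m1 : 0 ≤ ‖(W k).2.1‖ ^ 2 := by positivity
  have m2 : 0 ≤ ‖(W k).2.2.1‖ ^ 2 := by positivity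
  rw [hSq] at hk1
  have a1 : ‖(W k).2.1‖ ^ 2 ≤ |M| := by linarith [le_abs_self M]
  have a2 : ‖(W k).2.2.1‖ ^ 2 ≤ |M| := by linarith [le_abs_self M]
  have b1 : 3 * (2 * R / n) ^ 2 * ‖(W k).2.1‖ ^ 2 + 3 * (L / n) ^ 2 * ‖(W k).2.2.1‖ ^ 2 ≤
      (3 * (2 * R) ^ 2 * |M| + 3 * L ^ 2 * |M|) / (n : ℝ) ^ 2 := by
    calc _ ≤ 3 * (2 * R / n) ^ 2 * |M| + 3 * (L / n) ^ 2 * |M| := by gcongr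
      _ = _ := by field_simp
  linarith

/-- First δ controls the derivative term, then local compactness the slab term. The delta is thus a
compact perturbation and is not felt by the escaping part. -/
theorem tendsto_norm_trace (hL : 0 < L) {ι : Type*} {l : Filter ι} {W : ι → Quad L}
    (hW : ∀ n, W n ∈ energySpace L) {M : ℝ} (hM : ∀ᶠ n in l, hSq (W n) ≤ M)
    (h : WeakTendsto W l 0) : Tendsto (fun n => ‖(W n).2.2.2‖ ^ 2) l (𝓝 0) := by
  refine Metric.tendsto_nhds.2 fun ε hε => ?_
  set δ := ε / (2 * (|M| + 1)) with hδ
  have hδ0 : 0 < δ := by positivity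
  have h1 := (tendsto_slabSq hL hW hM h one_pos).const_mul (1 + 1 / δ)
  rw [mul_zero] at h1
  filter_upwards [hM, h1.eventually_lt_const (show 0 < ε / 2 by linarith)] with k hk1 hk2
  rw [Real.dist_eq, sub_zero, abs_of_nonneg (by positivity)]
  have h2 := trace_sq_le_slab (hW k) hδ0
  have m0 : 0 ≤ ‖(W k).1‖ ^ 2 := by positivity
  have m2 : 0 ≤ ‖(W k).2.2.1‖ ^ 2 := by positivity
  rw [hSq] at hk1
  have a1 : ‖(W k).2.1‖ ^ 2 ≤ |M| := by linarith [le_abs_self M]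
  have a2 : δ * ‖(W k).2.1‖ ^ 2 ≤ δ * |M| := by gcongr
  have a3 : δ * (|M| + 1) = ε / 2 := by rw [hδ]; field_simp
  linarith

end DeltaStrip

/-! ### The quadratic form and the existence of a minimizer. -/

namespace DeltaStrip

variable {L : ℝ}

/-- The bilinear form of the linear part of the equation. -/
noncomputable def bForm (ω γ : ℝ) (U V : Quad L) : ℝ :=
  inner ℝ U.2.1 V.2.1 + inner ℝ U.2.2.1 V.2.2.1 + ω * inner ℝ U.1 V.1
    + γ * inner ℝ U.2.2.2 V.2.2.2

/-- The quadratic part of the Nehari functional. -/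
noncomputable def qForm (ω γ : ℝ) (U : Quad L) : ℝ :=
  ‖U.2.1‖ ^ 2 + ‖U.2.2.1‖ ^ 2 + ω * ‖U.1‖ ^ 2 + γ * ‖U.2.2.2‖ ^ 2

theorem bForm_self (ω γ : ℝ) (U : Quad L) : bForm ω γ U U = qForm ω γ U := by
  simp only [bForm, qForm, real_inner_self_eq_norm_sq]

theorem qForm_add (ω γ : ℝ) (U V : Quad L) :
    qForm ω γ (U + V) = qForm ω γ U + 2 * bForm ω γ U V + qForm ω γ V := by
  simp only [qForm, bForm, Prod.fst_add, Prod.snd_add, norm_add_sq_real]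
  ring

theorem bForm_smul_right (ω γ c : ℝ) (U V : Quad L) : bForm ω γ U (c • V) = c * bForm ω γ U V := by
  simp only [bForm, Prod.smul_fst, Prod.smul_snd, real_inner_smul_right]
  ring

theorem bForm_smul_left (ω γ c : ℝ) (U V : Quad L) : bForm ω γ (c • U) V = c * bForm ω γ U V := by
  simp only [bForm, Prod.smul_fst, Prod.smul_snd, real_inner_smul_left]
  ring

theorem qForm_smul (ω γ c : ℝ) (U : Quad L) : qForm ω γ (c • U) = c ^ 2 * qForm ω γ U := by
  rw [← bForm_self, bForm_smul_right, bForm_smul_left, bForm_self]; ring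

theorem continuous_qForm (ω γ : ℝ) : Continuous (qForm (L := L) ω γ) := by
  unfold qForm; fun_prop

theorem tendsto_bForm_zero {ι : Type*} {l : Filter ι} {W : ι → Quad L} (h : WeakTendsto W l 0)
    (ω γ : ℝ) (U : Quad L) : Tendsto (fun n => bForm ω γ U (W n)) l (𝓝 0) := by
  have h1 := (h.map (ContinuousLinearMap.fst ℝ _ _)) (innerSL ℝ U.1)
  have h' := h.map (ContinuousLinearMap.snd ℝ _ _)
  have h2 := (h'.map (ContinuousLinearMap.fst ℝ _ _)) (innerSL ℝ U.2.1)
  have h'' := h'.map (ContinuousLinearMap.snd ℝ _ _)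
  have h3 := (h''.map (ContinuousLinearMap.fst ℝ _ _)) (innerSL ℝ U.2.2.1)
  have h4 := (h''.map (ContinuousLinearMap.snd ℝ _ _)) (innerSL ℝ U.2.2.2)
  simp only [map_zero] at h1 h2 h3 h4
  have := ((h2.add h3).add (h1.const_mul ω)).add (h4.const_mul γ)
  simp only [mul_zero, add_zero] at this
  exact this

theorem exists_coercive {ω γ : ℝ} (hγ : γ < 0) (hω : γ ^ 2 / 4 < ω) :
    ∃ c : ℝ, 0 < c ∧ ∀ U ∈ energySpace L, c * hSq U ≤ qForm ω γ U := by
  have hγ2 : 0 < γ ^ 2 := by have := hγ.ne; positivity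
  have hω0 : 0 < ω := by linarith
  -- θ is the midpoint between γ²/(4ω) and 1, two numbers in this order because ω > γ²/4.
  set θ := (γ ^ 2 / (4 * ω) + 1) / 2 with hθ
  have h1 : γ ^ 2 / (4 * ω) < 1 := by
    rw [div_lt_one (by positivity)]; linarith
  have hθ1 : θ < 1 := by rw [hθ]; linarith
  have hθ2 : γ ^ 2 / (4 * ω) < θ := by rw [hθ]; linarith
  have hθ0 : 0 < θ := lt_of_le_of_lt (by positivity) hθ2
  have h2 : γ ^ 2 / (4 * θ) < ω := by
    rw [div_lt_iff₀ (by positivity)] at hθ2 ⊢; nlinarith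
  refine ⟨min (1 - θ) (ω - γ ^ 2 / (4 * θ)), lt_min (by linarith) (by linarith), fun U hU => ?_⟩
  -- With a = -γ/(2θ) the trace inequality times -γ becomes θ ‖∂ₓU‖² + γ²/(4θ) ‖U‖², where θ < 1 and
  -- γ²/(4θ) < ω.
  have ha : 0 < -γ / (2 * θ) := div_pos (by linarith) (by linarith)
  have h3 := trace_sq_le hU ha
  have h4 := mul_le_mul_of_nonneg_left h3 (show 0 ≤ -γ by linarith)
  have e : -γ * (1 / 2 * (-γ / (2 * θ) * ‖U.1‖ ^ 2 + 1 / (-γ / (2 * θ)) * ‖U.2.1‖ ^ 2))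
      = γ ^ 2 / (4 * θ) * ‖U.1‖ ^ 2 + θ * ‖U.2.1‖ ^ 2 := by
    have : γ ≠ 0 := hγ.ne
    field_simp
    ring
  rw [e] at h4
  set c := min (1 - θ) (ω - γ ^ 2 / (4 * θ)) with hc
  have c1 : c ≤ 1 - θ := min_le_left _ _
  have c2 : c ≤ ω - γ ^ 2 / (4 * θ) := min_le_right _ _
  have a1 := mul_le_mul_of_nonneg_right c1 (sq_nonneg ‖U.2.1‖)
  have a2 := mul_le_mul_of_nonneg_right c2 (sq_nonneg ‖U.1‖)
  have a3 := mul_le_mul_of_nonneg_right (show c ≤ 1 by linarith) (sq_nonneg ‖U.2.2.1‖)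
  rw [hSq, qForm]
  linarith

theorem hSq_add_le (U V : Quad L) : hSq (U - V) ≤ 2 * hSq U + 2 * hSq V := by
  have key : ∀ {E : Type} [NormedAddCommGroup E] (a b : E), ‖a - b‖ ^ 2 ≤ 2 * ‖a‖ ^ 2 + 2 * ‖b‖ ^ 2 := by
    intro E _ a b
    have := norm_sub_le a b
    nlinarith [norm_nonneg (a - b), sq_nonneg (‖a‖ - ‖b‖)]
  have h1 := key U.1 V.1
  have h2 := key U.2.1 V.2.1
  have h3 := key U.2.2.1 V.2.2.1
  simp only [hSq, Prod.fst_sub, Prod.snd_sub]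
  linarith

/-- Bounded sequences of the energy space have weak limits along ultrafilters. -/
theorem exists_weakTendsto_energySpace {ι : Type*} (l : Ultrafilter ι) {f : ι → Quad L}
    (hf : ∀ n, f n ∈ energySpace L) {M : ℝ} (hM : ∀ n, hSq (f n) ≤ M) :
    ∃ U ∈ energySpace L, WeakTendsto f l U := by
  have hb : ∀ {x : ℝ}, x ^ 2 ≤ M → x ≤ √M := fun h => Real.le_sqrt_of_sq_le h
  have s1 : ∀ n, ‖(f n).1‖ ≤ √M := fun n => hb (le_trans (by
    rw [hSq]; nlinarith [sq_nonneg ‖(f n).2.1‖, sq_nonneg ‖(f n).2.2.1‖]) (hM n))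
  have s2 : ∀ n, ‖(f n).2.1‖ ≤ √M := fun n => hb (le_trans (by
    rw [hSq]; nlinarith [sq_nonneg ‖(f n).1‖, sq_nonneg ‖(f n).2.2.1‖]) (hM n))
  have s3 : ∀ n, ‖(f n).2.2.1‖ ≤ √M := fun n => hb (le_trans (by
    rw [hSq]; nlinarith [sq_nonneg ‖(f n).1‖, sq_nonneg ‖(f n).2.1‖]) (hM n))
  have s4 : ∀ n, ‖(f n).2.2.2‖ ≤ √M := fun n => hb (by
    have := trace_sq_le (hf n) one_pos
    have h2 := hM n
    rw [hSq] at h2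
    nlinarith [sq_nonneg ‖(f n).1‖, sq_nonneg ‖(f n).2.1‖, sq_nonneg ‖(f n).2.2.1‖])
  obtain ⟨a, ha⟩ := exists_weakTendsto l s1
  obtain ⟨b, hb⟩ := exists_weakTendsto l s2
  obtain ⟨c, hc⟩ := exists_weakTendsto l s3
  obtain ⟨d, hd⟩ := exists_weakTendsto l s4
  have h : WeakTendsto f l (a, b, c, d) := ha.prodMk (hb.prodMk (hc.prodMk hd))
  exact ⟨_, h.mem_of_isClosed (energySpace L).convex isClosed_energySpace hf, h⟩

theorem pInt_smul {r : ℝ} (U : Quad L) (c : ℝ) : pInt r (c • U) = |c| ^ r * pInt r U := by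
  rw [pInt, pInt, ← integral_const_mul]
  refine integral_congr_ae ?_
  filter_upwards [Lp.coeFn_smul c U.1] with z hz
  have : (c • U).1 z = c • U.1 z := hz
  rw [this, norm_smul, Real.mul_rpow (norm_nonneg _) (norm_nonneg _), Real.norm_eq_abs]

theorem ae_eq_zero_of_pInt {r : ℝ} (hL : 0 < L) (hr : 2 ≤ r) {U : Quad L} (hU : U ∈ energySpace L)
    (h : pInt r U = 0) : U.1 =ᵐ[stripMeasure L] 0 := by
  have h1 := (integral_eq_zero_iff_of_nonneg (fun z => by positivity)
    (integrable_rpow hL hr hU)).1 h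
  filter_upwards [h1] with z hz
  simp only [Pi.zero_apply] at hz ⊢
  rwa [Real.rpow_eq_zero (norm_nonneg _) (by linarith), norm_eq_zero] at hz

theorem exists_pInt_pos (hL : 0 < L) {r : ℝ} (hr : 2 ≤ r) :
    ∃ U ∈ energySpace L, 0 < pInt r U := by
  let b : ContDiffBump ((0, L / 2) : ℝ × ℝ) := ⟨L / 4, L / 2, by positivity, by linarith⟩
  have hφ : IsCc (fun z => ((b z : ℝ) : ℂ)) :=
    ⟨Complex.ofRealCLM.contDiff.comp b.contDiff,
      hasCompactSupport_of_imp b.hasCompactSupport fun z hz => by simp [hz]⟩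
  refine ⟨hφ.quad L, quad_mem hφ, lt_of_le_of_ne (pInt_nonneg _ _) fun h => ?_⟩
  have h1 := ae_eq_zero_of_pInt hL hr (quad_mem hφ) h.symm
  have h2 : ∀ᵐ z ∂(stripMeasure L), ((b z : ℝ) : ℂ) = 0 := by
    filter_upwards [h1, (hφ.memLp L).coeFn_toLp] with z hz hz'
    have : (hφ.quad L).1 z = ((b z : ℝ) : ℂ) := hz'
    rw [← this, hz]; rfl
  have hsub : Metric.ball ((0, L / 2) : ℝ × ℝ) (L / 2) ⊆ strip L := by
    rintro ⟨x, y⟩ hz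
    rw [Metric.mem_ball, Prod.dist_eq, max_lt_iff, Real.dist_eq, Real.dist_eq] at hz
    have := abs_lt.1 hz.2
    exact ⟨trivial, by simp only at this ⊢; linarith, by simp only at this ⊢; linarith⟩
  have h3 : volume (Metric.ball ((0, L / 2) : ℝ × ℝ) (L / 2)) = 0 := by
    rw [stripMeasure, ae_restrict_iff' (measurableSet_strip L), ae_iff] at h2
    refine measure_mono_null (fun z hz => ?_) h2
    simp only [Set.mem_ofPred_eq, Classical.not_imp, Complex.ofReal_eq_zero]
    exact ⟨hsub hz, (b.pos_of_mem_ball hz).ne'⟩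
  exact (Metric.measure_ball_pos volume _ (by positivity)).ne' h3

/-- The minimal value of the quadratic form on the unit sphere of the potential energy. -/
noncomputable def minLevel (L ω γ r : ℝ) : ℝ :=
  sInf {q | ∃ U ∈ energySpace L, pInt r U = 1 ∧ qForm ω γ U = q}

section Minimization

variable {ω γ r : ℝ} (hL : 0 < L) (hγ : γ < 0) (hω : γ ^ 2 / 4 < ω) (hr : 2 < r)
include hL hγ hω hr

omit hL hr in
theorem qForm_nonneg {U : Quad L} (hU : U ∈ energySpace L) : 0 ≤ qForm ω γ U := by
  obtain ⟨c, hc, h⟩ := exists_coercive (L := L) hγ hω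
  exact le_trans (mul_nonneg hc.le (hSq_nonneg U)) (h U hU)

omit hL hr in
theorem bddBelow_levels : BddBelow {q | ∃ U ∈ energySpace L, pInt r U = 1 ∧ qForm ω γ U = q} :=
  ⟨0, by rintro _ ⟨U, hU, -, rfl⟩; exact qForm_nonneg hγ hω hU⟩

omit hγ hω in
theorem exists_normalized {U : Quad L} (hU : U ∈ energySpace L) (hP : 0 < pInt r U) :
    ∃ c : ℝ, 0 < c ∧ c • U ∈ energySpace L ∧ pInt r (c • U) = 1 ∧
      c ^ 2 * (pInt r U) ^ (2 / r) = 1 := by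
  refine ⟨(pInt r U) ^ (-(1 / r)), by positivity, (energySpace L).smul_mem _ hU, ?_, ?_⟩
  · rw [pInt_smul, abs_of_pos (by positivity), ← Real.rpow_mul hP.le]
    have : -(1 / r) * r = -1 := by field_simp
    rw [this, Real.rpow_neg_one, inv_mul_cancel₀ hP.ne']
  · rw [← Real.rpow_natCast, ← Real.rpow_mul hP.le, ← Real.rpow_add hP]
    have : -(1 / r) * (2 : ℕ) + 2 / r = 0 := by push_cast; ring
    rw [this, Real.rpow_zero]

theorem levels_nonempty : {q | ∃ U ∈ energySpace L, pInt r U = 1 ∧ qForm ω γ U = q}.Nonempty := by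
  obtain ⟨U, hU, hP⟩ := exists_pInt_pos hL hr.le
  obtain ⟨c, hc, h1, h2, -⟩ := exists_normalized hL hr hU hP
  exact ⟨_, _, h1, h2, rfl⟩

theorem minLevel_nonneg : 0 ≤ minLevel L ω γ r :=
  le_csInf (levels_nonempty hL hγ hω hr) (by rintro _ ⟨U, hU, -, rfl⟩; exact qForm_nonneg hγ hω hU)

/-- Homogeneous form of the minimization: P has degree r and q has degree 2, so the constraint P = 1
disappears. If P vanishes only q ≥ 0 is needed. -/
theorem minLevel_mul_le {U : Quad L} (hU : U ∈ energySpace L) :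
    minLevel L ω γ r * (pInt r U) ^ (2 / r) ≤ qForm ω γ U := by
  rcases (pInt_nonneg r U).eq_or_lt with h | h
  · rw [← h, Real.zero_rpow (by positivity), mul_zero]
    exact qForm_nonneg hγ hω hU
  obtain ⟨c, hc, h1, h2, h3⟩ := exists_normalized hL hr hU h
  have h4 : minLevel L ω γ r ≤ qForm ω γ (c • U) :=
    csInf_le (bddBelow_levels hγ hω) ⟨_, h1, h2, rfl⟩
  rw [qForm_smul] at h4
  have h5 := mul_le_mul_of_nonneg_right h4 (show 0 ≤ (pInt r U) ^ (2 / r) by positivity)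
  calc _ ≤ _ := h5
    _ = (c ^ 2 * (pInt r U) ^ (2 / r)) * qForm ω γ U := by ring
    _ = qForm ω γ U := by rw [h3, one_mul]

omit hγ hω hr hL in
theorem measurePreserving_shift (x₀ : ℝ) :
    MeasurePreserving (fun z : ℝ × ℝ => z + (x₀, 0)) (stripMeasure L) (stripMeasure L) := by
  rw [stripMeasure_eq]
  have := (measurePreserving_add_right (volume : Measure ℝ) x₀).prod
    (MeasurePreserving.id (sectionMeasure L))
  convert this using 1
  ext z <;> simp

omit hγ hω hr hL in
theorem integral_shift (x₀ : ℝ) (g : ℝ × ℝ → ℝ) :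
    ∫ z, g (z + (x₀, 0)) ∂(stripMeasure L) = ∫ z, g z ∂(stripMeasure L) :=
  (measurePreserving_shift x₀).integral_comp
    (Homeomorph.addRight ((x₀, 0) : ℝ × ℝ)).measurableEmbedding g

omit hγ hω hr hL in
theorem pInt_quad {φ : ℝ × ℝ → ℂ} (h : IsCc φ) :
    pInt r (h.quad L) = ∫ z, ‖φ z‖ ^ r ∂(stripMeasure L) := by
  refine integral_congr_ae ?_
  filter_upwards [(h.memLp L).coeFn_toLp] with z hz
  have : (h.quad L).1 z = φ z := hz
  rw [this]

/-- The strip, the potential and the form with γ = 0 are invariant under translations in x, so any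
section of φ can be placed under the delta before the minimal level is used. -/
theorem minLevel_mul_le_slice {φ : ℝ × ℝ → ℂ} (h : IsCc φ) (x₀ : ℝ) :
    minLevel L ω γ r * (pInt r (h.quad L)) ^ (2 / r) ≤
      qForm ω 0 (h.quad L) + γ * ∫ y, ‖φ (x₀, y)‖ ^ 2 ∂(sectionMeasure L) := by
  set ψ : ℝ × ℝ → ℂ := fun z => φ (z + (x₀, 0)) with hψ
  have h' : IsCc ψ := ⟨h.smooth.comp (contDiff_id.add contDiff_const),
    h.cpt.comp_homeomorph (Homeomorph.addRight ((x₀, 0) : ℝ × ℝ))⟩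
  have hf : ∀ z e, fderiv ℝ ψ z e = fderiv ℝ φ (z + (x₀, 0)) e := fun z e => by
    rw [hψ, fderiv_comp_add_right]
  have e1 : pInt r (h'.quad L) = pInt r (h.quad L) := by
    rw [pInt_quad, pInt_quad]
    exact integral_shift x₀ (fun z => ‖φ z‖ ^ r)
  have e2 : qForm ω γ (h'.quad L) =
      qForm ω 0 (h.quad L) + γ * ∫ y, ‖φ (x₀, y)‖ ^ 2 ∂(sectionMeasure L) := by
    simp only [qForm, IsCc.quad, norm_toLp_sq, hf]
    rw [integral_shift x₀ (fun z => ‖fderiv ℝ φ z ex‖ ^ 2),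
      integral_shift x₀ (fun z => ‖fderiv ℝ φ z ey‖ ^ 2),
      integral_shift x₀ (fun z => ‖φ z‖ ^ 2)]
    simp [hψ]
  rw [← e1, ← e2]
  exact minLevel_mul_le hL hγ hω hr (quad_mem h')

omit hγ hω in
-- Exclusion of vanishing: if every section had small mass, the L⁴ integral would be small, and t^r
-- ≤ δ t² + δ t^k + K t⁴ would push P below β.
theorem exists_large_slice (M : ℝ) {β : ℝ} (hβ : 0 < β) :
    ∃ c : ℝ, 0 < c ∧ ∀ (φ : ℝ × ℝ → ℂ) (h : IsCc φ), smoothSq L φ ≤ M → β ≤ pInt r (h.quad L) →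
      ∃ x₀, c ≤ ∫ y, ‖φ (x₀, y)‖ ^ 2 ∂(sectionMeasure L) := by
  obtain ⟨i, hi⟩ := exists_nat_ge r
  obtain ⟨C, hC0, hC⟩ := integral_pow_le hL i (|M| + 1) (by positivity)
  have hk : r < (4 * (i + 1) : ℕ) := by
    push_cast; linarith [Nat.cast_nonneg (α := ℝ) i]
  -- δ keeps the first two terms below β/4 and c below keeps the L⁴ term below β/4.
  set δ := β / (4 * (|M| + C + 1)) with hδ
  obtain ⟨K, hK0, hK⟩ := rpow_le_eps_sq_add_pow_four hr hk (δ := δ) (by positivity)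
  have hLi : 0 < 1 / L := by positivity
  set c := β / (4 * (K + 1) * ((1 / L + 1) * (|M| + 1))) with hc
  refine ⟨c, by positivity, fun φ h hM hP => ?_⟩
  by_contra! hcon
  have h4 := integral_pow_four_le_of_slice hL h (fun x => (hcon x).le)
  have hM' : smoothSq L φ ≤ |M| := hM.trans (le_abs_self M)
  have hC' := hC φ h (by linarith)
  have i2 := integrable_norm_pow (L := L) h.continuous h.cpt two_ne_zero
  have i4 := integrable_norm_pow (L := L) h.continuous h.cpt (n := 4) (by norm_num)
  have ik := integrable_norm_pow (L := L) h.continuous h.cpt (n := 4 * (i + 1)) (by omega)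
  have m2 : ∫ z, ‖φ z‖ ^ 2 ∂(stripMeasure L) ≤ |M| := by
    have m1 : 0 ≤ ∫ z, ‖fderiv ℝ φ z ex‖ ^ 2 ∂(stripMeasure L) :=
      integral_nonneg fun _ => by positivity
    have m2 : 0 ≤ ∫ z, ‖fderiv ℝ φ z ey‖ ^ 2 ∂(stripMeasure L) :=
      integral_nonneg fun _ => by positivity
    rw [smoothSq] at hM'
    linarith
  have hle : pInt r (h.quad L) ≤ δ * |M| + δ * C + K * (c * ((1 / L + 1) * (|M| + 1))) := by
    rw [pInt_quad]
    calc ∫ z, ‖φ z‖ ^ r ∂(stripMeasure L)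
        ≤ ∫ z, (δ * ‖φ z‖ ^ 2 + δ * ‖φ z‖ ^ (4 * (i + 1)) + K * ‖φ z‖ ^ 4) ∂(stripMeasure L) := by
          refine integral_mono ?_ (((i2.const_mul _).add (ik.const_mul _)).add (i4.const_mul _))
            fun z => hK _ (norm_nonneg _)
          exact integrable_strip (h.continuous.norm.rpow_const fun _ => Or.inr (by linarith))
            (hasCompactSupport_of_imp h.cpt fun z hz => by
              rw [hz, norm_zero, Real.zero_rpow (by linarith)])
      _ = δ * ∫ z, ‖φ z‖ ^ 2 ∂(stripMeasure L) + δ * ∫ z, ‖φ z‖ ^ (4 * (i + 1)) ∂(stripMeasure L)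
          + K * ∫ z, ‖φ z‖ ^ 4 ∂(stripMeasure L) := by
          have e1 := integral_add ((i2.const_mul δ).add (ik.const_mul δ)) (i4.const_mul K)
          simp only [Pi.add_apply] at e1
          rw [e1, integral_add (i2.const_mul δ) (ik.const_mul δ), integral_const_mul,
            integral_const_mul, integral_const_mul]
      _ ≤ _ := by
          have hδ0 : 0 ≤ δ := by positivity
          have hc0 : 0 ≤ c := by positivity
          gcongr
          refine h4.trans ?_
          gcongr
          linarith
  have e1 : K * (c * ((1 / L + 1) * (|M| + 1))) ≤ β / 4 := by
    have : c * ((1 / L + 1) * (|M| + 1)) = β / (4 * (K + 1)) := by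
      rw [hc]; field_simp
    rw [this, mul_div_assoc', div_le_div_iff₀ (by positivity) (by norm_num)]
    nlinarith
  have e2 : δ * |M| + δ * C ≤ β / 4 := by
    have h1 : δ * (|M| + C + 1) = β / 4 := by rw [hδ]; field_simp
    have : 0 ≤ δ := by positivity
    linarith
  linarith

/-- Away from the delta nothing is gained from it, whereas moving a large section under it would
gain at least -γ c. The form without delta therefore lies above the minimal level by a fixed amount,
which makes escape too expensive. -/
theorem exists_gap (M : ℝ) {β : ℝ} (hβ : 0 < β) :
    ∃ c : ℝ, 0 < c ∧ ∀ W ∈ energySpace L, hSq W ≤ M → β ≤ pInt r W →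
      minLevel L ω γ r * (pInt r W) ^ (2 / r) + c ≤ qForm ω 0 W := by
  -- M + 1 and β/2 leave room for approximating W by smooth functions, whose sections are defined
  -- pointwise.
  obtain ⟨c, hc0, hc⟩ := exists_large_slice hL hr (M + 1) (half_pos hβ)
  refine ⟨-γ * c, mul_pos (by linarith) hc0, fun W hW hM hP => ?_⟩
  obtain ⟨φ, h, hlim⟩ := exists_seq_quad hW
  have t1 := tendsto_pInt hL hr hW (fun n => quad_mem (h n)) hlim
  have t2 := (continuous_hSq.tendsto W).comp hlim
  have t3 := ((continuous_qForm ω 0).tendsto W).comp hlim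
  have t4 := ((t1.rpow_const (p := 2 / r) (Or.inr (by positivity))).const_mul
    (minLevel L ω γ r)).add_const (-γ * c)
  refine le_of_tendsto_of_tendsto t4 t3 ?_
  filter_upwards [t1.eventually_const_le (show β / 2 < pInt r W by linarith),
    t2.eventually_le_const (show hSq W < M + 1 by linarith)] with n hn1 hn2
  rw [Function.comp_apply, hSq_quad] at hn2
  obtain ⟨x₀, hx⟩ := hc (φ n) (h n) hn2 hn1
  have := minLevel_mul_le_slice hL hγ hω hr (h n) x₀
  simp only [Function.comp_apply]
  nlinarith

/-- Concentration-compactness with a single alternative: either the weak limit carries all of P, or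
the escaping remainder pays the strict gap of `exists_gap`. Weak lower semicontinuity then
concludes. -/
theorem exists_minimizer : ∃ U ∈ energySpace L, pInt r U = 1 ∧ qForm ω γ U = minLevel L ω γ r := by
  set m := minLevel L ω γ r with hm
  have hm0 : 0 ≤ m := minLevel_nonneg hL hγ hω hr
  have hseq : ∀ n : ℕ, ∃ U ∈ energySpace L, pInt r U = 1 ∧ qForm ω γ U < m + 1 / ((n : ℝ) + 1) := by
    intro n
    obtain ⟨_, ⟨U, hU, h1, rfl⟩, h2⟩ := Real.lt_sInf_add_pos (levels_nonempty hL hγ hω hr)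
      (show 0 < 1 / ((n : ℝ) + 1) by positivity)
    exact ⟨U, hU, h1, h2⟩
  choose V hV hP hQ using hseq
  have hQlim : Tendsto (fun n => qForm ω γ (V n)) atTop (𝓝 m) := by
    refine tendsto_of_tendsto_of_tendsto_of_le_of_le tendsto_const_nhds
      (by simpa using tendsto_one_div_add_atTop_nhds_zero_nat.const_add m) (fun n => ?_)
      fun n => (hQ n).le
    exact csInf_le (bddBelow_levels hγ hω) ⟨_, hV n, hP n, rfl⟩
  obtain ⟨c₀, hc₀, hcoer⟩ := exists_coercive (L := L) hγ hω
  have hB : ∀ n, hSq (V n) ≤ (m + 1) / c₀ := by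
    intro n
    rw [le_div_iff₀ hc₀, mul_comm]
    refine (hcoer _ (hV n)).trans ((hQ n).le.trans ?_)
    gcongr
    rw [div_le_one (by positivity)]
    linarith [Nat.cast_nonneg (α := ℝ) n]
  set l : Ultrafilter ℕ := hyperfilter ℕ with hl
  obtain ⟨U, hU, hweak⟩ := exists_weakTendsto_energySpace l hV hB
  have hQlim' : Tendsto (fun n => qForm ω γ (V n)) l (𝓝 m) := hQlim.mono_left Nat.hyperfilter_le_atTop
  set W : ℕ → Quad L := fun n => V n - U with hW
  have hWm : ∀ n, W n ∈ energySpace L := fun n => (energySpace L).sub_mem (hV n) hU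
  have hWw : WeakTendsto W l 0 := by simpa using hweak.sub_const U
  set M := 2 * ((m + 1) / c₀) + 2 * hSq U with hMdef
  have hWB : ∀ n, hSq (W n) ≤ M := fun n => (hSq_add_le _ _).trans (by linarith [hB n])
  have hWB' : ∀ᶠ n in (l : Filter ℕ), hSq (W n) ≤ M := Eventually.of_forall hWB
  have hVe : ∀ n, V n = U + W n := fun n => by simp [hW]
  have t1 := tendsto_pInt_add_sub hL hr hU hWm hWB'
    (fun R hR => tendsto_slabSq hL hWm hWB' hWw hR)
  simp only [← hVe, hP] at t1
  have t2 : Tendsto (fun n => pInt r (W n)) l (𝓝 (1 - pInt r U)) := by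
    have := t1.const_sub (1 - pInt r U)
    simpa using this
  -- The cross term vanishes by weak convergence and the trace of W n by compactness, so the
  -- remainder is governed by the form without delta.
  have t3 : Tendsto (fun n => qForm ω 0 (W n)) l (𝓝 (m - qForm ω γ U)) := by
    have a1 := tendsto_bForm_zero hWw ω γ U
    have a2 := tendsto_norm_trace hL hWm hWB' hWw
    have a3 := ((hQlim'.sub_const (qForm ω γ U)).sub (a1.const_mul 2)).sub (a2.const_mul γ)
    simp only [mul_zero, sub_zero] at a3
    refine a3.congr fun n => ?_
    rw [hVe n, qForm_add, qForm, qForm, qForm]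
    simp only [hW]
    ring
  have hUle := minLevel_mul_le hL hγ hω hr hU
  rw [← hm] at hUle
  have hβ0 : 0 ≤ 1 - pInt r U := ge_of_tendsto t2 (Eventually.of_forall fun n => pInt_nonneg _ _)
  have hω0 : 0 < ω := lt_of_le_of_lt (by positivity) hω
  -- If P(U) < 1, the case U = 0 included, the remainder costs at least m (1 - P(U))^(2/r) + c and U
  -- at least m P(U)^(2/r). Since 2/r ≤ 1, together they cost at least m + c, while the total is m.
  have hβ : 1 - pInt r U = 0 := by
    by_contra hne
    have hpos : 0 < 1 - pInt r U := lt_of_le_of_ne hβ0 (Ne.symm hne)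
    obtain ⟨c, hc0, hc⟩ := exists_gap hL hγ hω hr M (half_pos hpos)
    have t4 := ((t2.rpow_const (p := 2 / r) (Or.inr (by positivity))).const_mul
      m).add_const c
    have h1 := le_of_tendsto_of_tendsto t4 t3 (by
      filter_upwards [t2.eventually_const_le (show (1 - pInt r U) / 2 < 1 - pInt r U by linarith)]
        with n hn
      exact hc (W n) (hWm n) (hWB n) hn)
    have hs : ∀ t : ℝ, 0 ≤ t → t ≤ 1 → t ≤ t ^ (2 / r) := by
      intro t ht0 ht1
      rcases ht0.eq_or_lt with rfl | h0
      · positivity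
      · calc t = t ^ (1 : ℝ) := (Real.rpow_one t).symm
          _ ≤ t ^ (2 / r) := Real.rpow_le_rpow_of_exponent_ge h0 ht1
              (by rw [div_le_one (by linarith)]; linarith)
    have hPU := pInt_nonneg r U
    have a1 := hs _ hβ0 (by linarith)
    have a2 := hs _ hPU (by linarith)
    have a3 : m * 1 ≤ m * ((1 - pInt r U) ^ (2 / r) + (pInt r U) ^ (2 / r)) := by
      gcongr; linarith
    linarith
  have hPU : pInt r U = 1 := by linarith
  refine ⟨U, hU, hPU, le_antisymm ?_ (csInf_le (bddBelow_levels hγ hω) ⟨_, hU, hPU, rfl⟩)⟩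
  have h1 : 0 ≤ m - qForm ω γ U := ge_of_tendsto t3 (Eventually.of_forall fun n => by
    simp only [qForm, zero_mul, add_zero]; positivity)
  linarith

end Minimization

end DeltaStrip

/-! ### Modulus of an element of the energy space. -/

namespace DeltaStrip

variable {L : ℝ}

section Modulus

/-- A smooth approximation of the modulus. -/
noncomputable def smoothAbs (ε : ℝ) (φ : ℝ × ℝ → ℂ) : ℝ × ℝ → ℂ :=
  fun z => ((√(‖φ z‖ ^ 2 + ε ^ 2) - ε : ℝ) : ℂ)

theorem IsCc.smoothAbs {φ : ℝ × ℝ → ℂ} (h : IsCc φ) {ε : ℝ} (hε : 0 < ε) :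
    IsCc (smoothAbs ε φ) := by
  refine ⟨Complex.ofRealCLM.contDiff.comp ?_, hasCompactSupport_of_imp h.cpt fun z hz => ?_⟩
  · exact (((h.smooth.norm_sq ℝ).add contDiff_const).sqrt fun z => by positivity).sub contDiff_const
  · simp [DeltaStrip.smoothAbs, hz, Real.sqrt_sq hε.le]

/-- The derivative is the real inner product of φ and ∂φ divided by √(|φ|² + ε²), a quantity at
least |φ|. -/
theorem norm_fderiv_smoothAbs_le {φ : ℝ × ℝ → ℂ} (h : IsCc φ) {ε : ℝ} (hε : 0 < ε) (z e : ℝ × ℝ) :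
    ‖fderiv ℝ (smoothAbs ε φ) z e‖ ≤ ‖fderiv ℝ φ z e‖ := by
  have hpos : 0 < ‖φ z‖ ^ 2 + ε ^ 2 := by positivity
  have h1 := (((h.differentiable z).hasFDerivAt.norm_sq.add_const (ε ^ 2)).sqrt
    hpos.ne').sub_const ε
  have h2 : HasFDerivAt (smoothAbs ε φ) _ z := Complex.ofRealCLM.hasFDerivAt.comp z h1
  rw [h2.fderiv]
  simp only [ContinuousLinearMap.comp_apply, _root_.smul_apply, innerSL_apply_apply,
    smul_eq_mul, nsmul_eq_mul, Nat.cast_ofNat, Complex.ofRealCLM_apply, Complex.norm_real,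
    Real.norm_eq_abs, abs_mul]
  have hs : 0 < √(‖φ z‖ ^ 2 + ε ^ 2) := Real.sqrt_pos.2 hpos
  have h3 : ‖φ z‖ ≤ √(‖φ z‖ ^ 2 + ε ^ 2) := Real.le_sqrt_of_sq_le (by nlinarith)
  have h4 := abs_real_inner_le_norm (φ z) (fderiv ℝ φ z e)
  rw [abs_of_pos (show 0 < 1 / (2 * √(‖φ z‖ ^ 2 + ε ^ 2)) by positivity), abs_two]
  calc 1 / (2 * √(‖φ z‖ ^ 2 + ε ^ 2)) * (2 * |inner ℝ (φ z) (fderiv ℝ φ z e)|)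
      ≤ 1 / (2 * √(‖φ z‖ ^ 2 + ε ^ 2)) * (2 * (√(‖φ z‖ ^ 2 + ε ^ 2) * ‖fderiv ℝ φ z e‖)) := by
        gcongr
        exact h4.trans (by gcongr)
    _ = ‖fderiv ℝ φ z e‖ := by field_simp

/-- Subtracting ε in `smoothAbs` makes it vanish with φ, so the error is confined to a set of finite
measure. -/
theorem norm_smoothAbs_sub_le {φ : ℝ × ℝ → ℂ} {ε : ℝ} (hε : 0 < ε) (z : ℝ × ℝ) :
    ‖smoothAbs ε φ z - (‖φ z‖ : ℂ)‖ ≤ (tsupport φ).indicator (fun _ => ε) z := by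
  by_cases hz : z ∈ tsupport φ
  · rw [Set.indicator_of_mem hz, smoothAbs, ← Complex.ofReal_sub, Complex.norm_real,
      Real.norm_eq_abs, abs_le]
    have h1 : ‖φ z‖ ≤ √(‖φ z‖ ^ 2 + ε ^ 2) := Real.le_sqrt_of_sq_le (by nlinarith)
    have h2 : √(‖φ z‖ ^ 2 + ε ^ 2) ≤ ‖φ z‖ + ε := by
      rw [Real.sqrt_le_left (by positivity)]
      nlinarith [norm_nonneg (φ z)]
    constructor <;> linarith
  · have h0 := image_eq_zero_of_notMem_tsupport hz
    rw [Set.indicator_of_notMem hz, smoothAbs, h0]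
    simp [Real.sqrt_sq hε.le]

theorem lipschitzWith_norm_complex : LipschitzWith 1 (fun z : ℂ => ((‖z‖ : ℝ) : ℂ)) :=
  LipschitzWith.of_dist_le_mul fun x y => by
    rw [dist_eq_norm, ← Complex.ofReal_sub, Complex.norm_real, Real.norm_eq_abs, NNReal.coe_one,
      one_mul, dist_eq_norm]
    exact abs_norm_sub_norm_le x y

/-- The modulus of an element of `L²`. -/
noncomputable def absLp {α : Type*} [MeasurableSpace α] {μ : Measure α} (f : Lp ℂ 2 μ) :
    Lp ℂ 2 μ := lipschitzWith_norm_complex.compLp (by simp) f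

theorem absLp_ae {α : Type*} [MeasurableSpace α] {μ : Measure α} (f : Lp ℂ 2 μ) :
    absLp f =ᵐ[μ] fun z => ((‖f z‖ : ℝ) : ℂ) :=
  lipschitzWith_norm_complex.coeFn_compLp _ f

theorem continuous_absLp {α : Type*} [MeasurableSpace α] {μ : Measure α} :
    Continuous (absLp (μ := μ)) :=
  lipschitzWith_norm_complex.continuous_compLp (by simp)

theorem norm_toLp_sub_absLp_le {α : Type*} [MeasurableSpace α] {μ : Measure α} {f g : α → ℂ}
    (hf : MemLp f 2 μ) (hg : MemLp g 2 μ) {s : Set α} (hs : MeasurableSet s) (hμ : μ s ≠ ⊤)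
    {ε : ℝ} (h : ∀ z, ‖g z - (‖f z‖ : ℂ)‖ ≤ s.indicator (fun _ => ε) z) :
    ‖hg.toLp g - absLp (hf.toLp f)‖ ^ 2 ≤ ε ^ 2 * μ.real s := by
  rw [norm_sq_eq_integral]
  have e : ε ^ 2 * μ.real s = ∫ z, s.indicator (fun _ => ε ^ 2) z ∂μ := by
    rw [integral_indicator hs, setIntegral_const, smul_eq_mul, mul_comm]
  rw [e]
  refine integral_mono_ae (integrable_norm_sq _)
    ((integrableOn_const (C := ε ^ 2) hμ).integrable_indicator hs) ?_
  filter_upwards [Lp.coeFn_sub (hg.toLp g) (absLp (hf.toLp f)), hg.coeFn_toLp, hf.coeFn_toLp,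
    absLp_ae (hf.toLp f)] with z h1 h2 h3 h4
  rw [h1, Pi.sub_apply, h2, h4, h3]
  have := pow_le_pow_left₀ (norm_nonneg _) (h z) 2
  refine this.trans (le_of_eq ?_)
  by_cases hz : z ∈ s <;> simp [hz]

/-- The modulus of an element of the energy space is in the energy space, with no more energy. -/
theorem exists_abs {U : Quad L} (hU : U ∈ energySpace L) :
    ∃ V ∈ energySpace L, V.1 = absLp U.1 ∧ V.2.2.2 = absLp U.2.2.2 ∧ ‖V.2.1‖ ≤ ‖U.2.1‖ ∧
      ‖V.2.2.1‖ ≤ ‖U.2.2.1‖ := by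
  obtain ⟨φ, h, hlim⟩ := exists_seq_quad hU
  set K : ℕ → ℝ := fun n => (stripMeasure L).real (tsupport (φ n)) +
    (sectionMeasure L).real Set.univ + 1 with hK
  have hK1 : ∀ n, 1 ≤ K n := fun n => by
    have h1 : 0 ≤ (stripMeasure L).real (tsupport (φ n)) := measureReal_nonneg
    have h2 : 0 ≤ (sectionMeasure L).real Set.univ := measureReal_nonneg
    simp only [hK]; linarith
  -- The supports of φ n may grow, so ε n is adjusted to their measure to make the L² errors vanish.
  set ε : ℕ → ℝ := fun n => 1 / (((n : ℝ) + 1) * K n) with hε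
  have hε0 : ∀ n, 0 < ε n := fun n => by
    have := hK1 n
    simp only [hε]
    positivity
  have hεK : ∀ n, ε n ^ 2 * K n ≤ 1 / ((n : ℝ) + 1) := by
    intro n
    have hk := hK1 n
    have hn : (1 : ℝ) ≤ n + 1 := by linarith [Nat.cast_nonneg (α := ℝ) n]
    have e : ε n ^ 2 * K n = 1 / ((n : ℝ) + 1) * (1 / (((n : ℝ) + 1) * K n)) := by
      simp only [hε]; field_simp
    rw [e]
    refine mul_le_of_le_one_right (by positivity) ?_
    rw [div_le_one (by positivity)]
    nlinarith
  set ψ : ℕ → ℝ × ℝ → ℂ := fun n => smoothAbs (ε n) (φ n) with hψ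
  have h' : ∀ n, IsCc (ψ n) := fun n => (h n).smoothAbs (hε0 n)
  have hdist : Tendsto (fun n => ‖((h' n).quad L).1 - absLp ((h n).quad L).1‖) atTop (𝓝 0) := by
    have h1 : Tendsto (fun n : ℕ => √(1 / ((n : ℝ) + 1))) atTop (𝓝 0) := by
      have := tendsto_one_div_add_atTop_nhds_zero_nat (𝕜 := ℝ)
      have := (Real.continuous_sqrt.tendsto 0).comp this
      rwa [Real.sqrt_zero] at this
    refine squeeze_zero (fun n => norm_nonneg _) (fun n => Real.le_sqrt_of_sq_le ?_) h1
    refine (norm_toLp_sub_absLp_le ((h n).memLp L) ((h' n).memLp L)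
      (isClosed_tsupport _).measurableSet (h n).cpt.isCompact.measure_lt_top.ne
      (norm_smoothAbs_sub_le (hε0 n))).trans (le_trans ?_ (hεK n))
    have h2 : 0 ≤ (sectionMeasure L).real Set.univ := measureReal_nonneg
    have h3 := sq_nonneg (ε n)
    simp only [hK]
    nlinarith
  have hdist' : Tendsto (fun n => ‖((h' n).quad L).2.2.2 - absLp ((h n).quad L).2.2.2‖)
      atTop (𝓝 0) := by
    have h1 : Tendsto (fun n : ℕ => √(1 / ((n : ℝ) + 1))) atTop (𝓝 0) := by
      have := tendsto_one_div_add_atTop_nhds_zero_nat (𝕜 := ℝ)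
      have := (Real.continuous_sqrt.tendsto 0).comp this
      rwa [Real.sqrt_zero] at this
    refine squeeze_zero (fun n => norm_nonneg _) (fun n => Real.le_sqrt_of_sq_le ?_) h1
    refine (norm_toLp_sub_absLp_le (ε := ε n) ((h n).memLp_slice L) ((h' n).memLp_slice L)
      MeasurableSet.univ (measure_ne_top _ _)
      (fun y => (norm_smoothAbs_sub_le (hε0 n) (0, y)).trans ?_)).trans (le_trans ?_ (hεK n))
    · rw [Set.indicator_univ]
      exact Set.indicator_le_self' (fun _ _ => (hε0 n).le) _
    · have h2 : 0 ≤ (stripMeasure L).real (tsupport (φ n)) := measureReal_nonneg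
      have h3 := sq_nonneg (ε n)
      simp only [hK]
      nlinarith
  have lim1 : Tendsto (fun n => ((h n).quad L).1) atTop (𝓝 U.1) := (continuous_fst.tendsto U).comp hlim
  have lim2 : Tendsto (fun n => ((h n).quad L).2.1) atTop (𝓝 U.2.1) :=
    ((continuous_fst.comp continuous_snd).tendsto U).comp hlim
  have lim3 : Tendsto (fun n => ((h n).quad L).2.2.1) atTop (𝓝 U.2.2.1) :=
    ((continuous_fst.comp (continuous_snd.comp continuous_snd)).tendsto U).comp hlim
  have lim4 : Tendsto (fun n => ((h n).quad L).2.2.2) atTop (𝓝 U.2.2.2) :=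
    ((continuous_snd.comp (continuous_snd.comp continuous_snd)).tendsto U).comp hlim
  have s1 : Tendsto (fun n => ((h' n).quad L).1) atTop (𝓝 (absLp U.1)) := by
    have := (tendsto_zero_iff_norm_tendsto_zero.2 hdist).add
      ((continuous_absLp.tendsto U.1).comp lim1)
    simpa using this
  have s4 : Tendsto (fun n => ((h' n).quad L).2.2.2) atTop (𝓝 (absLp U.2.2.2)) := by
    have := (tendsto_zero_iff_norm_tendsto_zero.2 hdist').add
      ((continuous_absLp.tendsto U.2.2.2).comp lim4)
    simpa using this
  have hd : ∀ n e, ‖((h' n).memLp_fderiv L e).toLp _‖ ≤ ‖((h n).memLp_fderiv L e).toLp _‖ := by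
    intro n e
    refine Lp.norm_le_norm_of_ae_le ?_
    filter_upwards [((h' n).memLp_fderiv L e).coeFn_toLp, ((h n).memLp_fderiv L e).coeFn_toLp]
      with z h1 h2
    rw [h1, h2]
    exact norm_fderiv_smoothAbs_le (h n) (hε0 n) z e
  have hbd : ∃ M, ∀ n, hSq ((h' n).quad L) ≤ M := by
    obtain ⟨A, hA⟩ := s1.norm.bddAbove_range
    obtain ⟨B, hB⟩ := lim2.norm.bddAbove_range
    obtain ⟨C, hC⟩ := lim3.norm.bddAbove_range
    refine ⟨A ^ 2 + B ^ 2 + C ^ 2, fun n => ?_⟩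
    rw [hSq]
    have a1 := hA ⟨n, rfl⟩
    have a2 := (hd n ex).trans (hB ⟨n, rfl⟩)
    have a3 := (hd n ey).trans (hC ⟨n, rfl⟩)
    exact add_le_add (add_le_add (pow_le_pow_left₀ (norm_nonneg _) a1 2)
      (pow_le_pow_left₀ (norm_nonneg _) a2 2)) (pow_le_pow_left₀ (norm_nonneg _) a3 2)
  obtain ⟨M, hM⟩ := hbd
  set l : Ultrafilter ℕ := hyperfilter ℕ
  have hl : (l : Filter ℕ) ≤ atTop := Nat.hyperfilter_le_atTop
  -- The derivatives of the approximations are only bounded, hence a weak limit. The function and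
  -- the trace converge in norm, which identifies these components, and lower semicontinuity bounds
  -- the other two.
  obtain ⟨V, hV, hw⟩ := exists_weakTendsto_energySpace l (fun n => quad_mem (h' n)) hM
  have w1 := hw.map (ContinuousLinearMap.fst ℝ _ _)
  have w' := hw.map (ContinuousLinearMap.snd ℝ _ _)
  have w2 := w'.map (ContinuousLinearMap.fst ℝ _ _)
  have w'' := w'.map (ContinuousLinearMap.snd ℝ _ _)
  have w3 := w''.map (ContinuousLinearMap.fst ℝ _ _)
  have w4 := w''.map (ContinuousLinearMap.snd ℝ _ _)
  exact ⟨V, hV, w1.unique (WeakTendsto.of_tendsto (s1.mono_left hl)),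
    w4.unique (WeakTendsto.of_tendsto (s4.mono_left hl)),
    w2.norm_le (fun n => hd n ex) (lim2.norm.mono_left hl),
    w3.norm_le (fun n => hd n ey) (lim3.norm.mono_left hl)⟩

end Modulus

/-! ### Euler–Lagrange equation and rescaling to a ground state. -/

section EulerLagrange

variable {r : ℝ}

theorem hasDerivAt_norm_add_smul_rpow (hr : 1 < r) (a b : ℂ) (t : ℝ) :
    HasDerivAt (fun s : ℝ => ‖a + s • b‖ ^ r)
      (r * ‖a + t • b‖ ^ (r - 2) * inner ℝ (a + t • b) b) t := by
  have h1 : HasDerivAt (fun s : ℝ => a + s • b) b t := by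
    simpa using ((hasDerivAt_id t).smul_const b).const_add a
  have h2 := (hasFDerivAt_norm_rpow (a + t • b) hr).comp_hasDerivAt t h1
  refine h2.congr_deriv ?_
  rw [_root_.smul_apply, innerSL_apply_apply, smul_eq_mul]

/-- Integrable majorant for differentiating the potential under the integral: |a + t b| and |b| are
both at most twice max(|a|, |b|). -/
theorem abs_deriv_norm_rpow_le (hr : 2 < r) (a b : ℂ) {t : ℝ} (ht : |t| ≤ 1) :
    |r * ‖a + t • b‖ ^ (r - 2) * inner ℝ (a + t • b) b| ≤
      r * 2 ^ r * (‖a‖ ^ r + ‖b‖ ^ r) := by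
  set s := max ‖a‖ ‖b‖ with hs
  have hs0 : 0 ≤ s := le_max_of_le_left (norm_nonneg a)
  have h1 : ‖a + t • b‖ ≤ 2 * s := by
    refine (norm_add_le _ _).trans ?_
    rw [norm_smul, Real.norm_eq_abs]
    have : |t| * ‖b‖ ≤ 1 * ‖b‖ := by gcongr
    linarith [le_max_left ‖a‖ ‖b‖, le_max_right ‖a‖ ‖b‖]
  have h2 : ‖b‖ ≤ 2 * s := by linarith [le_max_right ‖a‖ ‖b‖]
  have h3 : s ^ r ≤ ‖a‖ ^ r + ‖b‖ ^ r := by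
    have pa : 0 ≤ ‖a‖ ^ r := by positivity
    have pb : 0 ≤ ‖b‖ ^ r := by positivity
    rcases max_choice ‖a‖ ‖b‖ with h | h
    · rw [hs, h]; linarith
    · rw [hs, h]; linarith
  rw [abs_mul, abs_of_nonneg (show 0 ≤ r * ‖a + t • b‖ ^ (r - 2) by positivity)]
  calc r * ‖a + t • b‖ ^ (r - 2) * |inner ℝ (a + t • b) b|
      ≤ r * (2 * s) ^ (r - 2) * (2 * s * (2 * s)) := by
        gcongr
        exact (abs_real_inner_le_norm _ _).trans (by gcongr)
    _ = r * (2 * s) ^ r := by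
        have : (2 * s) ^ r = (2 * s) ^ (r - 2) * (2 * s) ^ 2 := by
          rw [← Real.rpow_natCast (2 * s) 2, ← Real.rpow_add' (by positivity) (by push_cast; linarith)]
          congr 1; push_cast; ring
        rw [this]; ring
    _ = r * 2 ^ r * s ^ r := by rw [Real.mul_rpow (by norm_num) hs0]; ring
    _ ≤ _ := by gcongr

theorem hasDerivAt_pInt (hL : 0 < L) (hr : 2 < r) {U W : Quad L} (hU : U ∈ energySpace L)
    (hW : W ∈ energySpace L) :
    HasDerivAt (fun t : ℝ => pInt r (U + t • W))
      (r * ∫ z, ‖U.1 z‖ ^ (r - 2) * inner ℝ (U.1 z) (W.1 z) ∂(stripMeasure L)) 0 := by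
  have iU := integrable_rpow hL hr.le hU
  have iW := integrable_rpow hL hr.le hW
  have mU := Lp.aestronglyMeasurable U.1
  have mW := Lp.aestronglyMeasurable W.1
  have m1 : ∀ t : ℝ, AEStronglyMeasurable (fun z => U.1 z + t • W.1 z) (stripMeasure L) :=
    fun t => mU.add (mW.const_smul t)
  have key := hasDerivAt_integral_of_dominated_loc_of_deriv_le (μ := stripMeasure L)
    (F := fun (t : ℝ) z => ‖U.1 z + t • W.1 z‖ ^ r)
    (F' := fun (t : ℝ) z => r * ‖U.1 z + t • W.1 z‖ ^ (r - 2) *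
      inner ℝ (U.1 z + t • W.1 z) (W.1 z)) (x₀ := 0) (s := Metric.ball 0 1)
    (bound := fun z => r * 2 ^ r * (‖U.1 z‖ ^ r + ‖W.1 z‖ ^ r))
    (Metric.ball_mem_nhds 0 one_pos)
    (Eventually.of_forall fun t =>
      (Real.continuous_rpow_const (by linarith)).comp_aestronglyMeasurable (m1 t).norm)
    (by simpa using iU)
    ((((Real.continuous_rpow_const (by linarith)).comp_aestronglyMeasurable
      (m1 0).norm).const_mul r).mul ((m1 0).inner mW))
    (Eventually.of_forall fun z t ht => by
      rw [Real.norm_eq_abs]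
      refine abs_deriv_norm_rpow_le hr _ _ ?_
      rw [Metric.mem_ball, Real.dist_eq, sub_zero] at ht
      exact ht.le)
    ((iU.add iW).const_mul _)
    (Eventually.of_forall fun z t _ => hasDerivAt_norm_add_smul_rpow (by linarith) _ _ t)
  have e : (fun t : ℝ => pInt r (U + t • W)) =
      fun t : ℝ => ∫ z, ‖U.1 z + t • W.1 z‖ ^ r ∂(stripMeasure L) := by
    funext t
    refine integral_congr_ae ?_
    filter_upwards [Lp.coeFn_add U.1 (t • W.1), Lp.coeFn_smul t W.1] with z h1 h2
    have : (U + t • W).1 z = U.1 z + t • W.1 z := by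
      refine h1.trans ?_
      rw [Pi.add_apply, h2]; rfl
    rw [this]
  rw [e]
  refine key.2.congr_deriv ?_
  rw [← integral_const_mul]
  simp only [zero_smul, add_zero, mul_assoc]

/-- Minimizers of the quadratic form on the unit sphere of the potential solve the
Euler–Lagrange equation. -/
theorem euler_lagrange {ω γ : ℝ} (hL : 0 < L) (hγ : γ < 0) (hω : γ ^ 2 / 4 < ω) (hr : 2 < r)
    {U W : Quad L} (hU : U ∈ energySpace L) (hW : W ∈ energySpace L) (hP : pInt r U = 1)
    (hQ : qForm ω γ U = minLevel L ω γ r) :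
    bForm ω γ U W = minLevel L ω γ r *
      ∫ z, ‖U.1 z‖ ^ (r - 2) * inner ℝ (U.1 z) (W.1 z) ∂(stripMeasure L) := by
  set m := minLevel L ω γ r with hm
  set D := ∫ z, ‖U.1 z‖ ^ (r - 2) * inner ℝ (U.1 z) (W.1 z) ∂(stripMeasure L) with hD
  have h1 := hasDerivAt_pInt hL hr hU hW
  have h0 : pInt r (U + (0 : ℝ) • W) = 1 := by simpa using hP
  have h2 : HasDerivAt (fun t : ℝ => (pInt r (U + t • W)) ^ (2 / r)) (2 * D) 0 := by
    have := h1.rpow_const (p := 2 / r) (Or.inl (by rw [h0]; exact one_ne_zero))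
    rw [h0, Real.one_rpow] at this
    convert this using 1
    field_simp
    rw [hD]
  have h3 : HasDerivAt (fun t : ℝ => qForm ω γ (U + t • W)) (2 * bForm ω γ U W) 0 := by
    have e : (fun t : ℝ => qForm ω γ (U + t • W)) =
        fun t => qForm ω γ U + t * (2 * bForm ω γ U W) + t ^ 2 * qForm ω γ W := by
      funext t
      rw [qForm_add, qForm_smul, bForm_smul_right]; ring
    rw [e]
    have a1 := ((hasDerivAt_id (0 : ℝ)).mul_const (2 * bForm ω γ U W)).const_add (qForm ω γ U)
    have a2 := ((hasDerivAt_id (0 : ℝ)).pow 2).mul_const (qForm ω γ W)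
    refine (a1.add a2).congr_deriv ?_
    simp
  have h4 := h3.sub (h2.const_mul m)
  -- By `minLevel_mul_le` this function is nonnegative for every t, and it vanishes at t = 0. The
  -- homogeneous inequality thus dispenses with a Lagrange multiplier argument.
  have hmin : IsLocalMin (fun t : ℝ => qForm ω γ (U + t • W) - m * (pInt r (U + t • W)) ^ (2 / r)) 0 := by
    refine Eventually.of_forall fun t => ?_
    have h5 := minLevel_mul_le hL hγ hω hr
      ((energySpace L).add_mem hU ((energySpace L).smul_mem t hW))
    simp only [zero_smul, add_zero, hP, hQ, Real.one_rpow, mul_one, sub_self]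
    linarith
  have := hmin.hasDerivAt_eq_zero h4
  linarith

/-- Existence of a nonnegative solution of least energy. -/
theorem exists_ground_state {ω γ : ℝ} (hL : 0 < L) (hγ : γ < 0) (hω : γ ^ 2 / 4 < ω) (hr : 2 < r) :
    ∃ U ∈ energySpace L, (U.1 =ᵐ[stripMeasure L] fun z => ((‖U.1 z‖ : ℝ) : ℂ)) ∧
      (U.2.2.2 =ᵐ[sectionMeasure L] fun y => ((‖U.2.2.2 y‖ : ℝ) : ℂ)) ∧ 0 < pInt r U ∧
      (∀ W ∈ energySpace L, bForm ω γ U W =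
        ∫ z, ‖U.1 z‖ ^ (r - 2) * inner ℝ (U.1 z) (W.1 z) ∂(stripMeasure L)) ∧
      ∀ V ∈ energySpace L, 0 < pInt r V → qForm ω γ V = pInt r V → pInt r U ≤ pInt r V := by
  obtain ⟨U₀, hU₀, hP₀, hQ₀⟩ := exists_minimizer hL hγ hω hr
  obtain ⟨U, hU, e1, e4, l2, l3⟩ := exists_abs hU₀
  set m := minLevel L ω γ r with hm
  have hn : ∀ {α : Type} [MeasurableSpace α] {μ : Measure α} (f : Lp ℂ 2 μ),
      ∀ᵐ z ∂μ, ‖absLp f z‖ = ‖f z‖ := by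
    intro α _ μ f
    filter_upwards [absLp_ae f] with z hz
    rw [hz, Complex.norm_real, norm_norm]
  have hn' : ∀ {α : Type} [MeasurableSpace α] {μ : Measure α} (f : Lp ℂ 2 μ), ‖absLp f‖ = ‖f‖ := by
    intro α _ μ f
    exact le_antisymm (Lp.norm_le_norm_of_ae_le ((hn f).mono fun z hz => hz.le))
      (Lp.norm_le_norm_of_ae_le ((hn f).mono fun z hz => hz.ge))
  have hP : pInt r U = 1 := by
    rw [← hP₀, pInt, pInt, e1]
    refine integral_congr_ae ?_
    filter_upwards [hn U₀.1] with z hz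
    rw [hz]
  have hQ : qForm ω γ U = m := by
    refine le_antisymm ?_ (csInf_le (bddBelow_levels hγ hω) ⟨_, hU, hP, rfl⟩)
    rw [← hQ₀, qForm, qForm, e1, e4, hn', hn']
    gcongr
  have hm0 : 0 < m := by
    obtain ⟨c, hc, hcoer⟩ := exists_coercive (L := L) hγ hω
    rw [← hQ]
    refine lt_of_lt_of_le (mul_pos hc (lt_of_le_of_ne (hSq_nonneg U) fun h => ?_)) (hcoer U hU)
    have h1 : ‖U.1‖ ^ 2 = 0 := by
      rw [hSq] at h
      nlinarith [sq_nonneg ‖U.1‖, sq_nonneg ‖U.2.1‖, sq_nonneg ‖U.2.2.1‖]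
    have h2 : U.1 = 0 := by simpa using h1
    have : pInt r U = 0 := by
      rw [pInt, h2]
      refine integral_eq_zero_of_ae ?_
      filter_upwards [Lp.coeFn_zero ℂ 2 (stripMeasure L)] with z hz
      rw [hz]
      simp [Real.zero_rpow (show r ≠ 0 by linarith)]
    linarith
  -- Chosen so that lam^(r-2) = m: the linear side of the equation scales like lam and the power
  -- side like lam^(r-1), so the factor m disappears.
  set lam := m ^ (1 / (r - 2)) with hlam
  have hlam0 : 0 < lam := by positivity
  have hlamr : lam ^ (r - 2) = m := by
    rw [hlam, ← Real.rpow_mul hm0.le, one_div_mul_cancel (by linarith), Real.rpow_one]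
  have hco : ∀ᵐ z ∂(stripMeasure L), (lam • U).1 z = lam • U.1 z := Lp.coeFn_smul lam U.1
  have hco4 : ∀ᵐ y ∂(sectionMeasure L), (lam • U).2.2.2 y = lam • U.2.2.2 y :=
    Lp.coeFn_smul lam U.2.2.2
  have hPl : pInt r (lam • U) = lam ^ r := by rw [pInt_smul, hP, abs_of_pos hlam0, mul_one]
  refine ⟨lam • U, (energySpace L).smul_mem _ hU, ?_, ?_, ?_, fun W hW => ?_, fun V hV hV0 hVq => ?_⟩
  · filter_upwards [hco, absLp_ae U₀.1, hn U₀.1] with z h1 h2 h3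
    rw [h1, e1, norm_smul, h3, h2, Real.norm_of_nonneg hlam0.le]
    simp
  · filter_upwards [hco4, absLp_ae U₀.2.2.2, hn U₀.2.2.2] with z h1 h2 h3
    rw [h1, e4, norm_smul, h3, h2, Real.norm_of_nonneg hlam0.le]
    simp
  · rw [hPl]; positivity
  · rw [bForm_smul_left, euler_lagrange hL hγ hω hr hU hW hP hQ, ← hm, ← mul_assoc,
      ← integral_const_mul]
    refine integral_congr_ae ?_
    filter_upwards [hco] with z hz
    rw [hz, norm_smul, real_inner_smul_left, Real.norm_of_nonneg hlam0.le,
      Real.mul_rpow hlam0.le (norm_nonneg _), hlamr]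
    ring
  -- With q(V) = P(V) the inequality reads m P(V)^(2/r) ≤ P(V), so P(V) ≥ m^(r/(r-2)) = lam^r, the
  -- value attained.
  · have h1 := minLevel_mul_le hL hγ hω hr hV
    rw [hVq, ← hm] at h1
    have h2 : m ≤ (pInt r V) ^ ((r - 2) / r) := by
      have e : pInt r V = (pInt r V) ^ ((r - 2) / r) * (pInt r V) ^ (2 / r) := by
        rw [← Real.rpow_add hV0]
        have : (r - 2) / r + 2 / r = 1 := by field_simp; ring
        rw [this, Real.rpow_one]
      rw [e] at h1
      have hp : 0 < (pInt r V) ^ (2 / r) := by positivity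
      have h1' : m * (pInt r V) ^ (2 / r) ≤ (pInt r V) ^ ((r - 2) / r) * (pInt r V) ^ (2 / r) := by
        rw [← e] at h1 ⊢; exact h1
      exact le_of_mul_le_mul_right h1' hp
    rw [hPl, hlam, ← Real.rpow_mul hm0.le]
    have h3 := Real.rpow_le_rpow hm0.le h2 (show 0 ≤ 1 / (r - 2) * r by
      have : 0 < r - 2 := by linarith
      positivity)
    rw [← Real.rpow_mul hV0.le] at h3
    have : (r - 2) / r * (1 / (r - 2) * r) = 1 := by
      have : r - 2 ≠ 0 := by linarith
      field_simp
    rwa [this, Real.rpow_one] at h3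

end EulerLagrange

end DeltaStrip

/-! ### Weak derivatives. -/

namespace DeltaStrip

variable {L : ℝ}

section WeakDerivative

theorem isOpen_openStrip : IsOpen (openStrip L) := isOpen_univ.prod isOpen_Ioo

theorem openStrip_subset : openStrip L ⊆ strip L :=
  Set.prod_mono_right Set.Ioo_subset_Icc_self

theorem ae_mem_openStrip : ∀ᵐ z ∂(stripMeasure L), z ∈ openStrip L := by
  have h1 : ∀ᵐ y ∂(sectionMeasure L), y ∈ Set.Ioo 0 L := by
    rw [sectionMeasure, ← restrict_Ioo_eq_restrict_Icc]
    exact ae_restrict_mem measurableSet_Ioo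
  rw [stripMeasure_eq]
  have := Measure.quasiMeasurePreserving_snd (μ := (volume : Measure ℝ))
    (ν := sectionMeasure L) |>.ae h1
  filter_upwards [this] with z hz
  exact ⟨trivial, hz⟩

/-- Integrals against functions supported in the strip. -/
theorem integral_strip_eq {F : Type*} [NormedAddCommGroup F] [NormedSpace ℝ F] {f : ℝ × ℝ → F}
    (h : ∀ z ∉ strip L, f z = 0) : ∫ z, f z ∂(stripMeasure L) = ∫ z, f z :=
  setIntegral_eq_integral_of_forall_compl_eq_zero h

theorem continuous_integral_ofReal_mul {α : Type*} [MeasurableSpace α] {μ : Measure α} {h : α → ℝ}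
    (hh : MemLp (fun z => (h z : ℂ)) 2 μ) :
    Continuous fun f : Lp ℂ 2 μ => ∫ z, (h z : ℂ) * f z ∂μ := by
  have e : (fun f : Lp ℂ 2 μ => ∫ z, (h z : ℂ) * f z ∂μ) = fun f => inner ℂ (hh.toLp _) f := by
    funext f
    rw [L2.inner_def]
    refine integral_congr_ae ?_
    filter_upwards [hh.coeFn_toLp] with z hz
    rw [hz, RCLike.inner_apply, Complex.conj_ofReal, mul_comm]
  rw [e]
  fun_prop

theorem memLp_ofReal {h : ℝ × ℝ → ℝ} (hc : Continuous h) (hs : HasCompactSupport h) :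
    MemLp (fun z => (h z : ℂ)) 2 (stripMeasure L) :=
  (Complex.continuous_ofReal.comp hc).memLp_of_hasCompactSupport
    (hasCompactSupport_of_imp hs fun z hz => by simp [hz])

theorem integral_ofReal_mul_congr {α : Type*} [MeasurableSpace α] {μ : Measure α} {h : α → ℝ}
    {f : α → ℂ} (hf : MemLp f 2 μ) :
    ∫ z, (h z : ℂ) * hf.toLp f z ∂μ = ∫ z, (h z : ℂ) * f z ∂μ := by
  refine integral_congr_ae ?_
  filter_upwards [hf.coeFn_toLp] with z hz
  rw [hz]

theorem fderiv_ofReal_comp {φ : ℝ × ℝ → ℝ} (hφ : Differentiable ℝ φ) (z e : ℝ × ℝ) :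
    fderiv ℝ (fun z => (φ z : ℂ)) z e = (fderiv ℝ φ z e : ℂ) := by
  have : HasFDerivAt (fun z => (φ z : ℂ)) _ z :=
    Complex.ofRealCLM.hasFDerivAt.comp z (hφ z).hasFDerivAt
  rw [this.fderiv]; rfl

theorem IsTest.contDiff_one {φ : ℝ × ℝ → ℝ} (h : IsTest L φ) : ContDiff ℝ 1 φ :=
  h.1.of_le (by exact_mod_cast le_top)

theorem IsTest.eq_zero {φ : ℝ × ℝ → ℝ} (h : IsTest L φ) {z : ℝ × ℝ} (hz : z ∉ strip L) : φ z = 0 :=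
  image_eq_zero_of_notMem_tsupport fun h' => hz (openStrip_subset (h.2.2 h'))

theorem IsTest.fderiv_eq_zero {φ : ℝ × ℝ → ℝ} (h : IsTest L φ) {z : ℝ × ℝ} (hz : z ∉ strip L) :
    fderiv ℝ φ z = 0 :=
  image_eq_zero_of_notMem_tsupport fun h' =>
    hz (openStrip_subset (h.2.2 (tsupport_fderiv_subset ℝ h')))

/-- The test function vanishes outside the strip, so integration by parts can be done on the whole
plane without boundary terms. -/
theorem integral_fderiv_test_mul {φ : ℝ × ℝ → ℝ} (hφ : IsTest L φ) {ψ : ℝ × ℝ → ℂ} (hψ : IsCc ψ)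
    (e : ℝ × ℝ) : ∫ z, (fderiv ℝ φ z e : ℂ) * ψ z ∂(stripMeasure L) =
      - ∫ z, (φ z : ℂ) * fderiv ℝ ψ z e ∂(stripMeasure L) := by
  have hd : Differentiable ℝ φ := hφ.contDiff_one.differentiable one_ne_zero
  have hc : Continuous (fun z => (φ z : ℂ)) := Complex.continuous_ofReal.comp hφ.1.continuous
  have hc' : Continuous (fun z => (fderiv ℝ φ z e : ℂ)) :=
    Complex.continuous_ofReal.comp (continuous_fderiv_dir hφ.contDiff_one e)
  rw [integral_strip_eq (fun z hz => by simp [hφ.fderiv_eq_zero hz]),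
    integral_strip_eq (fun z hz => by simp [hφ.eq_zero hz])]
  have key := integral_mul_fderiv_eq_neg_fderiv_mul_of_integrable (μ := volume)
    (f := fun z => (φ z : ℂ)) (g := ψ) (v := e) ?_ ?_ ?_ ?_ ?_
  · rw [key, neg_neg]
    simp only [fderiv_ofReal_comp hd]
  · simp only [fderiv_ofReal_comp hd]
    exact (hc'.mul hψ.continuous).integrable_of_hasCompactSupport
      (hasCompactSupport_of_imp hψ.cpt fun z hz => by simp [hz])
  · exact (hc.mul (hψ.continuous_fderiv e)).integrable_of_hasCompactSupport
      (hasCompactSupport_of_imp hφ.2.1 fun z hz => by simp [hz])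
  · exact (hc.mul hψ.continuous).integrable_of_hasCompactSupport
      (hasCompactSupport_of_imp hφ.2.1 fun z hz => by simp [hz])
  · exact fun z _ => Complex.ofRealCLM.differentiableAt.comp z (hd z)
  · exact fun z _ => hψ.differentiable z

theorem hasWeakDeriv_ex {U : Quad L} (hU : U ∈ energySpace L) : HasWeakDeriv L ex U.1 U.2.1 := by
  refine ⟨Lp.memLp _, fun φ hφ => ?_⟩
  have c1 := continuous_integral_ofReal_mul (memLp_ofReal (L := L) hφ.1.continuous hφ.2.1)
  have c2 := continuous_integral_ofReal_mul (memLp_ofReal (L := L)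
    (continuous_fderiv_dir hφ.contDiff_one ex) (hasCompactSupport_fderiv_dir hφ.2.1 ex))
  refine energySpace_induction (P := fun U => ∫ z, (fderiv ℝ φ z ex : ℂ) * U.1 z ∂(stripMeasure L)
    = - ∫ z, (φ z : ℂ) * U.2.1 z ∂(stripMeasure L)) (isClosed_eq (c2.comp continuous_fst)
    (c1.comp (continuous_fst.comp continuous_snd)).neg) (fun ψ h => ?_) U hU
  simp only [IsCc.quad, integral_ofReal_mul_congr]
  exact integral_fderiv_test_mul hφ h ex

theorem hasWeakDeriv_ey {U : Quad L} (hU : U ∈ energySpace L) : HasWeakDeriv L ey U.1 U.2.2.1 := by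
  refine ⟨Lp.memLp _, fun φ hφ => ?_⟩
  have c1 := continuous_integral_ofReal_mul (memLp_ofReal (L := L) hφ.1.continuous hφ.2.1)
  have c2 := continuous_integral_ofReal_mul (memLp_ofReal (L := L)
    (continuous_fderiv_dir hφ.contDiff_one ey) (hasCompactSupport_fderiv_dir hφ.2.1 ey))
  refine energySpace_induction (P := fun U => ∫ z, (fderiv ℝ φ z ey : ℂ) * U.1 z ∂(stripMeasure L)
    = - ∫ z, (φ z : ℂ) * U.2.2.1 z ∂(stripMeasure L)) (isClosed_eq (c2.comp continuous_fst)
    (c1.comp (continuous_fst.comp (continuous_snd.comp continuous_snd))).neg) (fun ψ h => ?_) U hU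
  simp only [IsCc.quad, integral_ofReal_mul_congr]
  exact integral_fderiv_test_mul hφ h ey

theorem memH1_of_mem {U : Quad L} (hU : U ∈ energySpace L) : MemH1 L U.1 :=
  ⟨Lp.memLp _, ⟨_, hasWeakDeriv_ex hU⟩, ⟨_, hasWeakDeriv_ey hU⟩⟩

theorem integrable_test_mul {φ : ℝ × ℝ → ℝ} (hc : Continuous φ) (hs : HasCompactSupport φ)
    {g : ℝ × ℝ → ℂ} (hg : MemLp g 2 (stripMeasure L)) :
    Integrable (fun z => (φ z : ℂ) * g z) (stripMeasure L) :=
  (memLp_ofReal hc hs).integrable_mul hg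

/-- Weak derivatives are unique. -/
theorem HasWeakDeriv.unique {e : ℝ × ℝ} {u g g' : ℝ × ℝ → ℂ} (h : HasWeakDeriv L e u g)
    (h' : HasWeakDeriv L e u g') : g =ᵐ[stripMeasure L] g' := by
  have h0 := isOpen_openStrip.ae_eq_zero_of_integral_contDiff_smul_eq_zero (U := openStrip L)
    (μ := stripMeasure L) (f := fun z => g z - g' z)
    (((h.1.sub h'.1).locallyIntegrable one_le_two).locallyIntegrableOn _) (fun φ h1 h2 h3 => by
      have a := h.2 φ ⟨h1, h2, h3⟩
      have a' := h'.2 φ ⟨h1, h2, h3⟩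
      have i := integrable_test_mul h1.continuous h2 h.1
      have i' := integrable_test_mul h1.continuous h2 h'.1
      rw [a, neg_inj] at a'
      simp only [Complex.real_smul, mul_sub]
      rw [integral_sub i i', a', sub_self])
  filter_upwards [h0, ae_mem_openStrip] with z h1 h2
  exact sub_eq_zero.1 (h1 h2)

theorem hasWeakDeriv_weakDeriv {e : ℝ × ℝ} {u : ℝ × ℝ → ℂ} (h : ∃ g, HasWeakDeriv L e u g) :
    HasWeakDeriv L e u (weakDeriv L e u) := by
  rw [weakDeriv, dif_pos h]
  exact h.choose_spec

/-- The elements of the energy space are determined by their first component. -/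
theorem eq_of_fst_eq {U V : Quad L} (hU : U ∈ energySpace L) (hV : V ∈ energySpace L)
    (h : U.1 = V.1) : U = V := by
  have h2 : U.2.1 = V.2.1 := Lp.ext ((hasWeakDeriv_ex hU).unique (h ▸ hasWeakDeriv_ex hV))
  have h3 : U.2.2.1 = V.2.2.1 := Lp.ext ((hasWeakDeriv_ey hU).unique (h ▸ hasWeakDeriv_ey hV))
  -- The trace component is determined because the trace inequality for U - V bounds it by the
  -- function and its x-derivative.
  have h4 := trace_sq_le ((energySpace L).sub_mem hU hV) one_pos
  simp only [Prod.fst_sub, Prod.snd_sub, h, h2, sub_self, norm_zero] at h4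
  refine Prod.ext h (Prod.ext h2 (Prod.ext h3 (sub_eq_zero.1 (norm_eq_zero.1 ?_))))
  nlinarith [norm_nonneg (U.2.2.2 - V.2.2.2)]

/-- Multiplication of a weakly differentiable function by a smooth one. -/
theorem HasWeakDeriv.smooth_mul {e : ℝ × ℝ} {u g : ℝ × ℝ → ℂ} (hu : MemLp u 2 (stripMeasure L))
    (h : HasWeakDeriv L e u g) {χ : ℝ × ℝ → ℝ} (hχ : ContDiff ℝ (⊤ : ℕ∞) χ)
    (hs : HasCompactSupport χ) :
    HasWeakDeriv L e (fun z => (χ z : ℂ) * u z)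
      (fun z => (χ z : ℂ) * g z + (fderiv ℝ χ z e : ℂ) * u z) := by
  have hχ1 : ContDiff ℝ 1 χ := hχ.of_le (by exact_mod_cast le_top)
  have bd : ∀ {h : ℝ × ℝ → ℝ} {f : ℝ × ℝ → ℂ}, Continuous h → HasCompactSupport h →
      MemLp f 2 (stripMeasure L) → MemLp (fun z => (h z : ℂ) * f z) 2 (stripMeasure L) := by
    intro h f hc hs hf
    obtain ⟨C, hC⟩ := hs.exists_bound_of_continuous hc
    refine hf.of_le_mul (c := C) ((Complex.continuous_ofReal.comp hc).aestronglyMeasurable.mul hf.1)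
      (Eventually.of_forall fun z => ?_)
    rw [norm_mul, Complex.norm_real]
    gcongr
    exact hC z
  have m2 := bd (continuous_fderiv_dir hχ1 e) (hasCompactSupport_fderiv_dir hs e) hu
  have m1 := bd hχ.continuous hs h.1
  refine ⟨m1.add m2, fun φ hφ => ?_⟩
  have ht : IsTest L (fun z => φ z * χ z) := by
    refine ⟨hφ.1.mul hχ, hasCompactSupport_of_imp hφ.2.1 fun z hz => by simp [hz], ?_⟩
    exact (tsupport_mul_subset_left).trans hφ.2.2
  have key := h.2 _ ht
  have hφd := hφ.contDiff_one.differentiable one_ne_zero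
  have hχd := hχ1.differentiable one_ne_zero
  have e1 : ∀ z, fderiv ℝ (fun z => φ z * χ z) z e =
      fderiv ℝ φ z e * χ z + φ z * fderiv ℝ χ z e := by
    intro z
    rw [fderiv_fun_mul (hφd z) (hχd z)]
    simp only [_root_.add_apply, _root_.smul_apply, smul_eq_mul]
    ring
  have i1 : Integrable (fun z => (fderiv ℝ φ z e : ℂ) * ((χ z : ℂ) * u z)) (stripMeasure L) :=
    integrable_test_mul (continuous_fderiv_dir hφ.contDiff_one e)
      (hasCompactSupport_fderiv_dir hφ.2.1 e) (bd hχ.continuous hs hu)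
  have i2 : Integrable (fun z => (φ z : ℂ) * ((fderiv ℝ χ z e : ℂ) * u z)) (stripMeasure L) :=
    integrable_test_mul hφ.1.continuous hφ.2.1 m2
  have i3 : Integrable (fun z => (φ z : ℂ) * ((χ z : ℂ) * g z)) (stripMeasure L) :=
    integrable_test_mul hφ.1.continuous hφ.2.1 m1
  have e2 : ∫ z, (fderiv ℝ (fun z => φ z * χ z) z e : ℂ) * u z ∂(stripMeasure L)
      = (∫ z, (fderiv ℝ φ z e : ℂ) * ((χ z : ℂ) * u z) ∂(stripMeasure L))
        + ∫ z, (φ z : ℂ) * ((fderiv ℝ χ z e : ℂ) * u z) ∂(stripMeasure L) := by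
    rw [← integral_add i1 i2]
    refine integral_congr_ae (Eventually.of_forall fun z => ?_)
    simp only [e1]
    push_cast
    ring
  have e3 : ∫ z, ((φ z * χ z : ℝ) : ℂ) * g z ∂(stripMeasure L)
      = ∫ z, (φ z : ℂ) * ((χ z : ℂ) * g z) ∂(stripMeasure L) := by
    refine integral_congr_ae (Eventually.of_forall fun z => ?_)
    push_cast
    ring
  rw [e2, e3] at key
  have e4 : ∫ z, (φ z : ℂ) * ((χ z : ℂ) * g z + (fderiv ℝ χ z e : ℂ) * u z) ∂(stripMeasure L)
      = (∫ z, (φ z : ℂ) * ((χ z : ℂ) * g z) ∂(stripMeasure L))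
        + ∫ z, (φ z : ℂ) * ((fderiv ℝ χ z e : ℂ) * u z) ∂(stripMeasure L) := by
    rw [← integral_add i3 i2]
    refine integral_congr_ae (Eventually.of_forall fun z => ?_)
    simp only [mul_add]
  rw [e4, neg_add, ← key]
  ring

end WeakDerivative

end DeltaStrip

/-! ### Mollification after contraction. -/

namespace DeltaStrip

variable {L : ℝ}

section Mollifier

/-- Convolution of the extension by zero of a function on the strip. -/
noncomputable def moll (L : ℝ) (η : ℝ × ℝ → ℝ) (f : ℝ × ℝ → ℂ) (x : ℝ × ℝ) : ℂ :=
  ∫ w, η (x - w) • f w ∂(stripMeasure L)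

theorem measurableSet_strip' : MeasurableSet (strip L) := MeasurableSet.univ.prod measurableSet_Icc

theorem moll_eq_convolution (η : ℝ × ℝ → ℝ) (f : ℝ × ℝ → ℂ) :
    moll L η f = convolution η ((strip L).indicator f) (ContinuousLinearMap.lsmul ℝ ℝ) volume := by
  funext x
  rw [convolution_eq_swap, moll, stripMeasure, ← integral_indicator measurableSet_strip']
  refine integral_congr_ae (Eventually.of_forall fun w => ?_)
  by_cases hw : w ∈ strip L <;> simp [hw]

theorem locallyIntegrable_indicator {f : ℝ × ℝ → ℂ} (hf : MemLp f 2 (stripMeasure L)) :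
    LocallyIntegrable ((strip L).indicator f) volume :=
  ((memLp_indicator_iff_restrict measurableSet_strip').2 hf).locallyIntegrable one_le_two

theorem contDiff_moll {η : ℝ × ℝ → ℝ} (hη : ContDiff ℝ (⊤ : ℕ∞) η) (hs : HasCompactSupport η)
    {f : ℝ × ℝ → ℂ} (hf : MemLp f 2 (stripMeasure L)) : ContDiff ℝ (⊤ : ℕ∞) (moll L η f) := by
  rw [moll_eq_convolution]
  exact hs.contDiff_convolution_left _ hη (locallyIntegrable_indicator hf)

theorem hasCompactSupport_moll {η : ℝ × ℝ → ℝ} (hs : HasCompactSupport η) {f : ℝ × ℝ → ℂ}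
    (hf : HasCompactSupport f) : HasCompactSupport (moll L η f) := by
  rw [moll_eq_convolution]
  exact hs.convolution _ (hasCompactSupport_of_imp hf fun z hz => by
    by_cases h : z ∈ strip L <;> simp [h, hz])

theorem fderiv_moll {η : ℝ × ℝ → ℝ} (hη : ContDiff ℝ (⊤ : ℕ∞) η) (hs : HasCompactSupport η)
    {f : ℝ × ℝ → ℂ} (hf : MemLp f 2 (stripMeasure L)) (x e : ℝ × ℝ) :
    fderiv ℝ (moll L η f) x e = moll L (fun z => fderiv ℝ η z e) f x := by
  have hη1 : ContDiff ℝ 1 η := hη.of_le (by exact_mod_cast le_top)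
  have hl := locallyIntegrable_indicator hf
  have h := hs.hasFDerivAt_convolution_left (ContinuousLinearMap.lsmul ℝ ℝ) hη1 hl x
  rw [moll_eq_convolution, moll_eq_convolution, h.fderiv]
  have hex : ConvolutionExistsAt (fderiv ℝ η) ((strip L).indicator f) x
      ((ContinuousLinearMap.lsmul ℝ ℝ : ℝ →L[ℝ] ℂ →L[ℝ] ℂ).precompL (ℝ × ℝ)) volume :=
    (hs.fderiv ℝ).convolutionExists_left _ (hη1.continuous_fderiv one_ne_zero) hl x
  exact ContinuousLinearMap.integral_apply hex e

/-- Jensen's inequality, through Cauchy–Schwarz with η = √η · √η. Restricted to the strip, the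
kernel has mass at most 1. -/
theorem norm_moll_sq_le {η : ℝ × ℝ → ℝ} (hc : Continuous η) (hs : HasCompactSupport η)
    (h0 : ∀ z, 0 ≤ η z) (h1 : ∫ z, η z = 1) {f : ℝ × ℝ → ℂ} (hf : MemLp f 2 (stripMeasure L))
    (x : ℝ × ℝ) : ‖moll L η f x‖ ^ 2 ≤ ∫ w, η (x - w) * ‖f w‖ ^ 2 ∂(stripMeasure L) := by
  have hc' : Continuous fun w => η (x - w) := hc.comp (by fun_prop)
  have hs' : HasCompactSupport fun w => η (x - w) :=
    hs.comp_homeomorph (Homeomorph.subLeft x)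
  obtain ⟨C, hC⟩ := hs.exists_bound_of_continuous hc
  have i2 : Integrable (fun w => η (x - w) * ‖f w‖ ^ 2) (stripMeasure L) := by
    refine ((memLp_two_iff_integrable_sq_norm hf.1).1 hf).bdd_mul (c := C)
      hc'.aestronglyMeasurable (Eventually.of_forall fun w => hC _)
  have i1 : Integrable (fun w => η (x - w)) (stripMeasure L) := integrable_strip hc' hs'
  have i3 : Integrable (fun w => η (x - w) * ‖f w‖) (stripMeasure L) := by
    have := (memLp_ofReal (L := L) hc' hs').norm.integrable_mul hf.norm
    refine this.congr (Eventually.of_forall fun w => ?_)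
    simp [abs_of_nonneg (h0 _)]
  have hsq : ∀ w, √(η (x - w)) ^ 2 = η (x - w) := fun w => Real.sq_sqrt (h0 _)
  have key := integral_mul_sq_le (μ := stripMeasure L) (f := fun w => √(η (x - w)))
    (g := fun w => √(η (x - w)) * ‖f w‖) (by simpa only [hsq] using i1)
    (by simpa only [mul_pow, hsq] using i2)
    (by simpa only [← mul_assoc, ← sq, hsq] using i3)
  simp only [mul_pow, ← mul_assoc, ← sq, hsq] at key
  have hle : ∫ w, η (x - w) ∂(stripMeasure L) ≤ 1 := by
    have hi : Integrable (fun w => η (x - w)) := hc'.integrable_of_hasCompactSupport hs'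
    have e : ∫ w, η (x - w) = 1 := by rw [integral_sub_left_eq_self η volume x, h1]
    rw [← e]
    exact setIntegral_le_integral hi (Eventually.of_forall fun w => h0 _)
  have hn : ‖moll L η f x‖ ≤ ∫ w, η (x - w) * ‖f w‖ ∂(stripMeasure L) := by
    refine (norm_integral_le_integral_norm _).trans (le_of_eq ?_)
    refine integral_congr_ae (Eventually.of_forall fun w => ?_)
    simp [abs_of_nonneg (h0 _)]
  have h2 : 0 ≤ ∫ w, η (x - w) * ‖f w‖ ^ 2 ∂(stripMeasure L) :=
    integral_nonneg fun w => mul_nonneg (h0 _) (sq_nonneg _)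
  calc ‖moll L η f x‖ ^ 2 ≤ (∫ w, η (x - w) * ‖f w‖ ∂(stripMeasure L)) ^ 2 :=
        pow_le_pow_left₀ (norm_nonneg _) hn 2
    _ ≤ _ := key
    _ ≤ _ := mul_le_of_le_one_left h2 hle

/-- Contraction towards the centre of the strip. -/
noncomputable def shrink (L lam : ℝ) (z : ℝ × ℝ) : ℝ × ℝ := lam • z + (1 - lam) • ((0 : ℝ), L / 2)

theorem contDiff_shrink (lam : ℝ) : ContDiff ℝ (⊤ : ℕ∞) (shrink L lam) := by
  unfold shrink; fun_prop

theorem hasFDerivAt_shrink (lam : ℝ) (z : ℝ × ℝ) :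
    HasFDerivAt (shrink L lam) (lam • ContinuousLinearMap.id ℝ (ℝ × ℝ)) z :=
  ((hasFDerivAt_id z).const_smul lam).add_const _

theorem lintegral_shrink {η : ℝ × ℝ → ℝ} (hc : Continuous η) (hs : HasCompactSupport η)
    (h0 : ∀ z, 0 ≤ η z) (h1 : ∫ z, η z = 1) {lam : ℝ} (hl : 0 < lam) (w : ℝ × ℝ) :
    ∫⁻ z, ENNReal.ofReal (η (shrink L lam z - w)) = ENNReal.ofReal ((lam ^ 2)⁻¹) := by
  set b := (1 - lam) • ((0 : ℝ), L / 2) - w with hb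
  have e : ∀ z, shrink L lam z - w = lam • z + b := fun z => by rw [shrink, hb, add_sub_assoc]
  simp only [e]
  have hs' : HasCompactSupport fun z : ℝ × ℝ => η (z + b) :=
    hs.comp_homeomorph (Homeomorph.addRight b)
  have hi : Integrable (fun z : ℝ × ℝ => η (z + b)) :=
    (hc.comp (by fun_prop : Continuous fun z : ℝ × ℝ => z + b)).integrable_of_hasCompactSupport hs'
  rw [← ofReal_integral_eq_lintegral_ofReal (hi.comp_smul hl.ne')
    (Eventually.of_forall fun z => h0 _), Measure.integral_comp_smul volume (fun z => η (z + b)) lam,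
    integral_add_right_eq_self η b, h1]
  simp [abs_of_pos hl]

/-- The pointwise bound is integrated and the integrals exchanged; for fixed w the contracted kernel
has integral λ⁻² in z over the plane. -/
theorem lintegral_moll_sq_le {η : ℝ × ℝ → ℝ} (hη : ContDiff ℝ (⊤ : ℕ∞) η) (hs : HasCompactSupport η)
    (h0 : ∀ z, 0 ≤ η z) (h1 : ∫ z, η z = 1) {f : ℝ × ℝ → ℂ} (hf : MemLp f 2 (stripMeasure L))
    {lam : ℝ} (hl : 0 < lam) :
    ∫⁻ z, ENNReal.ofReal (‖moll L η f (shrink L lam z)‖ ^ 2) ∂(stripMeasure L) ≤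
      ENNReal.ofReal ((lam ^ 2)⁻¹) * ∫⁻ w, ENNReal.ofReal (‖f w‖ ^ 2) ∂(stripMeasure L) := by
  have hc := hη.continuous
  have hS : Continuous (shrink L lam) := (contDiff_shrink lam).continuous
  obtain ⟨C, hC⟩ := hs.exists_bound_of_continuous hc
  have hle : ∀ z, ENNReal.ofReal (‖moll L η f (shrink L lam z)‖ ^ 2) ≤
      ∫⁻ w, ENNReal.ofReal (η (shrink L lam z - w)) * ENNReal.ofReal (‖f w‖ ^ 2)
        ∂(stripMeasure L) := by
    intro z
    have hc' : Continuous fun w => η (shrink L lam z - w) := hc.comp (by fun_prop)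
    have i2 : Integrable (fun w => η (shrink L lam z - w) * ‖f w‖ ^ 2) (stripMeasure L) := by
      refine ((memLp_two_iff_integrable_sq_norm hf.1).1 hf).bdd_mul (c := C)
        hc'.aestronglyMeasurable (Eventually.of_forall fun w => hC _)
    refine (ENNReal.ofReal_le_ofReal (norm_moll_sq_le hc hs h0 h1 hf _)).trans (le_of_eq ?_)
    rw [ofReal_integral_eq_lintegral_ofReal i2
      (Eventually.of_forall fun w => mul_nonneg (h0 _) (sq_nonneg _))]
    simp only [ENNReal.ofReal_mul (h0 _)]
  refine (lintegral_mono hle).trans ?_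
  rw [lintegral_lintegral_swap]
  · rw [← lintegral_const_mul' _ _ ENNReal.ofReal_ne_top]
    refine lintegral_mono fun w => ?_
    dsimp only
    rw [lintegral_mul_const]
    · gcongr
      rw [← lintegral_shrink (L := L) hc hs h0 h1 hl w]
      exact setLIntegral_le_lintegral _ _
    · exact ENNReal.measurable_ofReal.comp (hc.comp (by fun_prop)).measurable
  · change AEMeasurable (fun p : (ℝ × ℝ) × (ℝ × ℝ) =>
      ENNReal.ofReal (η (shrink L lam p.1 - p.2)) * ENNReal.ofReal (‖f p.2‖ ^ 2)) _
    have m1 : Measurable fun p : (ℝ × ℝ) × (ℝ × ℝ) =>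
        ENNReal.ofReal (η (shrink L lam p.1 - p.2)) :=
      ENNReal.measurable_ofReal.comp
        (hc.comp ((hS.comp continuous_fst).sub continuous_snd)).measurable
    have m2 : AEMeasurable (fun w => ENNReal.ofReal (‖f w‖ ^ 2)) (stripMeasure L) :=
      ENNReal.measurable_ofReal.comp_aemeasurable (hf.1.norm.aemeasurable.pow_const 2)
    exact m1.aemeasurable.mul m2.comp_snd

theorem eLpNorm_two_eq {α : Type*} [MeasurableSpace α] {μ : Measure α} (f : α → ℂ) :
    eLpNorm f 2 μ = (∫⁻ z, ENNReal.ofReal (‖f z‖ ^ 2) ∂μ) ^ (1 / 2 : ℝ) := by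
  rw [eLpNorm_eq_lintegral_rpow_enorm_toReal (by norm_num) (by norm_num)]
  norm_num

theorem eLpNorm_moll_le {η : ℝ × ℝ → ℝ} (hη : ContDiff ℝ (⊤ : ℕ∞) η) (hs : HasCompactSupport η)
    (h0 : ∀ z, 0 ≤ η z) (h1 : ∫ z, η z = 1) {f : ℝ × ℝ → ℂ} (hf : MemLp f 2 (stripMeasure L))
    {lam : ℝ} (hl : 1 / 2 ≤ lam) :
    eLpNorm (fun z => moll L η f (shrink L lam z)) 2 (stripMeasure L) ≤
      2 * eLpNorm f 2 (stripMeasure L) := by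
  rw [eLpNorm_two_eq, eLpNorm_two_eq]
  have h4 : ENNReal.ofReal ((lam ^ 2)⁻¹) ≤ 2 ^ 2 := by
    have : (lam ^ 2)⁻¹ ≤ 4 := by
      rw [inv_le_comm₀ (by positivity) (by norm_num)]
      nlinarith
    refine (ENNReal.ofReal_le_ofReal this).trans ?_
    norm_num
  calc _ ≤ (2 ^ 2 * ∫⁻ w, ENNReal.ofReal (‖f w‖ ^ 2) ∂(stripMeasure L)) ^ (1 / 2 : ℝ) := by
        refine ENNReal.rpow_le_rpow ?_ (by norm_num)
        refine (lintegral_moll_sq_le hη hs h0 h1 hf (by linarith)).trans ?_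
        gcongr
    _ = _ := by
        rw [ENNReal.mul_rpow_of_nonneg _ _ (by norm_num)]
        congr 1
        rw [← ENNReal.rpow_natCast, ← ENNReal.rpow_mul]
        norm_num

end Mollifier

end DeltaStrip

/-! ### Density of smooth functions. -/

namespace DeltaStrip

variable {L : ℝ}

section Density

theorem shrink_sub (lam : ℝ) (z : ℝ × ℝ) :
    shrink L lam z - z = (1 - lam) • (((0 : ℝ), L / 2) - z) := by
  rw [shrink, smul_sub, sub_smul, sub_smul, one_smul, one_smul]
  abel

/-- The contraction brings the strip to distance at least (1 - λ) L/2 from its sides, leaving room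
for a kernel of smaller radius. This permits mollification without any boundary condition. -/
theorem closedBall_shrink_subset {lam ε : ℝ} (hl0 : 0 ≤ lam)
    (hε : ε < (1 - lam) * (L / 2)) {z : ℝ × ℝ} (hz : z ∈ strip L) :
    Metric.closedBall (shrink L lam z) ε ⊆ openStrip L := by
  intro w hw
  rw [Metric.mem_closedBall, Prod.dist_eq, max_le_iff, Real.dist_eq, Real.dist_eq] at hw
  have h2 := abs_le.1 hw.2
  have e : (shrink L lam z).2 = lam * z.2 + (1 - lam) * (L / 2) := by simp [shrink]
  obtain ⟨h3, h4⟩ := hz.2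
  rw [e] at h2
  have h5 : lam * z.2 ≤ lam * L := by gcongr
  have h6 : 0 ≤ lam * z.2 := by positivity
  refine ⟨trivial, ?_, ?_⟩ <;> nlinarith

/-- Smooth approximation of a function on the strip: contraction and mollification. -/
noncomputable def smoothing (L : ℝ) (η : ℝ × ℝ → ℝ) (lam : ℝ) (f : ℝ × ℝ → ℂ) : ℝ × ℝ → ℂ :=
  fun z => moll L η f (shrink L lam z)

theorem contDiff_smoothing {η : ℝ × ℝ → ℝ} (hη : ContDiff ℝ (⊤ : ℕ∞) η) (hs : HasCompactSupport η)
    {f : ℝ × ℝ → ℂ} (hf : MemLp f 2 (stripMeasure L)) (lam : ℝ) :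
    ContDiff ℝ (⊤ : ℕ∞) (smoothing L η lam f) :=
  (contDiff_moll hη hs hf).comp (contDiff_shrink lam)

theorem hasCompactSupport_smoothing {η : ℝ × ℝ → ℝ} (hs : HasCompactSupport η) {f : ℝ × ℝ → ℂ}
    (hf : HasCompactSupport f) {lam : ℝ} (hl : lam ≠ 0) :
    HasCompactSupport (smoothing L η lam f) :=
  (hasCompactSupport_moll hs hf).comp_homeomorph
    ((Homeomorph.smulOfNeZero lam hl).trans (Homeomorph.addRight ((1 - lam) • ((0 : ℝ), L / 2))))

/-- For x in the contracted strip, w ↦ η(x - w) is a test function, so the derivative can be moved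
onto f, up to the boundary of the strip. The factor λ is the chain rule for the contraction. -/
theorem fderiv_smoothing {η : ℝ × ℝ → ℝ} (hη : ContDiff ℝ (⊤ : ℕ∞) η) {ε lam : ℝ}
    (hs : tsupport η ⊆ Metric.closedBall 0 ε) (hl : 0 ≤ lam) (hε : ε < (1 - lam) * (L / 2))
    {e : ℝ × ℝ} {f g : ℝ × ℝ → ℂ} (hf : MemLp f 2 (stripMeasure L)) (h : HasWeakDeriv L e f g)
    {z : ℝ × ℝ} (hz : z ∈ strip L) :
    fderiv ℝ (smoothing L η lam f) z e = lam • smoothing L η lam g z := by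
  have hcs : HasCompactSupport η :=
    (isCompact_closedBall (0 : ℝ × ℝ) ε).of_isClosed_subset (isClosed_tsupport _) hs
  have hη1 : ContDiff ℝ 1 η := hη.of_le (by exact_mod_cast le_top)
  have hd := (contDiff_moll hη hcs hf).differentiable (by simp) (shrink L lam z)
  have h1 : HasFDerivAt (smoothing L η lam f) _ z := hd.hasFDerivAt.comp z (hasFDerivAt_shrink lam z)
  rw [h1.fderiv]
  simp only [ContinuousLinearMap.comp_apply, _root_.smul_apply, ContinuousLinearMap.id_apply]
  rw [map_smul, fderiv_moll hη hcs hf]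
  congr 1
  set x := shrink L lam z with hx
  have hφ : ∀ w, HasFDerivAt (fun w => η (x - w)) (-(fderiv ℝ η (x - w))) w := fun w => by
    have := ((hη1.differentiable one_ne_zero (x - w)).hasFDerivAt).comp w
      ((hasFDerivAt_id w).const_sub x)
    refine this.congr_fderiv ?_
    ext <;> simp
  have ht : IsTest L fun w => η (x - w) := by
    have hcs' : HasCompactSupport fun w => η (x - w) := hcs.comp_homeomorph (Homeomorph.subLeft x)
    refine ⟨hη.comp (by fun_prop), hcs', ?_⟩
    refine Set.Subset.trans ?_ (closedBall_shrink_subset hl hε hz)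
    refine closure_minimal (fun w hw => ?_) Metric.isClosed_closedBall
    have := hs (subset_tsupport _ hw)
    rwa [mem_closedBall_zero_iff, ← dist_eq_norm, dist_comm] at this
  have key := h.2 _ ht
  simp only [(hφ _).fderiv, _root_.neg_apply, Complex.ofReal_neg, neg_mul, integral_neg,
    neg_inj] at key
  simp only [moll, smoothing, Complex.real_smul]
  exact key

theorem dist_smoothing_le {η : ℝ × ℝ → ℝ} {ε lam : ℝ}
    (hs : Function.support η ⊆ Metric.ball 0 ε) (h0 : ∀ z, 0 ≤ η z) (h1 : ∫ z, η z = 1)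
    (hl : 0 ≤ lam) (hε : ε < (1 - lam) * (L / 2)) {f : ℝ × ℝ → ℂ} (hf : Continuous f)
    {z : ℝ × ℝ} (hz : z ∈ strip L) {δ : ℝ} (hδ : 0 ≤ δ)
    (h : ∀ w, dist w z < ε + ‖shrink L lam z - z‖ → dist (f w) (f z) ≤ δ) :
    dist (smoothing L η lam f z) (f z) ≤ δ := by
  rw [smoothing, moll_eq_convolution]
  refine dist_convolution_le hδ hs h0 h1
    (hf.aestronglyMeasurable.indicator measurableSet_strip') fun w hw => ?_
  have hw' : w ∈ strip L :=
    openStrip_subset (closedBall_shrink_subset hl hε hz (Metric.ball_subset_closedBall hw))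
  rw [Set.indicator_of_mem hw']
  refine h w ?_
  rw [Metric.mem_ball] at hw
  calc dist w z ≤ dist w (shrink L lam z) + dist (shrink L lam z) z := dist_triangle _ _ _
    _ < _ := by rw [dist_eq_norm (shrink L lam z)]; linarith

/-- A sequence of mollifiers. -/
noncomputable def bump (L : ℝ) (hL : 0 < L) (n : ℕ) : ContDiffBump (0 : ℝ × ℝ) where
  rIn := L / (8 * (n + 2))
  rOut := L / (4 * (n + 2))
  rIn_pos := by positivity
  rIn_lt_rOut := by
    rw [div_lt_div_iff₀ (by positivity) (by positivity)]
    nlinarith [Nat.cast_nonneg (α := ℝ) n]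

/-- The contraction factors. -/
noncomputable def factor (n : ℕ) : ℝ := 1 - 1 / (n + 2)

theorem half_le_factor (n : ℕ) : 1 / 2 ≤ factor n := by
  have : 1 / ((n : ℝ) + 2) ≤ 1 / 2 := by
    gcongr
    linarith [Nat.cast_nonneg (α := ℝ) n]
  rw [factor]; linarith

theorem tendsto_one_div_add_two : Tendsto (fun n : ℕ => 1 / ((n : ℝ) + 2)) atTop (𝓝 0) :=
  tendsto_const_nhds.div_atTop (tendsto_atTop_add_const_right _ _ tendsto_natCast_atTop_atTop)

theorem tendsto_factor : Tendsto factor atTop (𝓝 1) := by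
  have := tendsto_one_div_add_two.const_sub 1
  rwa [sub_zero] at this

theorem bump_rOut_lt (hL : 0 < L) (n : ℕ) : (bump L hL n).rOut < (1 - factor n) * (L / 2) := by
  have : (1 - factor n) * (L / 2) = L / (2 * (n + 2)) := by rw [factor]; field_simp; ring
  rw [this]
  change L / (4 * (n + 2)) < _
  rw [div_lt_div_iff₀ (by positivity) (by positivity)]
  nlinarith [Nat.cast_nonneg (α := ℝ) n]

/-- The sequence of smoothing operators. -/
noncomputable def smoothSeq (hL : 0 < L) (n : ℕ) (f : ℝ × ℝ → ℂ) : ℝ × ℝ → ℂ :=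
  smoothing L ((bump L hL n).normed volume) (factor n) f

theorem eLpNorm_smoothSeq_le (hL : 0 < L) (n : ℕ) {f : ℝ × ℝ → ℂ} (hf : MemLp f 2 (stripMeasure L)) :
    eLpNorm (smoothSeq hL n f) 2 (stripMeasure L) ≤ 2 * eLpNorm f 2 (stripMeasure L) :=
  eLpNorm_moll_le (ContDiffBump.contDiff_normed _) (ContDiffBump.hasCompactSupport_normed _)
    (ContDiffBump.nonneg_normed _) (ContDiffBump.integral_normed _) hf (half_le_factor n)

theorem norm_shrink_sub_le {n : ℕ} {R : ℝ} {z : ℝ × ℝ} (hz : ‖z - ((0 : ℝ), L / 2)‖ ≤ R) :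
    ‖shrink L (factor n) z - z‖ ≤ 1 / (n + 2) * R := by
  have h0 : (0 : ℝ) < 1 / (n + 2) := by positivity
  rw [shrink_sub, norm_smul, factor, sub_sub_cancel, Real.norm_of_nonneg h0.le, norm_sub_rev]
  gcongr

/-- On a large ball K uniform continuity applies, since points are displaced by O(1/n). Outside K
displacements are proportional to the distance from the centre, but f vanishes at all points
involved. -/
theorem tendsto_smoothSeq_of_continuous (hL : 0 < L) {f : ℝ × ℝ → ℂ} (hf : Continuous f)
    (hs : HasCompactSupport f) :
    Tendsto (fun n => eLpNorm (smoothSeq hL n f - f) 2 (stripMeasure L)) atTop (𝓝 0) := by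
  set c : ℝ × ℝ := ((0 : ℝ), L / 2) with hc
  obtain ⟨R, hR0, hR⟩ : ∃ R > 0, tsupport f ⊆ Metric.closedBall c R := by
    obtain ⟨R, hR⟩ := hs.isBounded.subset_closedBall c
    exact ⟨max R 1, by positivity, hR.trans (Metric.closedBall_subset_closedBall (le_max_left _ _))⟩
  have hfz : ∀ z, R < ‖z - c‖ → f z = 0 := fun z hz => image_eq_zero_of_notMem_tsupport fun h => by
    have := hR h
    rw [Metric.mem_closedBall, dist_eq_norm] at this
    linarith
  -- A point beyond distance 2R + L from c is displaced by at most half this distance plus L/2, so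
  -- it remains beyond distance R, outside the support of f.
  set K := Metric.closedBall c (2 * R + L) with hK
  have hKm : stripMeasure L K < ⊤ := (isCompact_closedBall _ _).measure_lt_top
  have huc : UniformContinuous f := hs.uniformContinuous_of_continuous hf
  have key : ∀ δ > 0, ∀ᶠ n : ℕ in atTop, ∀ z ∈ strip L,
      ‖smoothSeq hL n f z - f z‖ ≤ K.indicator (fun _ => δ) z := by
    intro δ hδ
    obtain ⟨ρ, hρ, hρ'⟩ := Metric.uniformContinuous_iff.1 huc δ hδ
    have hlim : Tendsto (fun n : ℕ => 1 / ((n : ℝ) + 2) * (L + (2 * R + L))) atTop (𝓝 0) := by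
      simpa using tendsto_one_div_add_two.mul_const (L + (2 * R + L))
    filter_upwards [hlim.eventually_lt_const hρ] with n hn z hz
    have hn0 : (0 : ℝ) < 1 / (n + 2) := by positivity
    have hn1 : 1 / ((n : ℝ) + 2) ≤ 1 / 2 := by
      gcongr; linarith [Nat.cast_nonneg (α := ℝ) n]
    have hout : (bump L hL n).rOut ≤ 1 / (n + 2) * L := by
      change L / (4 * (n + 2)) ≤ _
      rw [one_div_mul_eq_div]
      gcongr
      linarith [Nat.cast_nonneg (α := ℝ) n]
    rw [← dist_eq_norm]
    have gen : ∀ δ' : ℝ, 0 ≤ δ' → (∀ w, dist w z < (bump L hL n).rOut +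
        ‖shrink L (factor n) z - z‖ → dist (f w) (f z) ≤ δ') → dist (smoothSeq hL n f z) (f z) ≤ δ' :=
      fun δ' hδ' h => dist_smoothing_le (ContDiffBump.support_normed_eq _).subset
        (ContDiffBump.nonneg_normed _) (ContDiffBump.integral_normed _)
        (by linarith [half_le_factor n]) (bump_rOut_lt hL n) hf hz hδ' h
    by_cases hzK : z ∈ K
    · rw [Set.indicator_of_mem hzK]
      rw [hK, Metric.mem_closedBall, dist_eq_norm] at hzK
      refine gen δ hδ.le fun w hw => (hρ' (hw.trans_le ?_)).le
      have := norm_shrink_sub_le (n := n) hzK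
      calc _ ≤ 1 / ((n : ℝ) + 2) * L + 1 / (n + 2) * (2 * R + L) := add_le_add hout this
        _ ≤ ρ := by rw [← mul_add]; exact hn.le
    · rw [Set.indicator_of_notMem hzK]
      rw [hK, Metric.mem_closedBall, dist_eq_norm, not_le] at hzK
      refine gen 0 le_rfl fun w hw => ?_
      have h1 := norm_shrink_sub_le (n := n) (le_refl ‖z - c‖)
      have h2 : 1 / ((n : ℝ) + 2) * ‖z - c‖ ≤ 1 / 2 * ‖z - c‖ := by gcongr
      have h3 : 1 / ((n : ℝ) + 2) * L ≤ 1 / 2 * L := by gcongr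
      have h4 : ‖z - c‖ ≤ dist w z + ‖w - c‖ := by
        rw [← dist_eq_norm, ← dist_eq_norm, dist_comm w z]; exact dist_triangle _ _ _
      rw [hfz w (by linarith), hfz z (by linarith), dist_self]
  rw [ENNReal.tendsto_nhds_zero]
  intro ε hε
  have hlim : Tendsto (fun δ : ℝ => ENNReal.ofReal δ * (stripMeasure L K) ^ (1 / (2 : ENNReal).toReal))
      (𝓝 0) (𝓝 0) := by
    have := ENNReal.Tendsto.mul_const (b := (stripMeasure L K) ^ (1 / (2 : ENNReal).toReal))
      (ENNReal.tendsto_ofReal (tendsto_id (x := 𝓝 (0 : ℝ))))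
      (Or.inr (ENNReal.rpow_ne_top_of_nonneg (by positivity) hKm.ne))
    simpa using this
  obtain ⟨δ, h1, h2⟩ : ∃ δ : ℝ, ENNReal.ofReal δ *
      (stripMeasure L K) ^ (1 / (2 : ENNReal).toReal) < ε ∧ 0 < δ := by
    have h1 := (hlim.mono_left (nhdsWithin_le_nhds (s := Set.Ioi 0))).eventually_lt_const hε
    have h2 : ∀ᶠ δ : ℝ in 𝓝[>] 0, 0 < δ := eventually_mem_nhdsWithin
    exact (h1.and h2).exists
  filter_upwards [key δ h2] with n hn
  refine le_trans ?_ h1.le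
  calc eLpNorm (smoothSeq hL n f - f) 2 (stripMeasure L)
      ≤ eLpNorm (K.indicator fun _ => δ) 2 (stripMeasure L) := by
        refine eLpNorm_mono_ae ?_
        filter_upwards [ae_restrict_mem measurableSet_strip'] with z hz
        exact (hn z hz).trans (le_abs_self _)
    _ = _ := by
        rw [eLpNorm_indicator_const Metric.isClosed_closedBall.measurableSet (by norm_num)
          (by norm_num), Real.enorm_of_nonneg h2.le]

/-- Density of continuous compactly supported functions in L² and the uniform bound 2 on the
smoothing operators. -/
theorem tendsto_smoothSeq (hL : 0 < L) {f : ℝ × ℝ → ℂ} (hf : MemLp f 2 (stripMeasure L)) :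
    Tendsto (fun n => eLpNorm (smoothSeq hL n f - f) 2 (stripMeasure L)) atTop (𝓝 0) := by
  have hreg : (stripMeasure L).Regular := by unfold stripMeasure; infer_instance
  have hcts : ∀ n {g : ℝ × ℝ → ℂ}, MemLp g 2 (stripMeasure L) → Continuous (smoothSeq hL n g) :=
    fun n g hg => (contDiff_smoothing (ContDiffBump.contDiff_normed _)
      (ContDiffBump.hasCompactSupport_normed _) hg _).continuous
  rw [ENNReal.tendsto_nhds_zero]
  intro ε hε
  obtain ⟨g, hg1, hg2, hg3, hg4⟩ := hf.exists_hasCompactSupport_eLpNorm_sub_le (by norm_num)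
    (ε := ε / 4) (ENNReal.div_pos hε.ne' (by norm_num)).ne'
  filter_upwards [(ENNReal.tendsto_nhds_zero.1 (tendsto_smoothSeq_of_continuous hL hg3 hg1)) (ε / 4)
    (ENNReal.div_pos hε.ne' (by norm_num))] with n hn
  have hsub : smoothSeq hL n f - smoothSeq hL n g = smoothSeq hL n (f - g) := by
    funext z
    have hc : Continuous fun w => (bump L hL n).normed volume (shrink L (factor n) z - w) :=
      (ContDiffBump.continuous_normed _).comp (by fun_prop)
    have hs : HasCompactSupport fun w => (bump L hL n).normed volume (shrink L (factor n) z - w) :=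
      (ContDiffBump.hasCompactSupport_normed _).comp_homeomorph (Homeomorph.subLeft _)
    have i1 := integrable_test_mul hc hs hf
    have i2 := integrable_test_mul hc hs hg4
    simp only [← Complex.real_smul] at i1 i2
    rw [Pi.sub_apply, smoothSeq, smoothSeq, smoothSeq, smoothing, smoothing, smoothing, moll, moll,
      moll, ← integral_sub i1 i2]
    refine integral_congr_ae (Eventually.of_forall fun w => ?_)
    simp only [Pi.sub_apply, smul_sub]
  have e : smoothSeq hL n f - f = smoothSeq hL n (f - g) + ((smoothSeq hL n g - g) - (f - g)) := by
    rw [← hsub]; abel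
  have m1 := (hcts n (hf.sub hg4)).aestronglyMeasurable (μ := stripMeasure L)
  have m2 := ((hcts n hg4).sub hg3).aestronglyMeasurable (μ := stripMeasure L)
  calc eLpNorm (smoothSeq hL n f - f) 2 (stripMeasure L)
      ≤ 2 * (ε / 4) + (ε / 4 + ε / 4) := by
        rw [e]
        refine (eLpNorm_add_le m1 (m2.sub (hf.1.sub hg4.1)) one_le_two).trans ?_
        refine add_le_add ?_ ((eLpNorm_sub_le m2 (hf.1.sub hg4.1) one_le_two).trans
          (add_le_add hn hg2))
        exact (eLpNorm_smoothSeq_le hL n (hf.sub hg4)).trans (by gcongr)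
    _ = ε := by
        rw [← two_mul, ← mul_add, ← two_mul, ← mul_assoc]
        norm_num
        exact ENNReal.mul_div_cancel (by norm_num) (by norm_num)

end Density

end DeltaStrip

/-! ### Identification of H¹ with the energy space. -/

namespace DeltaStrip

variable {L : ℝ}

section Identification

/-- No convergence of traces is assumed: the trace inequality bounds them, so a weak limit exists in
the energy space and its first three components are the prescribed ones. -/
theorem mem_energySpace_of_tendsto {V : ℕ → Quad L} (hV : ∀ n, V n ∈ energySpace L)
    {a b c : Lp ℂ 2 (stripMeasure L)} (h1 : Tendsto (fun n => (V n).1) atTop (𝓝 a))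
    (h2 : Tendsto (fun n => (V n).2.1) atTop (𝓝 b))
    (h3 : Tendsto (fun n => (V n).2.2.1) atTop (𝓝 c)) :
    ∃ U ∈ energySpace L, U.1 = a ∧ U.2.1 = b ∧ U.2.2.1 = c := by
  have hbd : ∃ M, ∀ n, hSq (V n) ≤ M := by
    have := (((h1.norm.pow 2).add (h2.norm.pow 2)).add (h3.norm.pow 2)).bddAbove_range
    obtain ⟨M, hM⟩ := this
    exact ⟨M, fun n => hM ⟨n, rfl⟩⟩
  obtain ⟨M, hM⟩ := hbd
  set l : Ultrafilter ℕ := hyperfilter ℕ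
  have hl : (l : Filter ℕ) ≤ atTop := Nat.hyperfilter_le_atTop
  obtain ⟨U, hU, hw⟩ := exists_weakTendsto_energySpace l hV hM
  have w1 := hw.map (ContinuousLinearMap.fst ℝ _ _)
  have w' := hw.map (ContinuousLinearMap.snd ℝ _ _)
  have w2 := w'.map (ContinuousLinearMap.fst ℝ _ _)
  have w3 := (w'.map (ContinuousLinearMap.snd ℝ _ _)).map (ContinuousLinearMap.fst ℝ _ _)
  exact ⟨U, hU, w1.unique (WeakTendsto.of_tendsto (h1.mono_left hl)),
    w2.unique (WeakTendsto.of_tendsto (h2.mono_left hl)),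
    w3.unique (WeakTendsto.of_tendsto (h3.mono_left hl))⟩

/-- The derivatives of the smoothings are the smoothings of the weak derivatives times contraction
factors that tend to 1, so all three components converge. -/
theorem exists_mem_of_hasCompactSupport (hL : 0 < L) {u g g' : ℝ × ℝ → ℂ}
    (hu : MemLp u 2 (stripMeasure L)) (hs : HasCompactSupport u) (h : HasWeakDeriv L ex u g)
    (h' : HasWeakDeriv L ey u g') :
    ∃ U ∈ energySpace L, U.1 = hu.toLp u ∧ U.2.1 = h.1.toLp g ∧ U.2.2.1 = h'.1.toLp g' := by
  have hsm : ∀ n, HasCompactSupport ((bump L hL n).normed volume) :=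
    fun n => ContDiffBump.hasCompactSupport_normed _
  have hpos : ∀ n, factor n ≠ 0 := fun n => by linarith [half_le_factor n]
  have hcc : ∀ n, IsCc (smoothSeq hL n u) := fun n =>
    ⟨contDiff_smoothing (ContDiffBump.contDiff_normed _) (hsm n) hu _,
      hasCompactSupport_smoothing (hsm n) hs (hpos n)⟩
  have hlim : ∀ {e : ℝ × ℝ} {k : ℝ × ℝ → ℂ} (hk : HasWeakDeriv L e u k),
      Tendsto (fun n => ((hcc n).memLp_fderiv L e).toLp _) atTop (𝓝 (hk.1.toLp k)) := by
    intro e k hk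
    have hc : ∀ n, Continuous (smoothSeq hL n k) := fun n =>
      (contDiff_smoothing (ContDiffBump.contDiff_normed _) (hsm n) hk.1 _).continuous
    have hm : ∀ n, MemLp (smoothSeq hL n k) 2 (stripMeasure L) := fun n =>
      ⟨(hc n).aestronglyMeasurable, (eLpNorm_smoothSeq_le hL n hk.1).trans_lt
        (ENNReal.mul_lt_top (by norm_num) hk.1.2)⟩
    have h1 : Tendsto (fun n => (hm n).toLp _) atTop (𝓝 (hk.1.toLp k)) :=
      (Lp.tendsto_Lp_iff_tendsto_eLpNorm'' _ hm _ hk.1).2 (tendsto_smoothSeq hL hk.1)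
    have h2 := tendsto_factor.smul h1
    rw [one_smul] at h2
    refine h2.congr fun n => ?_
    rw [← MemLp.toLp_const_smul]
    refine MemLp.toLp_congr _ _ ?_
    filter_upwards [ae_restrict_mem measurableSet_strip'] with z hz
    exact (fderiv_smoothing (ContDiffBump.contDiff_normed _)
      (ContDiffBump.tsupport_normed_eq _).subset (by linarith [half_le_factor n])
      (bump_rOut_lt hL n) hu hk hz).symm
  exact mem_energySpace_of_tendsto (fun n => quad_mem (hcc n))
    ((Lp.tendsto_Lp_iff_tendsto_eLpNorm'' _ (fun n => (hcc n).memLp L) _ hu).2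
      (tendsto_smoothSeq hL hu)) (hlim h) (hlim h')

theorem tendsto_toLp_of_dominated {α : Type*} [MeasurableSpace α] {μ : Measure α}
    {F : ℕ → α → ℂ} {f : α → ℂ} (hF : ∀ n, MemLp (F n) 2 μ) (hf : MemLp f 2 μ) {b : α → ℝ}
    (hb : MemLp b 2 μ) (hle : ∀ n z, ‖F n z - f z‖ ≤ b z)
    (hlim : ∀ z, Tendsto (fun n => F n z) atTop (𝓝 (f z))) :
    Tendsto (fun n => (hF n).toLp (F n)) atTop (𝓝 (hf.toLp f)) := by
  rw [tendsto_iff_norm_sub_tendsto_zero]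
  have e : ∀ n, ‖(hF n).toLp (F n) - hf.toLp f‖ ^ 2 = ∫ z, ‖F n z - f z‖ ^ 2 ∂μ := by
    intro n
    rw [← MemLp.toLp_sub, norm_toLp_sq]
    rfl
  have h1 : Tendsto (fun n => ∫ z, ‖F n z - f z‖ ^ 2 ∂μ) atTop (𝓝 (∫ _, (0 : ℝ) ∂μ)) := by
    refine tendsto_integral_of_dominated_convergence (fun z => b z ^ 2)
      (fun n => ((hF n).1.sub hf.1).norm.pow 2)
      ((memLp_two_iff_integrable_sq hb.1).1 hb)
      (fun n => Eventually.of_forall fun z => ?_) (Eventually.of_forall fun z => ?_)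
    · rw [Real.norm_of_nonneg (by positivity)]
      exact pow_le_pow_left₀ (norm_nonneg _) (hle n z) 2
    · have := ((hlim z).sub_const (f z)).norm.pow 2
      simpa using this
  rw [integral_zero] at h1
  have h2 := (Real.continuous_sqrt.tendsto 0).comp h1
  rw [Real.sqrt_zero] at h2
  refine h2.congr fun n => ?_
  rw [Function.comp_apply, ← e, Real.sqrt_sq (norm_nonneg _)]

/-- A fixed cut-off function. -/
noncomputable def cutoffBump : ContDiffBump (0 : ℝ × ℝ) where
  rIn := 1
  rOut := 2
  rIn_pos := one_pos
  rIn_lt_rOut := one_lt_two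

/-- Cut-off functions, equal to one on large balls. -/
noncomputable def cutoff (n : ℕ) (z : ℝ × ℝ) : ℝ := cutoffBump ((1 / ((n : ℝ) + 2)) • z)

theorem contDiff_cutoff (n : ℕ) : ContDiff ℝ (⊤ : ℕ∞) (cutoff n) :=
  cutoffBump.contDiff.comp (contDiff_const_smul _)

theorem hasCompactSupport_cutoff (n : ℕ) : HasCompactSupport (cutoff n) :=
  cutoffBump.hasCompactSupport.comp_homeomorph
    (Homeomorph.smulOfNeZero (1 / ((n : ℝ) + 2)) (by positivity))

theorem fderiv_cutoff (n : ℕ) (z e : ℝ × ℝ) : fderiv ℝ (cutoff n) z e =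
    (1 / ((n : ℝ) + 2)) * fderiv ℝ cutoffBump ((1 / ((n : ℝ) + 2)) • z) e := by
  have hd : Differentiable ℝ (cutoffBump : ℝ × ℝ → ℝ) :=
    (cutoffBump.contDiff (n := 1)).differentiable one_ne_zero
  have : HasFDerivAt (cutoff n) _ z := (hd ((1 / ((n : ℝ) + 2)) • z)).hasFDerivAt.comp z
    ((hasFDerivAt_id z).const_smul (1 / ((n : ℝ) + 2)))
  rw [this.fderiv]
  simp

theorem eventually_cutoff (z : ℝ × ℝ) : ∀ᶠ n : ℕ in atTop, cutoff n z = 1 := by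
  have h := tendsto_one_div_add_two.smul_const z
  rw [zero_smul] at h
  filter_upwards [h.eventually (Metric.closedBall_mem_nhds (0 : ℝ × ℝ) one_pos)] with n hn
  exact cutoffBump.one_of_mem_closedBall hn

theorem abs_cutoff_le (n : ℕ) (z : ℝ × ℝ) : ‖(cutoff n z : ℂ)‖ ≤ 1 := by
  rw [Complex.norm_real, cutoff, Real.norm_of_nonneg cutoffBump.nonneg]
  exact cutoffBump.le_one

/-- Reduction to compact support by cut-offs equal to 1 on growing balls; the extra term with the
derivative of the cut-off is O(1/n) in L². -/
theorem exists_mem_of_hasWeakDeriv (hL : 0 < L) {u g g' : ℝ × ℝ → ℂ}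
    (hu : MemLp u 2 (stripMeasure L)) (h : HasWeakDeriv L ex u g)
    (h' : HasWeakDeriv L ey u g') :
    ∃ U ∈ energySpace L, U.1 = hu.toLp u ∧ U.2.1 = h.1.toLp g ∧ U.2.2.1 = h'.1.toLp g' := by
  have hw : ∀ (n : ℕ) {e : ℝ × ℝ} {k : ℝ × ℝ → ℂ} (_ : HasWeakDeriv L e u k),
      HasWeakDeriv L e (fun z => (cutoff n z : ℂ) * u z)
        (fun z => (cutoff n z : ℂ) * k z + (fderiv ℝ (cutoff n) z e : ℂ) * u z) :=
    fun n e k hk => hk.smooth_mul hu (contDiff_cutoff n) (hasCompactSupport_cutoff n)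
  have hm : ∀ n, MemLp (fun z => (cutoff n z : ℂ) * u z) 2 (stripMeasure L) := by
    intro n
    refine hu.of_le ((Complex.continuous_ofReal.comp
      (contDiff_cutoff n).continuous).aestronglyMeasurable.mul hu.1)
      (Eventually.of_forall fun z => ?_)
    rw [norm_mul]
    exact mul_le_of_le_one_left (norm_nonneg _) (abs_cutoff_le n z)
  choose V hV e1 e2 e3 using fun n => exists_mem_of_hasCompactSupport hL (hm n)
    (hasCompactSupport_of_imp (hasCompactSupport_cutoff n) fun z hz => by simp [hz]) (hw n h) (hw n h')
  have hbd : ∀ (n : ℕ) (z : ℝ × ℝ) (a : ℂ), ‖(cutoff n z : ℂ) * a - a‖ ≤ 2 * ‖a‖ := by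
    intro n z a
    refine (norm_sub_le _ _).trans ?_
    rw [norm_mul]
    have := mul_le_of_le_one_left (norm_nonneg a) (abs_cutoff_le n z)
    linarith
  have hl1 : Tendsto (fun n => (hm n).toLp _) atTop (𝓝 (hu.toLp u)) := by
    refine tendsto_toLp_of_dominated hm hu (b := fun z => 2 * ‖u z‖) (hu.norm.const_mul 2)
      (fun n z => hbd n z _) fun z => ?_
    refine tendsto_const_nhds.congr' ?_
    filter_upwards [eventually_cutoff z] with n hn
    rw [hn, Complex.ofReal_one, one_mul]
  have hl2 : ∀ {e : ℝ × ℝ} {k : ℝ × ℝ → ℂ} (hk : HasWeakDeriv L e u k),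
      Tendsto (fun n => (hw n hk).1.toLp _) atTop (𝓝 (hk.1.toLp k)) := by
    intro e k hk
    have hc : Continuous fun z => fderiv ℝ (cutoffBump : ℝ × ℝ → ℝ) z e :=
      continuous_fderiv_dir cutoffBump.contDiff e
    obtain ⟨C, hC⟩ := (hasCompactSupport_fderiv_dir
      cutoffBump.hasCompactSupport e).exists_bound_of_continuous hc
    have hC' : ∀ (n : ℕ) (z : ℝ × ℝ), ‖(fderiv ℝ (cutoff n) z e : ℂ) * u z‖ ≤
        1 / ((n : ℝ) + 2) * (C * ‖u z‖) := by
      intro n z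
      have h0 : (0 : ℝ) < 1 / (n + 2) := by positivity
      rw [fderiv_cutoff, norm_mul, Complex.norm_real, norm_mul, Real.norm_of_nonneg h0.le, mul_assoc]
      gcongr
      exact hC _
    refine tendsto_toLp_of_dominated (fun n => (hw n hk).1) hk.1
      (b := fun z => 2 * ‖k z‖ + C * ‖u z‖)
      ((hk.1.norm.const_mul 2).add (hu.norm.const_mul C)) (fun n z => ?_) fun z => ?_
    · rw [add_sub_right_comm]
      refine (norm_add_le _ _).trans (add_le_add (hbd n z _) ((hC' n z).trans ?_))
      have hC0 : 0 ≤ C := (norm_nonneg _).trans (hC 0)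
      refine mul_le_of_le_one_left (by positivity) ?_
      rw [div_le_one (by positivity)]
      linarith [Nat.cast_nonneg (α := ℝ) n]
    · have t1 : Tendsto (fun n => (cutoff n z : ℂ) * k z) atTop (𝓝 (k z)) := by
        refine tendsto_const_nhds.congr' ?_
        filter_upwards [eventually_cutoff z] with n hn
        rw [hn, Complex.ofReal_one, one_mul]
      have t2 : Tendsto (fun n => (fderiv ℝ (cutoff n) z e : ℂ) * u z) atTop (𝓝 0) := by
        refine squeeze_zero_norm (fun n => hC' n z) ?_
        simpa using tendsto_one_div_add_two.mul_const (C * ‖u z‖)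
      simpa using t1.add t2
  exact mem_energySpace_of_tendsto hV (by simpa only [e1] using hl1)
    (by simpa only [e2] using hl2 h) (by simpa only [e3] using hl2 h')

/-- The functions in `H¹` of the strip, with their weak derivatives and traces, are the elements
of the energy space. -/
theorem exists_quad_of_memH1 (hL : 0 < L) {u : ℝ × ℝ → ℂ} (hu : MemH1 L u) :
    ∃ U ∈ energySpace L, U.1 =ᵐ[stripMeasure L] u ∧ U.2.1 =ᵐ[stripMeasure L] weakDeriv L ex u ∧
      U.2.2.1 =ᵐ[stripMeasure L] weakDeriv L ey u ∧ U.2.2.2 =ᵐ[sectionMeasure L] trace L u := by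
  have hx := hasWeakDeriv_weakDeriv hu.2.1
  have hy := hasWeakDeriv_weakDeriv hu.2.2
  obtain ⟨U, hU, h1, h2, h3⟩ := exists_mem_of_hasWeakDeriv hL hu.1 hx hy
  obtain ⟨φ, h, hlim⟩ := exists_seq_quad hU
  have lim1 : Tendsto (fun n => ((h n).quad L).1) atTop (𝓝 U.1) :=
    (continuous_fst.tendsto U).comp hlim
  have lim2 : Tendsto (fun n => ((h n).quad L).2.1) atTop (𝓝 U.2.1) :=
    ((continuous_fst.comp continuous_snd).tendsto U).comp hlim
  have lim3 : Tendsto (fun n => ((h n).quad L).2.2.1) atTop (𝓝 U.2.2.1) :=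
    ((continuous_fst.comp (continuous_snd.comp continuous_snd)).tendsto U).comp hlim
  have lim4 : Tendsto (fun n => ((h n).quad L).2.2.2) atTop (𝓝 U.2.2.2) :=
    ((continuous_snd.comp (continuous_snd.comp continuous_snd)).tendsto U).comp hlim
  rw [h1] at lim1
  rw [h2] at lim2
  rw [h3] at lim3
  rw [← Lp.toLp_coeFn U.2.2.2 (Lp.memLp _)] at lim4
  -- This sequence only shows that some trace exists; `trace` may have been chosen differently.
  have htr : ∃ t, IsTrace L u t := ⟨U.2.2.2, Lp.memLp _, φ, fun n => ⟨(h n).smooth, (h n).cpt⟩,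
    (Lp.tendsto_Lp_iff_tendsto_eLpNorm'' _ (fun n => (h n).memLp L) _ hu.1).1 lim1,
    (Lp.tendsto_Lp_iff_tendsto_eLpNorm'' _ (fun n => (h n).memLp_fderiv L ex) _ hx.1).1 lim2,
    (Lp.tendsto_Lp_iff_tendsto_eLpNorm'' _ (fun n => (h n).memLp_fderiv L ey) _ hy.1).1 lim3,
    (Lp.tendsto_Lp_iff_tendsto_eLpNorm'' _ (fun n => (h n).memLp_slice L) _ (Lp.memLp _)).1 lim4⟩
  have hT : IsTrace L u (trace L u) := by
    rw [trace, dif_pos htr]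
    exact htr.choose_spec
  -- The chosen trace comes with its own smooth sequence, converging in all four components, so the
  -- quadruple with the chosen trace lies in the closed energy space.
  obtain ⟨ht, ψ, hψ, l1, l2, l3, l4⟩ := hT
  have hc : ∀ n, IsCc (ψ n) := fun n => ⟨(hψ n).1, (hψ n).2⟩
  have k1 := (Lp.tendsto_Lp_iff_tendsto_eLpNorm'' _ (fun n => (hc n).memLp L) _ hu.1).2 l1
  have k2 := (Lp.tendsto_Lp_iff_tendsto_eLpNorm'' _ (fun n => (hc n).memLp_fderiv L ex) _ hx.1).2 l2
  have k3 := (Lp.tendsto_Lp_iff_tendsto_eLpNorm'' _ (fun n => (hc n).memLp_fderiv L ey) _ hy.1).2 l3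
  have k4 := (Lp.tendsto_Lp_iff_tendsto_eLpNorm'' _ (fun n => (hc n).memLp_slice L) _ ht).2 l4
  refine ⟨(hu.1.toLp u, hx.1.toLp _, hy.1.toLp _, ht.toLp _), ?_, hu.1.coeFn_toLp,
    hx.1.coeFn_toLp, hy.1.coeFn_toLp, ht.coeFn_toLp⟩
  exact isClosed_energySpace.mem_of_tendsto
    (k1.prodMk_nhds (k2.prodMk_nhds (k3.prodMk_nhds k4)))
    (Eventually.of_forall fun n => quad_mem (hc n))

end Identification

end DeltaStrip

/-! ### Testing the equation with functions that satisfy the Neumann condition. -/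

namespace DeltaStrip

variable {L : ℝ}

section Parts

theorem IsCc.fderiv_dir {φ : ℝ × ℝ → ℂ} (h : IsCc φ) (e : ℝ × ℝ) :
    IsCc fun z => fderiv ℝ φ z e :=
  ⟨(h.smooth.fderiv_right (m := (⊤ : ℕ∞)) (by simp)).clm_apply contDiff_const,
    h.hasCompactSupport_fderiv e⟩

theorem integral_fderiv_ex_eq_zero {h : ℝ × ℝ → ℝ} (hh : ContDiff ℝ 1 h) (hs : HasCompactSupport h) :
    ∫ z, fderiv ℝ h z ex ∂(stripMeasure L) = 0 := by
  have hc := continuous_fderiv_dir hh ex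
  have hcs := hasCompactSupport_fderiv_dir hs ex
  have i := integrable_strip (L := L) hc hcs
  rw [stripMeasure_eq] at i ⊢
  rw [integral_prod_symm _ i]
  refine integral_eq_zero_of_ae (Eventually.of_forall fun y => ?_)
  refine integral_eq_zero_of_hasDerivAt_of_integrable
    (fun x => hasDerivAt_slice_fst (hh.differentiable one_ne_zero _))
    ((hc.comp (by fun_prop)).integrable_of_hasCompactSupport (hasCompactSupport_slice_fst hcs y))
    ((hh.continuous.comp (by fun_prop)).integrable_of_hasCompactSupport
      (hasCompactSupport_slice_fst hs y))

theorem integral_fderiv_ey_eq_zero (hL : 0 < L) {h : ℝ × ℝ → ℝ} (hh : ContDiff ℝ 1 h)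
    (hs : HasCompactSupport h) (h0 : ∀ x, h (x, 0) = 0) (h1 : ∀ x, h (x, L) = 0) :
    ∫ z, fderiv ℝ h z ey ∂(stripMeasure L) = 0 := by
  have hc := continuous_fderiv_dir hh ey
  have i := integrable_strip (L := L) hc (hasCompactSupport_fderiv_dir hs ey)
  rw [stripMeasure_eq] at i ⊢
  rw [integral_prod _ i]
  refine integral_eq_zero_of_ae (Eventually.of_forall fun x => ?_)
  have key := intervalIntegral.integral_eq_sub_of_hasDerivAt (a := 0) (b := L)
    (fun y _ => hasDerivAt_slice_snd (x := x) (hh.differentiable one_ne_zero (x, y)))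
    ((hc.comp (by fun_prop : Continuous fun y : ℝ => (x, y))).intervalIntegrable _ _)
  rw [h0, h1, sub_self, intervalIntegral.integral_of_le hL.le, ← integral_Icc_eq_integral_Ioc] at key
  exact key

theorem inner_toLp_eq {α : Type*} [MeasurableSpace α] {μ : Measure α} {f g : α → ℂ}
    (hf : MemLp f 2 μ) (hg : MemLp g 2 μ) :
    inner ℝ (hf.toLp f) (hg.toLp g) = ∫ z, inner ℝ (f z) (g z) ∂μ := by
  rw [L2.inner_def]
  refine integral_congr_ae ?_
  filter_upwards [hf.coeFn_toLp, hg.coeFn_toLp] with z h1 h2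
  rw [h1, h2]

theorem integrable_inner_toLp {α : Type*} [MeasurableSpace α] {μ : Measure α} {f g : α → ℂ}
    (hf : MemLp f 2 μ) (hg : MemLp g 2 μ) : Integrable (fun z => (inner ℝ (f z) (g z) : ℝ)) μ := by
  refine (L2.integrable_inner (𝕜 := ℝ) (hf.toLp f) (hg.toLp g)).congr ?_
  filter_upwards [hf.coeFn_toLp, hg.coeFn_toLp] with z h1 h2
  rw [h1, h2]

theorem fderiv_inner {φ ψ : ℝ × ℝ → ℂ} (h : IsCc φ) (h' : IsCc ψ) (z e : ℝ × ℝ) :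
    fderiv ℝ (fun z => (inner ℝ (φ z) (ψ z) : ℝ)) z e =
      inner ℝ (fderiv ℝ φ z e) (ψ z) + inner ℝ (φ z) (fderiv ℝ ψ z e) := by
  rw [fderiv_inner_apply ℝ (h.differentiable z) (h'.differentiable z), add_comm]

theorem inner_dx_add {U : Quad L} (hU : U ∈ energySpace L) {w : ℝ × ℝ → ℂ} (hw : IsCc w) :
    inner ℝ U.2.1 ((hw.memLp L).toLp w) +
      inner ℝ U.1 ((hw.memLp_fderiv L ex).toLp fun z => fderiv ℝ w z ex) = 0 := by
  refine energySpace_induction (P := fun U : Quad L => inner ℝ U.2.1 ((hw.memLp L).toLp w) +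
      inner ℝ U.1 ((hw.memLp_fderiv L ex).toLp fun z => fderiv ℝ w z ex) = 0)
    (isClosed_eq (by fun_prop) continuous_const) (fun φ h => ?_) U hU
  simp only [IsCc.quad, inner_toLp_eq]
  rw [← integral_add (integrable_inner_toLp (h.memLp_fderiv L ex) (hw.memLp L))
    (integrable_inner_toLp (h.memLp L) (hw.memLp_fderiv L ex))]
  simp only [← fderiv_inner h hw]
  exact integral_fderiv_ex_eq_zero (h.contDiff_one.inner ℝ hw.contDiff_one)
    (hasCompactSupport_of_imp h.cpt fun z hz => by simp [hz])

/-- No boundary term appears although U is free on the sides, because w vanishes there. It is used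
with w a normal derivative. -/
theorem inner_dy_add (hL : 0 < L) {U : Quad L} (hU : U ∈ energySpace L) {w : ℝ × ℝ → ℂ}
    (hw : IsCc w) (h0 : ∀ x, w (x, 0) = 0) (h1 : ∀ x, w (x, L) = 0) :
    inner ℝ U.2.2.1 ((hw.memLp L).toLp w) +
      inner ℝ U.1 ((hw.memLp_fderiv L ey).toLp fun z => fderiv ℝ w z ey) = 0 := by
  refine energySpace_induction (P := fun U : Quad L => inner ℝ U.2.2.1 ((hw.memLp L).toLp w) +
      inner ℝ U.1 ((hw.memLp_fderiv L ey).toLp fun z => fderiv ℝ w z ey) = 0)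
    (isClosed_eq (by fun_prop) continuous_const) (fun φ h => ?_) U hU
  simp only [IsCc.quad, inner_toLp_eq]
  rw [← integral_add (integrable_inner_toLp (h.memLp_fderiv L ey) (hw.memLp L))
    (integrable_inner_toLp (h.memLp L) (hw.memLp_fderiv L ey))]
  simp only [← fderiv_inner h hw]
  exact integral_fderiv_ey_eq_zero hL (h.contDiff_one.inner ℝ hw.contDiff_one)
    (hasCompactSupport_of_imp h.cpt fun z hz => by simp [hz])
    (fun x => by simp [h0]) (fun x => by simp [h1])

theorem inner_toLp_ofReal {α : Type*} [MeasurableSpace α] {μ : Measure α} {F : Lp ℂ 2 μ}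
    {f k : α → ℝ} (hF : F =ᵐ[μ] fun z => (f z : ℂ)) (hk : MemLp (fun z => (k z : ℂ)) 2 μ) :
    inner ℝ F (hk.toLp _) = ∫ z, f z * k z ∂μ := by
  rw [L2.inner_def]
  refine integral_congr_ae ?_
  filter_upwards [hF, hk.coeFn_toLp] with z h1 h2
  rw [h1, h2, Complex.inner, Complex.conj_ofReal, ← Complex.ofReal_mul, Complex.ofReal_re,
    mul_comm]

/-- The equation tested with a smooth function that satisfies the Neumann condition. -/
theorem integral_mul_laplacian (hL : 0 < L) {ω γ r : ℝ} {U : Quad L} (hU : U ∈ energySpace L)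
    {f : ℝ × ℝ → ℝ} {t : ℝ → ℝ} (hf : U.1 =ᵐ[stripMeasure L] fun z => (f z : ℂ))
    (ht : U.2.2.2 =ᵐ[sectionMeasure L] fun y => (t y : ℂ))
    (hEL : ∀ W ∈ energySpace L, bForm ω γ U W =
        ∫ z, ‖U.1 z‖ ^ (r - 2) * inner ℝ (U.1 z) (W.1 z) ∂(stripMeasure L))
    {v : ℝ × ℝ → ℝ} (hv : ContDiff ℝ (⊤ : ℕ∞) v) (hs : HasCompactSupport v)
    (h0 : ∀ x, fderiv ℝ v (x, 0) ey = 0) (h1 : ∀ x, fderiv ℝ v (x, L) ey = 0) :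
    ∫ z, f z * (fderiv ℝ (fun z => fderiv ℝ v z ex) z ex + fderiv ℝ (fun z => fderiv ℝ v z ey) z ey)
        ∂(stripMeasure L) =
      ω * (∫ z, f z * v z ∂(stripMeasure L)) + γ * (∫ y, t y * v (0, y) ∂(sectionMeasure L))
        - ∫ z, |f z| ^ (r - 2) * f z * v z ∂(stripMeasure L) := by
  have hc : IsCc fun z => (v z : ℂ) :=
    ⟨Complex.ofRealCLM.contDiff.comp hv, hasCompactSupport_of_imp hs fun z hz => by simp [hz]⟩
  have hv1 : ContDiff ℝ 1 v := hv.of_le (by exact_mod_cast le_top)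
  have d1 : ∀ e, (fun z => fderiv ℝ (fun z => (v z : ℂ)) z e) = fun z => (fderiv ℝ v z e : ℂ) :=
    fun e => funext fun z => fderiv_ofReal_comp (hv1.differentiable one_ne_zero) z e
  have hve : ∀ e, ContDiff ℝ 1 fun z => fderiv ℝ v z e := fun e =>
    ((hv.fderiv_right (m := (⊤ : ℕ∞)) (by simp)).clm_apply contDiff_const).of_le
      (by exact_mod_cast le_top)
  have d2 : ∀ e, (fun z => fderiv ℝ (fun z => fderiv ℝ (fun z => (v z : ℂ)) z e) z e) =
      fun z => (fderiv ℝ (fun z => fderiv ℝ v z e) z e : ℂ) := fun e => by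
    rw [d1]
    exact funext fun z => fderiv_ofReal_comp ((hve e).differentiable one_ne_zero) z e
  have a1 := inner_dx_add hU (hc.fderiv_dir ex)
  -- The Neumann condition on v says that ∂ᵧv vanishes on both sides, as needed here.
  have a2 := inner_dy_add hL hU (hc.fderiv_dir ey)
    (fun x => by rw [congrFun (d1 ey) (x, 0), h0, Complex.ofReal_zero])
    (fun x => by rw [congrFun (d1 ey) (x, L), h1, Complex.ofReal_zero])
  have a3 := hEL _ (quad_mem (L := L) hc)
  have k2 : ∀ e, MemLp (fun z => (fderiv ℝ (fun z => fderiv ℝ v z e) z e : ℂ)) 2 (stripMeasure L) :=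
    fun e => by rw [← d2]; exact (hc.fderiv_dir e).memLp_fderiv L e
  have b1 : ∀ e, inner ℝ U.1 (((hc.fderiv_dir e).memLp_fderiv L e).toLp
      fun z => fderiv ℝ (fun z => fderiv ℝ (fun z => (v z : ℂ)) z e) z e) =
      ∫ z, f z * fderiv ℝ (fun z => fderiv ℝ v z e) z e ∂(stripMeasure L) := fun e => by
    rw [← inner_toLp_ofReal hf (k2 e)]
    congr 1
    exact MemLp.toLp_congr _ _ (by rw [d2])
  have b2 : inner ℝ U.1 ((hc.memLp L).toLp fun z => (v z : ℂ)) =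
      ∫ z, f z * v z ∂(stripMeasure L) := inner_toLp_ofReal hf _
  have b3 : inner ℝ U.2.2.2 ((hc.memLp_slice L).toLp fun y => (v (0, y) : ℂ)) =
      ∫ y, t y * v (0, y) ∂(sectionMeasure L) := inner_toLp_ofReal ht (hc.memLp_slice L)
  have b4 : ∫ z, ‖U.1 z‖ ^ (r - 2) * inner ℝ (U.1 z) ((hc.quad L).1 z) ∂(stripMeasure L) =
      ∫ z, |f z| ^ (r - 2) * f z * v z ∂(stripMeasure L) := by
    refine integral_congr_ae ?_
    filter_upwards [hf, (hc.memLp L).coeFn_toLp] with z h1 h2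
    have h2' : (hc.quad L).1 z = (v z : ℂ) := h2
    rw [h1, h2', Complex.inner, Complex.conj_ofReal, ← Complex.ofReal_mul, Complex.ofReal_re,
      Complex.norm_real, Real.norm_eq_abs, mul_assoc,
      mul_comm (v z)]
  rw [b4] at a3
  rw [b1] at a1 a2
  have i : ∀ e, Integrable (fun z => f z * fderiv ℝ (fun z => fderiv ℝ v z e) z e)
      (stripMeasure L) := by
    intro e
    have := integrable_inner_toLp (Lp.memLp U.1) (k2 e)
    refine this.congr ?_
    filter_upwards [hf] with z h1
    rw [h1, Complex.inner, Complex.conj_ofReal, ← Complex.ofReal_mul, Complex.ofReal_re,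
      mul_comm]
  simp only [mul_add]
  rw [integral_add (i ex) (i ey), ← a3, ← b2, ← b3]
  simp only [bForm, IsCc.quad]
  linarith

end Parts

end DeltaStrip

/-! ### Radial kernels and their reflections. -/

namespace DeltaStrip

variable {L : ℝ}

section Profile

/-- The derivative of `expNegInvGlue`. -/
noncomputable def glueDeriv (x : ℝ) : ℝ := x⁻¹ ^ 2 * expNegInvGlue x

/-- The second derivative of `expNegInvGlue`. -/
noncomputable def glueDeriv₂ (x : ℝ) : ℝ := x⁻¹ ^ 2 * (x⁻¹ ^ 2 - 2 * x⁻¹) * expNegInvGlue x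

theorem hasDerivAt_glue (x : ℝ) : HasDerivAt expNegInvGlue (glueDeriv x) x := by
  simpa [glueDeriv] using expNegInvGlue.hasDerivAt_polynomial_eval_inv_mul 1 x

theorem hasDerivAt_glueDeriv (x : ℝ) : HasDerivAt glueDeriv (glueDeriv₂ x) x := by
  have := expNegInvGlue.hasDerivAt_polynomial_eval_inv_mul (Polynomial.X ^ 2) x
  simp only [Polynomial.eval_pow, Polynomial.eval_X, Polynomial.eval_mul, Polynomial.eval_sub,
    Polynomial.derivative_X_pow, Nat.cast_ofNat, Polynomial.eval_C, Nat.add_one_sub_one,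
    pow_one] at this
  exact this

theorem contDiff_glueDeriv : ContDiff ℝ (⊤ : ℕ∞) glueDeriv := by
  have := expNegInvGlue.contDiff_polynomial_eval_inv_mul (n := ⊤) (Polynomial.X ^ 2)
  simp only [Polynomial.eval_pow, Polynomial.eval_X] at this
  exact this

theorem continuous_glueDeriv₂ : Continuous glueDeriv₂ := by
  have := expNegInvGlue.continuous_polynomial_eval_inv_mul
    (Polynomial.X ^ 2 * (Polynomial.X ^ 2 - 2 * Polynomial.X))
  simp only [Polynomial.eval_pow, Polynomial.eval_X, Polynomial.eval_mul, Polynomial.eval_sub,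
    Polynomial.eval_ofNat] at this
  exact this

theorem glueDeriv_of_nonpos {x : ℝ} (hx : x ≤ 0) : glueDeriv x = 0 := by
  rw [glueDeriv, expNegInvGlue.zero_of_nonpos hx, mul_zero]

theorem glueDeriv₂_of_nonpos {x : ℝ} (hx : x ≤ 0) : glueDeriv₂ x = 0 := by
  rw [glueDeriv₂, expNegInvGlue.zero_of_nonpos hx, mul_zero]

theorem glueDeriv_nonneg (x : ℝ) : 0 ≤ glueDeriv x :=
  mul_nonneg (sq_nonneg _) (expNegInvGlue.nonneg x)

theorem glueDeriv_pos {x : ℝ} (hx : 0 < x) : 0 < glueDeriv x :=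
  mul_pos (by positivity) (expNegInvGlue.pos_of_pos hx)

/-- For 0 < x ≤ 1 the factor x⁻² is at least 1. It yields `ker₀` ≤ `ker₁` / (2a), through which the
term ω f is compared with the mean value. -/
theorem glue_le_glueDeriv {x : ℝ} (hx : x ≤ 1) : expNegInvGlue x ≤ glueDeriv x := by
  rcases le_or_gt x 0 with h | h
  · rw [glueDeriv_of_nonpos h, expNegInvGlue.zero_of_nonpos h]
  · exact le_mul_of_one_le_left (expNegInvGlue.nonneg x) (one_le_pow₀ ((one_le_inv₀ h).2 hx))

theorem exists_bound_of_le_one {g : ℝ → ℝ} (hg : Continuous g) (h0 : ∀ x ≤ 0, g x = 0) :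
    ∃ B, 0 ≤ B ∧ ∀ x ≤ 1, |g x| ≤ B := by
  obtain ⟨B, hB⟩ := isCompact_Icc.exists_bound_of_continuousOn (s := Set.Icc (0 : ℝ) 1) hg.continuousOn
  have hB0 : 0 ≤ B := (norm_nonneg _).trans (hB 0 ⟨le_rfl, zero_le_one⟩)
  refine ⟨B, hB0, fun x hx => ?_⟩
  rcases le_or_gt x 0 with h | h
  · rwa [h0 x h, abs_zero]
  · exact hB x ⟨h.le, hx⟩

theorem exists_glue_bound : ∃ B, 0 < B ∧ ∀ x ≤ 1, |expNegInvGlue x| ≤ B ∧ |glueDeriv x| ≤ B ∧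
    |glueDeriv₂ x| ≤ B := by
  obtain ⟨B₀, h0, h0'⟩ := exists_bound_of_le_one (expNegInvGlue.contDiff (n := 0)).continuous
    fun x hx => expNegInvGlue.zero_of_nonpos hx
  obtain ⟨B₁, h1, h1'⟩ := exists_bound_of_le_one contDiff_glueDeriv.continuous
    fun x hx => glueDeriv_of_nonpos hx
  obtain ⟨B₂, h2, h2'⟩ := exists_bound_of_le_one continuous_glueDeriv₂
    fun x hx => glueDeriv₂_of_nonpos hx
  refine ⟨B₀ + B₁ + B₂ + 1, by positivity, fun x hx => ⟨?_, ?_, ?_⟩⟩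
  · linarith [h0' x hx]
  · linarith [h1' x hx]
  · linarith [h2' x hx]

end Profile

section Kernel

/-- The square of the Euclidean norm. -/
def sqn (w : ℝ × ℝ) : ℝ := w.1 ^ 2 + w.2 ^ 2

theorem sqn_nonneg (w : ℝ × ℝ) : 0 ≤ sqn w := by unfold sqn; positivity

@[fun_prop]
theorem contDiff_sqn : ContDiff ℝ (⊤ : ℕ∞) sqn := by unfold sqn; fun_prop

/-- A smooth radial bump of radius `a ^ (-1/2)`. -/
noncomputable def ker₀ (a : ℝ) (w : ℝ × ℝ) : ℝ := expNegInvGlue (1 - a * sqn w)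

/-- The averaging kernel associated with `ker₀`. -/
noncomputable def ker₁ (a : ℝ) (w : ℝ × ℝ) : ℝ := 2 * a * glueDeriv (1 - a * sqn w)

/-- The Laplacian of `ker₀`. -/
noncomputable def ker₂ (a : ℝ) (w : ℝ × ℝ) : ℝ :=
  4 * a ^ 2 * sqn w * glueDeriv₂ (1 - a * sqn w) - 4 * a * glueDeriv (1 - a * sqn w)

theorem contDiff_ker₀ (a : ℝ) : ContDiff ℝ (⊤ : ℕ∞) (ker₀ a) :=
  (expNegInvGlue.contDiff (n := ⊤)).comp (contDiff_const.sub (contDiff_const.mul contDiff_sqn))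

theorem contDiff_glueDeriv_sqn (a : ℝ) :
    ContDiff ℝ (⊤ : ℕ∞) fun w => glueDeriv (1 - a * sqn w) :=
  contDiff_glueDeriv.comp (contDiff_const.sub (contDiff_const.mul contDiff_sqn))

theorem contDiff_ker₁ (a : ℝ) : ContDiff ℝ (⊤ : ℕ∞) (ker₁ a) :=
  contDiff_const.mul (contDiff_glueDeriv_sqn a)

theorem continuous_ker₂ (a : ℝ) : Continuous (ker₂ a) := by
  have h1 : Continuous sqn := contDiff_sqn.continuous
  have h2 : Continuous fun w => glueDeriv₂ (1 - a * sqn w) :=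
    continuous_glueDeriv₂.comp (by fun_prop)
  have h3 := (contDiff_glueDeriv_sqn a).continuous
  unfold ker₂
  fun_prop

theorem ker₀_eq_zero {a : ℝ} {w : ℝ × ℝ} (h : 1 ≤ a * sqn w) : ker₀ a w = 0 :=
  expNegInvGlue.zero_of_nonpos (by linarith)

theorem ker₁_eq_zero {a : ℝ} {w : ℝ × ℝ} (h : 1 ≤ a * sqn w) : ker₁ a w = 0 := by
  rw [ker₁, glueDeriv_of_nonpos (by linarith), mul_zero]

theorem ker₂_eq_zero {a : ℝ} {w : ℝ × ℝ} (h : 1 ≤ a * sqn w) : ker₂ a w = 0 := by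
  rw [ker₂, glueDeriv_of_nonpos (by linarith), glueDeriv₂_of_nonpos (by linarith)]
  ring

theorem fderiv_ex_of_slice {F : ℝ × ℝ → ℝ} (hF : Differentiable ℝ F) {w : ℝ × ℝ} {d : ℝ}
    (h : HasDerivAt (fun s => F (s, w.2)) d w.1) : fderiv ℝ F w ex = d :=
  (hasDerivAt_slice_fst (hF (w.1, w.2))).unique h

theorem fderiv_ey_of_slice {F : ℝ × ℝ → ℝ} (hF : Differentiable ℝ F) {w : ℝ × ℝ} {d : ℝ}
    (h : HasDerivAt (fun s => F (w.1, s)) d w.2) : fderiv ℝ F w ey = d :=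
  (hasDerivAt_slice_snd (hF (w.1, w.2))).unique h

theorem hasDerivAt_arg_fst (a x y : ℝ) :
    HasDerivAt (fun s : ℝ => 1 - a * sqn (s, y)) (-(2 * a * x)) x := by
  have := ((((hasDerivAt_id x).pow 2).add_const (y ^ 2)).const_mul a).const_sub 1
  refine this.congr_deriv ?_
  simp; ring

theorem hasDerivAt_arg_snd (a x y : ℝ) :
    HasDerivAt (fun s : ℝ => 1 - a * sqn (x, s)) (-(2 * a * y)) y := by
  have := ((((hasDerivAt_id y).pow 2).const_add (x ^ 2)).const_mul a).const_sub 1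
  refine this.congr_deriv ?_
  simp; ring

theorem fderiv_ker₀_ex (a : ℝ) : (fun w => fderiv ℝ (ker₀ a) w ex) =
    fun w => -(2 * a * w.1) * glueDeriv (1 - a * sqn w) := by
  funext w
  refine fderiv_ex_of_slice ((contDiff_ker₀ a).differentiable (by simp)) ?_
  refine ((hasDerivAt_glue _).comp w.1 (hasDerivAt_arg_fst a w.1 w.2)).congr_deriv ?_
  ring

theorem fderiv_ker₀_ey (a : ℝ) : (fun w => fderiv ℝ (ker₀ a) w ey) =
    fun w => -(2 * a * w.2) * glueDeriv (1 - a * sqn w) := by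
  funext w
  refine fderiv_ey_of_slice ((contDiff_ker₀ a).differentiable (by simp)) ?_
  refine ((hasDerivAt_glue _).comp w.2 (hasDerivAt_arg_snd a w.1 w.2)).congr_deriv ?_
  ring

theorem laplacian_ker₀ (a : ℝ) (w : ℝ × ℝ) :
    fderiv ℝ (fun w => fderiv ℝ (ker₀ a) w ex) w ex +
      fderiv ℝ (fun w => fderiv ℝ (ker₀ a) w ey) w ey = ker₂ a w := by
  have hg := contDiff_glueDeriv_sqn a
  have h1 : fderiv ℝ (fun w : ℝ × ℝ => -(2 * a * w.1) * glueDeriv (1 - a * sqn w)) w ex =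
      -(2 * a) * glueDeriv (1 - a * sqn w) +
        -(2 * a * w.1) * (glueDeriv₂ (1 - a * sqn w) * -(2 * a * w.1)) := by
    have hd : Differentiable ℝ fun w : ℝ × ℝ => -(2 * a * w.1) * glueDeriv (1 - a * sqn w) :=
      ((by fun_prop : ContDiff ℝ (⊤ : ℕ∞) fun w : ℝ × ℝ => -(2 * a * w.1)).mul
        hg).differentiable (by simp)
    refine fderiv_ex_of_slice hd ?_
    have a1 : HasDerivAt (fun s : ℝ => -(2 * a * s)) (-(2 * a)) w.1 := by
      exact ((hasDerivAt_id w.1).const_mul (2 * a)).neg.congr_deriv (by simp)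
    exact a1.mul ((hasDerivAt_glueDeriv _).comp w.1 (hasDerivAt_arg_fst a w.1 w.2))
  have h2 : fderiv ℝ (fun w : ℝ × ℝ => -(2 * a * w.2) * glueDeriv (1 - a * sqn w)) w ey =
      -(2 * a) * glueDeriv (1 - a * sqn w) +
        -(2 * a * w.2) * (glueDeriv₂ (1 - a * sqn w) * -(2 * a * w.2)) := by
    have hd : Differentiable ℝ fun w : ℝ × ℝ => -(2 * a * w.2) * glueDeriv (1 - a * sqn w) :=
      ((by fun_prop : ContDiff ℝ (⊤ : ℕ∞) fun w : ℝ × ℝ => -(2 * a * w.2)).mul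
        hg).differentiable (by simp)
    refine fderiv_ey_of_slice hd ?_
    have a1 : HasDerivAt (fun s : ℝ => -(2 * a * s)) (-(2 * a)) w.2 := by
      exact ((hasDerivAt_id w.2).const_mul (2 * a)).neg.congr_deriv (by simp)
    exact a1.mul ((hasDerivAt_glueDeriv _).comp w.2 (hasDerivAt_arg_snd a w.1 w.2))
  rw [fderiv_ker₀_ex, fderiv_ker₀_ey, h1, h2, ker₂]
  have : sqn w = w.1 ^ 2 + w.2 ^ 2 := rfl
  rw [this]; ring

/-- Smooth analogue of the formula for the derivative of spherical means in the radius: changing the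
scale of the averaging kernel amounts to adding a Laplacian. -/
theorem hasDerivAt_ker₁ {a : ℝ} (ha : a ≠ 0) (w : ℝ × ℝ) :
    HasDerivAt (fun a => ker₁ a w) (-(1 / (2 * a)) * ker₂ a w) a := by
  have h1 : HasDerivAt (fun a : ℝ => 1 - a * sqn w) (-sqn w) a := by
    simpa using ((hasDerivAt_id a).mul_const (sqn w)).const_sub 1
  have h2 : HasDerivAt (fun a : ℝ => 2 * a) 2 a := by
    simpa using (hasDerivAt_id a).const_mul 2
  refine (h2.mul ((hasDerivAt_glueDeriv _).comp a h1)).congr_deriv ?_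
  rw [ker₂]
  field_simp
  simp only [Function.comp_apply]
  ring_nf

theorem isCompact_sqn_le {a : ℝ} (ha : 0 < a) : IsCompact {w | a * sqn w ≤ 1} := by
  refine (isCompact_closedBall (0 : ℝ × ℝ) (√(1 / a))).of_isClosed_subset
    (isClosed_le (continuous_const.mul contDiff_sqn.continuous) continuous_const) fun w hw => ?_
  have hw' : w.1 ^ 2 + w.2 ^ 2 ≤ 1 / a := by
    rw [le_div_iff₀ ha, mul_comm]; exact hw
  rw [mem_closedBall_zero_iff, Prod.norm_def, Real.norm_eq_abs, Real.norm_eq_abs]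
  exact max_le (Real.abs_le_sqrt (by nlinarith)) (Real.abs_le_sqrt (by nlinarith))

theorem hasCompactSupport_of_sqn {K : ℝ × ℝ → ℝ} {a : ℝ} (ha : 0 < a)
    (h : ∀ w, 1 ≤ a * sqn w → K w = 0) : HasCompactSupport K :=
  HasCompactSupport.intro (isCompact_sqn_le ha) fun w hw => h w (not_le.1 hw).le

/-- The argument of the profile is at most 1, and a · `sqn` w is below 1 where the kernels live, so
only the power of a in front remains. -/
theorem exists_ker_bound : ∃ B, 0 < B ∧ ∀ a, 0 < a → ∀ w, |ker₀ a w| ≤ B ∧ |ker₁ a w| ≤ B * a ∧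
    |ker₂ a w| ≤ B * a := by
  obtain ⟨B, hB, h⟩ := exists_glue_bound
  refine ⟨8 * B, by positivity, fun a ha w => ?_⟩
  have hs : 0 ≤ a * sqn w := mul_nonneg ha.le (sqn_nonneg w)
  obtain ⟨h1, h2, h3⟩ := h (1 - a * sqn w) (by linarith)
  refine ⟨h1.trans (by linarith), ?_, ?_⟩
  · rw [ker₁, abs_mul, abs_of_pos (by positivity : 0 < 2 * a)]
    nlinarith
  · by_cases hc : 1 ≤ a * sqn w
    · rw [ker₂_eq_zero hc, abs_zero]; positivity
    · have e : ker₂ a w = 4 * a * (a * sqn w * glueDeriv₂ (1 - a * sqn w) -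
          glueDeriv (1 - a * sqn w)) := by rw [ker₂]; ring
      rw [e, abs_mul, abs_of_pos (by positivity : 0 < 4 * a)]
      have h4 : |a * sqn w * glueDeriv₂ (1 - a * sqn w)| ≤ 1 * B := by
        rw [abs_mul, abs_of_nonneg hs]
        exact mul_le_mul (not_le.1 hc).le h3 (abs_nonneg _) zero_le_one
      have h5 := abs_sub (a * sqn w * glueDeriv₂ (1 - a * sqn w)) (glueDeriv (1 - a * sqn w))
      calc _ ≤ 4 * a * (2 * B) := by gcongr; linarith
        _ = _ := by ring

end Kernel

section Fold

/-- Sum of a kernel over a point and its reflections through the two sides of the strip. -/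
def fold (L : ℝ) (K : ℝ × ℝ → ℝ) (z₀ z : ℝ × ℝ) : ℝ :=
  K (z - z₀) + K (z - (z₀.1, -z₀.2)) + K (z - (z₀.1, 2 * L - z₀.2))

theorem contDiff_fold {n : WithTop ℕ∞} {K : ℝ × ℝ → ℝ} (hK : ContDiff ℝ n K) (z₀ : ℝ × ℝ) :
    ContDiff ℝ n (fold L K z₀) :=
  ((hK.comp (contDiff_id.sub contDiff_const)).add (hK.comp (contDiff_id.sub contDiff_const))).add
    (hK.comp (contDiff_id.sub contDiff_const))

theorem continuous_fold {K : ℝ × ℝ → ℝ} (hK : Continuous K) (z₀ : ℝ × ℝ) :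
    Continuous (fold L K z₀) :=
  ((hK.comp (by fun_prop)).add (hK.comp (by fun_prop))).add (hK.comp (by fun_prop))

theorem hasCompactSupport_fold {K : ℝ × ℝ → ℝ} (hK : HasCompactSupport K) (z₀ : ℝ × ℝ) :
    HasCompactSupport (fold L K z₀) :=
  ((hK.comp_homeomorph (Homeomorph.subRight _)).add
    (hK.comp_homeomorph (Homeomorph.subRight _))).add (hK.comp_homeomorph (Homeomorph.subRight _))

theorem fderiv_fold {K : ℝ × ℝ → ℝ} (hK : Differentiable ℝ K) (z₀ e : ℝ × ℝ) :
    (fun z => fderiv ℝ (fold L K z₀) z e) = fold L (fun w => fderiv ℝ K w e) z₀ := by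
  funext z
  have h : ∀ c, HasFDerivAt (fun z => K (z - c)) (fderiv ℝ K (z - c)) z := fun c =>
    (hK (z - c)).hasFDerivAt.comp z ((hasFDerivAt_id z).sub_const c)
  have h3 : HasFDerivAt (fold L K z₀) _ z :=
    ((h z₀).add (h (z₀.1, -z₀.2))).add (h (z₀.1, 2 * L - z₀.2))
  rw [h3.fderiv]
  rfl

/-- Reflections of a point of the strip are no closer to the strip's points than the point itself,
so on the strip the folded kernel still lives in the disc around z₀. -/
theorem sqn_le_mirror {z z₀ : ℝ × ℝ} (hz : z ∈ strip L) (hz₀ : z₀ ∈ strip L) :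
    sqn (z - z₀) ≤ sqn (z - (z₀.1, -z₀.2)) ∧ sqn (z - z₀) ≤ sqn (z - (z₀.1, 2 * L - z₀.2)) := by
  obtain ⟨-, h1, h2⟩ := hz
  obtain ⟨-, h3, h4⟩ := hz₀
  simp only [sqn, Prod.fst_sub, Prod.snd_sub]
  constructor <;> nlinarith

theorem fold_eq_zero {K : ℝ × ℝ → ℝ} {a : ℝ} (ha : 0 < a) (h : ∀ w, 1 ≤ a * sqn w → K w = 0)
    {z z₀ : ℝ × ℝ} (hz : z ∈ strip L) (hz₀ : z₀ ∈ strip L) (h1 : 1 ≤ a * sqn (z - z₀)) :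
    fold L K z₀ z = 0 := by
  obtain ⟨h2, h3⟩ := sqn_le_mirror hz hz₀
  have h2' := mul_le_mul_of_nonneg_left h2 ha.le
  have h3' := mul_le_mul_of_nonneg_left h3 ha.le
  rw [fold, h _ h1, h _ (h1.trans h2'), h _ (h1.trans h3')]
  simp

theorem abs_fold_le {K : ℝ × ℝ → ℝ} {B : ℝ} (h : ∀ w, |K w| ≤ B) (z z₀ : ℝ × ℝ) :
    |fold L K z₀ z| ≤ 3 * B := by
  have h1 := h (z - z₀)
  have h2 := h (z - (z₀.1, -z₀.2))
  have h3 := h (z - (z₀.1, 2 * L - z₀.2))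
  rw [fold]
  refine (abs_add_three _ _ _).trans ?_
  linarith

/-- On y = 0 the image through the side y = L is at distance at least L, hence beyond the kernel
radius, and the other two contributions are mirror images with opposite normal derivatives. The side
y = L is symmetric. -/
theorem neumann_fold {a : ℝ} (ha : 0 < a) (hL : 0 < L) (haL : 1 ≤ a * L ^ 2) {z₀ : ℝ × ℝ}
    (hz₀ : z₀ ∈ strip L) (x : ℝ) :
    fderiv ℝ (fold L (ker₀ a) z₀) (x, 0) ey = 0 ∧ fderiv ℝ (fold L (ker₀ a) z₀) (x, L) ey = 0 := by
  have e := fderiv_fold (L := L) ((contDiff_ker₀ a).differentiable (by simp)) z₀ ey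
  obtain ⟨-, h1, h2⟩ := hz₀
  have hz : ∀ w : ℝ × ℝ, L ^ 2 ≤ w.2 ^ 2 → -(2 * a * w.2) * glueDeriv (1 - a * sqn w) = 0 := by
    intro w hw
    have : a * L ^ 2 ≤ a * sqn w := by
      refine mul_le_mul_of_nonneg_left ?_ ha.le
      simp only [sqn]; nlinarith
    rw [glueDeriv_of_nonpos (by linarith), mul_zero]
  constructor
  · rw [congrFun e (x, 0), fderiv_ker₀_ey, fold, hz ((x, 0) - (z₀.1, 2 * L - z₀.2))
      (by simp only [Prod.snd_sub]; nlinarith)]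
    simp only [sqn, Prod.fst_sub, Prod.snd_sub, zero_sub, neg_neg, neg_sq]
    ring
  · rw [congrFun e (x, L), fderiv_ker₀_ey, fold, hz ((x, L) - (z₀.1, -z₀.2))
      (by simp only [Prod.snd_sub]; nlinarith)]
    have e1 : L - (2 * L - z₀.2) = -(L - z₀.2) := by ring
    simp only [sqn, Prod.fst_sub, Prod.snd_sub, e1, neg_sq]
    ring

theorem laplacian_fold (a : ℝ) (z₀ z : ℝ × ℝ) :
    fderiv ℝ (fun z => fderiv ℝ (fold L (ker₀ a) z₀) z ex) z ex +
      fderiv ℝ (fun z => fderiv ℝ (fold L (ker₀ a) z₀) z ey) z ey = fold L (ker₂ a) z₀ z := by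
  have hd : Differentiable ℝ (ker₀ a) := (contDiff_ker₀ a).differentiable (by simp)
  have hd' : ∀ e, Differentiable ℝ fun w => fderiv ℝ (ker₀ a) w e := fun e =>
    (((contDiff_ker₀ a).fderiv_right (m := (⊤ : ℕ∞)) (by simp)).clm_apply
      contDiff_const).differentiable (by simp)
  rw [fderiv_fold hd, fderiv_fold hd, congrFun (fderiv_fold (hd' ex) z₀ ex) z,
    congrFun (fderiv_fold (hd' ey) z₀ ey) z]
  simp only [fold, ← laplacian_ker₀]
  ring

end Fold

end DeltaStrip

/-! ### Mean values of nonnegative solutions and their convergence. -/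

namespace DeltaStrip

variable {L : ℝ}

section MeanValue

/-- The properties of a nonnegative solution, with trace `t`, that its mean values involve. -/
structure IsNonnegSol (L ω γ r : ℝ) (f : ℝ × ℝ → ℝ) (t : ℝ → ℝ) : Prop where
  nonneg : ∀ z, 0 ≤ f z
  trace_nonneg : ∀ y, 0 ≤ t y
  memLp : MemLp f 2 (stripMeasure L)
  memLp_trace : MemLp t 2 (sectionMeasure L)
  memLp_rpow : MemLp (fun z => |f z| ^ (r - 2) * f z) 2 (stripMeasure L)
  eq_laplacian : ∀ a, 0 < a → 1 ≤ a * L ^ 2 → ∀ z₀ ∈ strip L,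
    ∫ z, f z * fold L (ker₂ a) z₀ z ∂(stripMeasure L) =
      ω * (∫ z, f z * fold L (ker₀ a) z₀ z ∂(stripMeasure L))
        + γ * (∫ y, t y * fold L (ker₀ a) z₀ (0, y) ∂(sectionMeasure L))
        - ∫ z, |f z| ^ (r - 2) * f z * fold L (ker₀ a) z₀ z ∂(stripMeasure L)

/-- The mean value of a function around a point of the strip. -/
noncomputable def mean (L : ℝ) (f : ℝ × ℝ → ℝ) (a : ℝ) (z₀ : ℝ × ℝ) : ℝ :=
  ∫ z, f z * fold L (ker₁ a) z₀ z ∂(stripMeasure L)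

theorem memLp_fold {K : ℝ × ℝ → ℝ} (hc : Continuous K) (hs : HasCompactSupport K) (z₀ : ℝ × ℝ) :
    MemLp (fold L K z₀) 2 (stripMeasure L) :=
  (continuous_fold hc z₀).memLp_of_hasCompactSupport (hasCompactSupport_fold hs z₀)

theorem ae_mem_strip : ∀ᵐ z ∂(stripMeasure L), z ∈ strip L := ae_restrict_mem measurableSet_strip'

theorem integrable_mul_fold {f : ℝ × ℝ → ℝ} (hf : MemLp f 2 (stripMeasure L)) {K : ℝ × ℝ → ℝ}
    (hc : Continuous K) (hs : HasCompactSupport K) (z₀ : ℝ × ℝ) :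
    Integrable (fun z => f z * fold L K z₀ z) (stripMeasure L) :=
  hf.integrable_mul (memLp_fold hc hs z₀)

theorem hasCompactSupport_ker₀ {a : ℝ} (ha : 0 < a) : HasCompactSupport (ker₀ a) :=
  hasCompactSupport_of_sqn ha fun _ => ker₀_eq_zero

theorem hasCompactSupport_ker₁ {a : ℝ} (ha : 0 < a) : HasCompactSupport (ker₁ a) :=
  hasCompactSupport_of_sqn ha fun _ => ker₁_eq_zero

theorem isCompact_sqn_sub_le {a : ℝ} (ha : 0 < a) (z₀ : ℝ × ℝ) :
    IsCompact {z | a * sqn (z - z₀) ≤ 1} :=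
  (Homeomorph.subRight z₀).isCompact_preimage.2 (isCompact_sqn_le ha)

/-- Through `hasDerivAt_ker₁` the derivative of the mean in a becomes an integral against the
Laplacian of `ker₀`, which the equation evaluates. -/
theorem hasDerivAt_mean {f : ℝ × ℝ → ℝ} (hf : MemLp f 2 (stripMeasure L)) {a : ℝ} (ha : 0 < a)
    {z₀ : ℝ × ℝ} (hz₀ : z₀ ∈ strip L) :
    HasDerivAt (fun a => mean L f a z₀)
      (-(1 / (2 * a)) * ∫ z, f z * fold L (ker₂ a) z₀ z ∂(stripMeasure L)) a := by
  obtain ⟨B, hB, hker⟩ := exists_ker_bound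
  -- For parameters b > a/2 the folded kernel vanishes on the strip outside this disc, and its
  -- bound, proportional to b, cancels the factor 1/(2b). This gives a majorant independent of b.
  set D : Set (ℝ × ℝ) := {z | a / 2 * sqn (z - z₀) ≤ 1} with hD
  have hDc : IsCompact D := isCompact_sqn_sub_le (half_pos ha) z₀
  have hball : ∀ b ∈ Metric.ball a (a / 2), a / 2 < b := fun b hb => by
    rw [Metric.mem_ball, Real.dist_eq] at hb
    linarith [(abs_lt.1 hb).1]
  have key := hasDerivAt_integral_of_dominated_loc_of_deriv_le (μ := stripMeasure L)
    (F := fun a z => f z * fold L (ker₁ a) z₀ z)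
    (F' := fun a z => f z * (-(1 / (2 * a)) * fold L (ker₂ a) z₀ z)) (x₀ := a)
    (s := Metric.ball a (a / 2)) (bound := fun z => 3 * B / 2 * D.indicator (fun z => ‖f z‖) z)
    (Metric.ball_mem_nhds a (half_pos ha))
    (Eventually.of_forall fun b =>
      hf.1.mul (continuous_fold (contDiff_ker₁ b).continuous z₀).aestronglyMeasurable)
    (integrable_mul_fold hf (contDiff_ker₁ a).continuous (hasCompactSupport_ker₁ ha) z₀)
    (hf.1.mul ((continuous_fold (continuous_ker₂ a) z₀).aestronglyMeasurable.const_mul _))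
    (by
      filter_upwards [ae_mem_strip] with z hz b hb
      have hb' := hball b hb
      have hb0 : 0 < b := by linarith
      rw [norm_mul, norm_mul, norm_neg, Real.norm_of_nonneg (by positivity : 0 ≤ 1 / (2 * b))]
      by_cases hzD : z ∈ D
      · rw [Set.indicator_of_mem hzD]
        have := abs_fold_le (L := L) (fun w => (hker b hb0 w).2.2) z z₀
        calc ‖f z‖ * (1 / (2 * b) * ‖fold L (ker₂ b) z₀ z‖)
            ≤ ‖f z‖ * (1 / (2 * b) * (3 * (B * b))) := by
              gcongr
              exact this
          _ = _ := by field_simp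
      · rw [Set.indicator_of_notMem hzD, fold_eq_zero hb0 (fun _ => ker₂_eq_zero) hz hz₀]
        · simp
        · rw [hD, Set.mem_ofPred_eq, not_le] at hzD
          refine hzD.le.trans (mul_le_mul_of_nonneg_right hb'.le (sqn_nonneg _)))
    ((IntegrableOn.integrable_indicator (f := fun z => ‖f z‖)
      ((hf.locallyIntegrable one_le_two).integrableOn_isCompact hDc).norm
      hDc.measurableSet).const_mul _)
    (Eventually.of_forall fun z b hb => by
      have hb0 : b ≠ 0 := by linarith [hball b hb]
      have h := ((hasDerivAt_ker₁ hb0 (z - z₀)).add (hasDerivAt_ker₁ hb0 (z - (z₀.1, -z₀.2)))).add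
        (hasDerivAt_ker₁ hb0 (z - (z₀.1, 2 * L - z₀.2)))
      refine (h.congr_deriv ?_).const_mul (f z)
      rw [fold]; ring)
  refine key.2.congr_deriv ?_
  rw [← integral_const_mul]
  refine integral_congr_ae (Eventually.of_forall fun z => ?_)
  ring

theorem sq_integral_mul_le {α : Type*} [MeasurableSpace α] {μ : Measure α} {g k : α → ℝ}
    (hg : MemLp g 2 μ) (hk : MemLp k 2 μ) {s : Set α} (hs : MeasurableSet s) (hμ : μ s ≠ ⊤)
    {b m : ℝ} (hm : μ.real s ≤ m) (hb : ∀ᵐ z ∂μ, |k z| ≤ s.indicator (fun _ => b) z) :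
    (∫ z, g z * k z ∂μ) ^ 2 ≤ (∫ z, g z ^ 2 ∂μ) * (b ^ 2 * m) := by
  have ig := (memLp_two_iff_integrable_sq hg.1).1 hg
  have ik := (memLp_two_iff_integrable_sq hk.1).1 hk
  refine (integral_mul_sq_le ig ik (hg.integrable_mul hk)).trans ?_
  refine mul_le_mul_of_nonneg_left ?_ (integral_nonneg fun z => sq_nonneg _)
  calc ∫ z, k z ^ 2 ∂μ ≤ ∫ z, s.indicator (fun _ => b ^ 2) z ∂μ := by
        refine integral_mono_ae ik ((integrableOn_const (C := b ^ 2) hμ).integrable_indicator hs) ?_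
        filter_upwards [hb] with z hz
        rw [← sq_abs]
        refine (pow_le_pow_left₀ (abs_nonneg _) hz 2).trans (le_of_eq ?_)
        by_cases h : z ∈ s <;> simp [h]
    _ = b ^ 2 * μ.real s := by rw [integral_indicator hs, setIntegral_const, smul_eq_mul, mul_comm]
    _ ≤ _ := by gcongr

theorem volume_real_closedBall (z : ℝ × ℝ) {δ : ℝ} (hδ : 0 ≤ δ) :
    (volume : Measure (ℝ × ℝ)).real (Metric.closedBall z δ) = 4 * δ ^ 2 := by
  obtain ⟨x, y⟩ := z
  rw [← closedBall_prod_same, Measure.volume_eq_prod, measureReal_prod_prod, Measure.real,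
    Measure.real, Real.volume_closedBall, Real.volume_closedBall,
    ENNReal.toReal_ofReal (by positivity)]
  ring

/-- The open disc that contains the support of the kernels. -/
def disc (a : ℝ) (z₀ : ℝ × ℝ) : Set (ℝ × ℝ) := {z | a * sqn (z - z₀) < 1}

theorem isOpen_disc (a : ℝ) (z₀ : ℝ × ℝ) : IsOpen (disc a z₀) :=
  isOpen_lt (continuous_const.mul (contDiff_sqn.continuous.comp (by fun_prop))) continuous_const

theorem disc_subset {a : ℝ} (ha : 0 < a) (z₀ : ℝ × ℝ) :
    disc a z₀ ⊆ Metric.closedBall z₀ (√(1 / a)) := by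
  intro z hz
  have hz' : (z - z₀).1 ^ 2 + (z - z₀).2 ^ 2 < 1 / a := by
    rw [lt_div_iff₀ ha, mul_comm]; exact hz
  rw [mem_closedBall_iff_norm, Prod.norm_def, Real.norm_eq_abs, Real.norm_eq_abs]
  exact max_le (Real.abs_le_sqrt (by nlinarith)) (Real.abs_le_sqrt (by nlinarith))

theorem stripMeasure_disc_le {a : ℝ} (ha : 0 < a) (z₀ : ℝ × ℝ) :
    stripMeasure L (disc a z₀) ≠ ⊤ ∧ (stripMeasure L).real (disc a z₀) ≤ 4 / a := by
  have h1 : stripMeasure L (disc a z₀) ≤ volume (Metric.closedBall z₀ (√(1 / a))) :=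
    (Measure.restrict_apply_le _ _).trans (measure_mono (disc_subset ha z₀))
  have h2 : volume (Metric.closedBall z₀ (√(1 / a))) ≠ ⊤ :=
    (isCompact_closedBall _ _).measure_lt_top.ne
  refine ⟨ne_top_of_le_ne_top h2 h1, ?_⟩
  have := ENNReal.toReal_mono h2 h1
  have e := volume_real_closedBall z₀ (Real.sqrt_nonneg (1 / a))
  rw [Real.sq_sqrt (by positivity)] at e
  calc _ ≤ 4 * (1 / a) := by rw [← e]; exact this
    _ = 4 / a := by ring

theorem sectionMeasure_disc_le {a : ℝ} (ha : 0 < a) (z₀ : ℝ × ℝ) :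
    (sectionMeasure L).real {y | (0, y) ∈ disc a z₀} ≤ 2 * √(1 / a) := by
  have h1 : sectionMeasure L {y | (0, y) ∈ disc a z₀} ≤
      volume (Metric.closedBall z₀.2 (√(1 / a))) := by
    refine (Measure.restrict_apply_le _ _).trans (measure_mono fun y hy => ?_)
    have := disc_subset ha z₀ hy
    rw [Metric.mem_closedBall, Prod.dist_eq] at this
    exact (le_max_right _ _).trans this
  have := ENNReal.toReal_mono measure_closedBall_lt_top.ne h1
  rwa [Real.volume_closedBall, ENNReal.toReal_ofReal (by positivity)] at this

theorem abs_fold_le_indicator {K : ℝ × ℝ → ℝ} {a B : ℝ} (ha : 0 < a) (hB : ∀ w, |K w| ≤ B)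
    (h : ∀ w, 1 ≤ a * sqn w → K w = 0) {z z₀ : ℝ × ℝ} (hz : z ∈ strip L) (hz₀ : z₀ ∈ strip L) :
    |fold L K z₀ z| ≤ (disc a z₀).indicator (fun _ => 3 * B) z := by
  by_cases hd : z ∈ disc a z₀
  · rw [Set.indicator_of_mem hd]
    exact abs_fold_le hB z z₀
  · rw [Set.indicator_of_notMem hd, fold_eq_zero ha h hz hz₀ (not_lt.1 hd), abs_zero]

theorem abs_le_of_sq_le {x X a : ℝ} (ha : 0 < a) (h : x ^ 2 ≤ X * √(1 / a)) :
    |x| ≤ √X * a ^ (-(1 / 4) : ℝ) := by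
  have e : √(√(1 / a)) = a ^ (-(1 / 4) : ℝ) := by
    rw [Real.sqrt_eq_rpow, Real.sqrt_eq_rpow, ← Real.rpow_mul (by positivity), one_div,
      Real.inv_rpow ha.le, ← Real.rpow_neg ha.le]
    norm_num
  rw [← e, ← Real.sqrt_mul' _ (Real.sqrt_nonneg _)]
  exact Real.abs_le_sqrt h

/-- The bound on M' is minus the derivative of 4 C a^(-1/4), so adding this function to M gives a
nonincreasing function and subtracting it a nondecreasing one; M is Cauchy with an explicit rate. -/
theorem exists_limit_of_deriv_le {M M' : ℝ → ℝ} {a₀ C : ℝ} (h0 : 0 < a₀)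
    (hd : ∀ a, a₀ ≤ a → HasDerivAt M (M' a) a)
    (hb : ∀ a, a₀ ≤ a → |M' a| ≤ C * a ^ (-(1 / 4) - 1 : ℝ)) :
    ∃ l, ∀ a, a₀ ≤ a → |M a - l| ≤ 4 * C * a ^ (-(1 / 4) : ℝ) := by
  have hs : ∀ a, a₀ ≤ a → HasDerivAt (fun a : ℝ => 4 * C * a ^ (-(1 / 4) : ℝ))
      (-(C * a ^ (-(1 / 4) - 1 : ℝ))) a := fun a ha => by
    refine ((Real.hasDerivAt_rpow_const (Or.inl (h0.trans_le ha).ne')).const_mul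
      (4 * C)).congr_deriv ?_
    ring
  have anti : AntitoneOn (fun a => M a + 4 * C * a ^ (-(1 / 4) : ℝ)) (Set.Ici a₀) := by
    have h : ∀ a, a₀ ≤ a → HasDerivAt (fun a => M a + 4 * C * a ^ (-(1 / 4) : ℝ)) _ a :=
      fun a ha => (hd a ha).add (hs a ha)
    refine antitoneOn_of_deriv_nonpos (convex_Ici _)
      (fun a ha => (h a ha).continuousAt.continuousWithinAt) (fun a ha => ?_) fun a ha => ?_
    · rw [interior_Ici] at ha
      exact (h a (le_of_lt ha)).differentiableAt.differentiableWithinAt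
    · rw [interior_Ici] at ha
      rw [(h a (le_of_lt ha)).deriv]
      linarith [(abs_le.1 (hb a (le_of_lt ha))).2]
  have mono : MonotoneOn (fun a => M a - 4 * C * a ^ (-(1 / 4) : ℝ)) (Set.Ici a₀) := by
    have h : ∀ a, a₀ ≤ a → HasDerivAt (fun a => M a - 4 * C * a ^ (-(1 / 4) : ℝ)) _ a :=
      fun a ha => (hd a ha).sub (hs a ha)
    refine monotoneOn_of_deriv_nonneg (convex_Ici _)
      (fun a ha => (h a ha).continuousAt.continuousWithinAt) (fun a ha => ?_) fun a ha => ?_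
    · rw [interior_Ici] at ha
      exact (h a (le_of_lt ha)).differentiableAt.differentiableWithinAt
    · rw [interior_Ici] at ha
      rw [(h a (le_of_lt ha)).deriv]
      linarith [(abs_le.1 (hb a (le_of_lt ha))).1]
  have hC : 0 ≤ C := by
    have h1 := (abs_nonneg _).trans (hb a₀ le_rfl)
    have h2 : 0 < a₀ ^ (-(1 / 4) - 1 : ℝ) := Real.rpow_pos_of_pos h0 _
    exact nonneg_of_mul_nonneg_left h1 h2
  have hdist : ∀ a b, a₀ ≤ a → a ≤ b → |M a - M b| ≤ 4 * C * a ^ (-(1 / 4) : ℝ) := by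
    intro a b ha hab
    have h1 := anti ha (ha.trans hab) hab
    have h2 := mono ha (ha.trans hab) hab
    have h3 : 0 ≤ 4 * C * b ^ (-(1 / 4) : ℝ) :=
      mul_nonneg (by linarith) (Real.rpow_nonneg (h0.le.trans (ha.trans hab)) _)
    dsimp only at h1 h2
    rw [abs_le]
    constructor <;> linarith
  have ht : Tendsto (fun n : ℕ => a₀ + n) atTop atTop :=
    tendsto_atTop_add_const_left _ _ tendsto_natCast_atTop_atTop
  have hlim0 : Tendsto (fun n : ℕ => 4 * C * (a₀ + n) ^ (-(1 / 4) : ℝ)) atTop (𝓝 0) := by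
    have := ((tendsto_rpow_neg_atTop (show (0 : ℝ) < 1 / 4 by norm_num)).comp ht).const_mul (4 * C)
    rwa [mul_zero] at this
  have hcau : CauchySeq fun n : ℕ => M (a₀ + n) := by
    refine cauchySeq_of_le_tendsto_0' _ (fun n m hnm => ?_) hlim0
    rw [Real.dist_eq]
    refine hdist _ _ (by linarith [Nat.cast_nonneg (α := ℝ) n]) ?_
    gcongr
  obtain ⟨l, hl⟩ := cauchySeq_tendsto_of_complete hcau
  refine ⟨l, fun a ha => ?_⟩
  refine le_of_tendsto ((hl.const_sub (M a)).abs) ?_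
  filter_upwards [ht.eventually_ge_atTop a] with n hn
  exact hdist a _ ha hn

variable {ω γ r : ℝ} {f : ℝ × ℝ → ℝ} {t : ℝ → ℝ}

/-- Cauchy–Schwarz on the support: the disc has area at most 4/a and meets the section x = 0 in
length at most 2 a^(-1/2). The section term, of order a^(-1/4), is the worst; the area terms are
weakened to this order by a L² ≥ 1. -/
theorem IsNonnegSol.exists_bound (h : IsNonnegSol L ω γ r f t) (hL : 0 < L) :
    ∃ C, ∀ a, 0 < a → 1 ≤ a * L ^ 2 → ∀ z₀ ∈ strip L,
      |∫ z, f z * fold L (ker₂ a) z₀ z ∂(stripMeasure L)| ≤ C * a ^ (-(1 / 4) : ℝ) := by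
  obtain ⟨B, hB, hker⟩ := exists_ker_bound
  have strip_le : ∀ {g : ℝ × ℝ → ℝ}, MemLp g 2 (stripMeasure L) → ∃ C, ∀ a, 0 < a → 1 ≤ a * L ^ 2 →
      ∀ z₀ ∈ strip L, |∫ z, g z * fold L (ker₀ a) z₀ z ∂(stripMeasure L)| ≤
        C * a ^ (-(1 / 4) : ℝ) := by
    intro g hg
    refine ⟨_, fun a ha haL z₀ hz₀ => abs_le_of_sq_le (X := (∫ z, g z ^ 2 ∂(stripMeasure L)) *
      ((3 * B) ^ 2 * (4 * L))) ha ?_⟩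
    refine (sq_integral_mul_le hg
      (memLp_fold (contDiff_ker₀ a).continuous (hasCompactSupport_ker₀ ha) z₀)
      (isOpen_disc a z₀).measurableSet (stripMeasure_disc_le ha z₀).1 (stripMeasure_disc_le ha z₀).2
      (b := 3 * B) ?_).trans ?_
    · filter_upwards [ae_mem_strip] with z hz
      exact abs_fold_le_indicator ha (fun w => (hker a ha w).1) (fun _ => ker₀_eq_zero) hz hz₀
    · have h1 : 1 / a ≤ L * √(1 / a) := by
        have h2 : √(1 / a) ≤ L := by
          rw [Real.sqrt_le_left hL.le, div_le_iff₀ ha]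
          linarith
        calc 1 / a = √(1 / a) * √(1 / a) := (Real.mul_self_sqrt (by positivity)).symm
          _ ≤ _ := by gcongr
      have h0 : 0 ≤ ∫ z, g z ^ 2 ∂(stripMeasure L) := integral_nonneg fun z => sq_nonneg _
      calc _ = (∫ z, g z ^ 2 ∂(stripMeasure L)) * ((3 * B) ^ 2 * (4 * (1 / a))) := by ring
        _ ≤ (∫ z, g z ^ 2 ∂(stripMeasure L)) * ((3 * B) ^ 2 * (4 * (L * √(1 / a)))) := by gcongr
        _ = _ := by ring
  obtain ⟨C₁, h1⟩ := strip_le h.memLp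
  obtain ⟨C₂, h2⟩ := strip_le h.memLp_rpow
  obtain ⟨C₃, h3⟩ : ∃ C, ∀ a, 0 < a → 1 ≤ a * L ^ 2 →
      ∀ z₀ ∈ strip L, |∫ y, t y * fold L (ker₀ a) z₀ (0, y) ∂(sectionMeasure L)| ≤
        C * a ^ (-(1 / 4) : ℝ) := by
    refine ⟨_, fun a ha haL z₀ hz₀ => abs_le_of_sq_le (X := (∫ y, t y ^ 2 ∂(sectionMeasure L)) *
      ((3 * B) ^ 2 * 2)) ha ?_⟩
    have hm : MemLp (fun y => fold L (ker₀ a) z₀ (0, y)) 2 (sectionMeasure L) := by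
      refine Continuous.memLp_of_hasCompactSupport ?_ (hasCompactSupport_slice_snd
        (hasCompactSupport_fold (hasCompactSupport_ker₀ ha) z₀) 0)
      exact (continuous_fold (contDiff_ker₀ a).continuous z₀).comp (by fun_prop)
    refine (sq_integral_mul_le h.memLp_trace hm (s := {y | (0, y) ∈ disc a z₀})
      ((isOpen_disc a z₀).preimage (by fun_prop : Continuous fun y : ℝ => ((0 : ℝ), y))).measurableSet
      (measure_ne_top _ _) (sectionMeasure_disc_le ha z₀) (b := 3 * B) ?_).trans (le_of_eq (by ring))
    refine ae_section fun y hy => ?_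
    exact abs_fold_le_indicator ha (fun w => (hker a ha w).1) (fun _ => ker₀_eq_zero)
      (z := (0, y)) ⟨trivial, hy⟩ hz₀
  refine ⟨|ω| * C₁ + |γ| * C₃ + C₂, fun a ha haL z₀ hz₀ => ?_⟩
  rw [h.eq_laplacian a ha haL z₀ hz₀]
  refine (abs_sub _ _).trans ((add_le_add_left (abs_add_le _ _) _).trans ?_)
  rw [abs_mul, abs_mul, add_mul, add_mul, mul_assoc, mul_assoc]
  gcongr
  · exact h1 a ha haL z₀ hz₀
  · exact h3 a ha haL z₀ hz₀
  · exact h2 a ha haL z₀ hz₀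

/-- The mean values converge, uniformly on the strip. -/
theorem IsNonnegSol.exists_limit (h : IsNonnegSol L ω γ r f t) (hL : 0 < L) :
    ∃ (C : ℝ) (l : ℝ × ℝ → ℝ), ∀ z₀ ∈ strip L, ∀ a, 1 / L ^ 2 ≤ a →
      |mean L f a z₀ - l z₀| ≤ C * a ^ (-(1 / 4) : ℝ) := by
  obtain ⟨C, hC⟩ := h.exists_bound hL
  have hpos : 0 < 1 / L ^ 2 := by positivity
  have key : ∀ z₀ ∈ strip L, ∃ l, ∀ a, 1 / L ^ 2 ≤ a →
      |mean L f a z₀ - l| ≤ 4 * (C / 2) * a ^ (-(1 / 4) : ℝ) := by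
    intro z₀ hz₀
    refine exists_limit_of_deriv_le hpos
      (fun a ha => hasDerivAt_mean h.memLp (hpos.trans_le ha) hz₀) fun a ha => ?_
    have ha0 := hpos.trans_le ha
    have haL : 1 ≤ a * L ^ 2 := by rwa [div_le_iff₀ (by positivity)] at ha
    rw [abs_mul, abs_neg, abs_of_pos (by positivity : 0 < 1 / (2 * a)), Real.rpow_sub ha0,
      Real.rpow_one]
    calc _ ≤ 1 / (2 * a) * (C * a ^ (-(1 / 4) : ℝ)) := by
          gcongr
          exact hC a ha0 haL z₀ hz₀
      _ = _ := by field_simp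
  choose! l hl using key
  exact ⟨_, l, hl⟩

end MeanValue

end DeltaStrip

/-! ### Continuity of the limit of the means and Lebesgue points. -/

namespace DeltaStrip

variable {L ω γ r : ℝ} {f : ℝ × ℝ → ℝ} {t : ℝ → ℝ}

section Continuity

theorem sqn_neg (w : ℝ × ℝ) : sqn (-w) = sqn w := by simp [sqn]

theorem ker₁_sub_comm (a : ℝ) (z w : ℝ × ℝ) : ker₁ a (z - w) = ker₁ a (w - z) := by
  rw [ker₁, ker₁, ← sqn_neg, neg_sub]

theorem ker₁_nonneg {a : ℝ} (ha : 0 < a) (w : ℝ × ℝ) : 0 ≤ ker₁ a w :=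
  mul_nonneg (by positivity) (glueDeriv_nonneg _)

theorem continuous_mean (hf : MemLp f 2 (stripMeasure L)) {a : ℝ} (ha : 0 < a) :
    Continuous (mean L f a) := by
  have hc := (contDiff_ker₁ a).continuous
  have hs := hasCompactSupport_ker₁ ha
  have hm : MemLp (fun z => (f z : ℂ)) 2 (stripMeasure L) := hf.ofReal
  have h1 : Continuous fun c => ∫ z, f z * ker₁ a (z - c) ∂(stripMeasure L) := by
    have h2 := Complex.continuous_re.comp (contDiff_moll (contDiff_ker₁ a) hs hm).continuous
    refine h2.congr fun c => ?_
    have e : ∀ w, ker₁ a (c - w) • (f w : ℂ) = ((f w * ker₁ a (w - c) : ℝ) : ℂ) := fun w => by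
      rw [ker₁_sub_comm, Complex.real_smul, ← Complex.ofReal_mul, mul_comm]
    rw [Function.comp_apply, moll]
    simp only [e]
    rw [integral_complex_ofReal, Complex.ofReal_re]
  have hi : ∀ c, Integrable (fun z => f z * ker₁ a (z - c)) (stripMeasure L) := fun c =>
    hf.integrable_mul ((hc.comp
      (by fun_prop : Continuous fun z : ℝ × ℝ => z - c)).memLp_of_hasCompactSupport (p := 2)
      (hs.comp_homeomorph (Homeomorph.subRight c)))
  have e : mean L f a = fun z₀ => (∫ z, f z * ker₁ a (z - z₀) ∂(stripMeasure L)) +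
      (∫ z, f z * ker₁ a (z - (z₀.1, -z₀.2)) ∂(stripMeasure L)) +
      ∫ z, f z * ker₁ a (z - (z₀.1, 2 * L - z₀.2)) ∂(stripMeasure L) := by
    funext z₀
    have e1 := integral_add (hi z₀) (hi (z₀.1, -z₀.2))
    have i12 : Integrable (fun z => f z * ker₁ a (z - z₀) + f z * ker₁ a (z - (z₀.1, -z₀.2)))
      (stripMeasure L) := (hi z₀).add (hi (z₀.1, -z₀.2))
    rw [← e1, ← integral_add i12 (hi (z₀.1, 2 * L - z₀.2)), mean]
    simp only [fold, mul_add]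
  rw [e]
  exact (h1.add (h1.comp (by fun_prop : Continuous fun z₀ : ℝ × ℝ => (z₀.1, -z₀.2)))).add
    (h1.comp (by fun_prop : Continuous fun z₀ : ℝ × ℝ => (z₀.1, 2 * L - z₀.2)))

theorem tendsto_rpow_bound (C : ℝ) :
    Tendsto (fun a : ℝ => C * a ^ (-(1 / 4) : ℝ)) atTop (𝓝 0) := by
  have := (tendsto_rpow_neg_atTop (show (0 : ℝ) < 1 / 4 by norm_num)).const_mul C
  rwa [mul_zero] at this

theorem continuousOn_limit (hf : MemLp f 2 (stripMeasure L)) {C : ℝ}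
    {l : ℝ × ℝ → ℝ} (hl : ∀ z₀ ∈ strip L, ∀ a, 1 / L ^ 2 ≤ a →
      |mean L f a z₀ - l z₀| ≤ C * a ^ (-(1 / 4) : ℝ)) : ContinuousOn l (strip L) := by
  have hu : TendstoUniformlyOn (mean L f) l atTop (strip L) := by
    rw [Metric.tendstoUniformlyOn_iff]
    intro ε hε
    filter_upwards [(tendsto_rpow_bound C).eventually_lt_const hε,
      eventually_ge_atTop (1 / L ^ 2)] with a h1 h2 z hz
    rw [dist_comm, Real.dist_eq]
    exact (hl z hz a h2).trans_lt h1
  refine hu.continuousOn (Eventually.frequently ?_)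
  filter_upwards [eventually_gt_atTop 0] with a ha
  exact (continuous_mean hf ha).continuousOn

theorem tendsto_mean {C : ℝ} {l : ℝ × ℝ → ℝ} (hl : ∀ z₀ ∈ strip L, ∀ a, 1 / L ^ 2 ≤ a →
      |mean L f a z₀ - l z₀| ≤ C * a ^ (-(1 / 4) : ℝ)) {z₀ : ℝ × ℝ} (hz₀ : z₀ ∈ strip L) :
    Tendsto (fun a => mean L f a z₀) atTop (𝓝 (l z₀)) := by
  rw [tendsto_iff_norm_sub_tendsto_zero]
  refine squeeze_zero' (Eventually.of_forall fun _ => norm_nonneg _) ?_ (tendsto_rpow_bound C)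
  filter_upwards [eventually_ge_atTop (1 / L ^ 2)] with a ha
  exact hl z₀ hz₀ a ha

end Continuity

section Lebesgue

theorem ker₁_eq_scale {a : ℝ} (ha : 0 < a) (w : ℝ × ℝ) : ker₁ a w = a * ker₁ 1 (√a • w) := by
  have : sqn (√a • w) = a * sqn w := by
    simp only [sqn, Prod.smul_fst, Prod.smul_snd, smul_eq_mul, mul_pow, Real.sq_sqrt ha.le]
    ring
  rw [ker₁, ker₁, this]; ring_nf

theorem integral_ker₁ {a : ℝ} (ha : 0 < a) : ∫ w, ker₁ a w = ∫ w, ker₁ 1 w := by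
  simp only [ker₁_eq_scale ha]
  rw [integral_const_mul, Measure.integral_comp_smul volume (ker₁ 1)]
  simp [Real.sq_sqrt ha.le, abs_of_pos ha]
  field_simp

theorem integral_ker₁_pos : 0 < ∫ w, ker₁ 1 w := by
  refine (contDiff_ker₁ 1).continuous.integral_pos_of_hasCompactSupport_nonneg_nonzero
    (hasCompactSupport_ker₁ one_pos) (fun w => ker₁_nonneg one_pos w) (x := 0) ?_
  have : 0 < glueDeriv (1 - 1 * sqn (0 : ℝ × ℝ)) := glueDeriv_pos (by simp [sqn])
  exact (mul_pos (by norm_num) this).ne'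

theorem mean_eq_integral {a : ℝ} (ha : 0 < a) {x : ℝ × ℝ} (hx : x ∈ strip L)
    (h0 : 1 ≤ a * x.2 ^ 2) (h1 : 1 ≤ a * (L - x.2) ^ 2) :
    mean L f a x = ∫ z, (strip L).indicator f z * ker₁ a (z - x) := by
  have e : ∫ z, (strip L).indicator f z * ker₁ a (z - x) =
      ∫ z, f z * ker₁ a (z - x) ∂(stripMeasure L) := by
    rw [stripMeasure, ← integral_indicator measurableSet_strip']
    refine integral_congr_ae (Eventually.of_forall fun z => ?_)
    by_cases hz : z ∈ strip L <;> simp [hz]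
  rw [e, mean]
  refine integral_congr_ae ?_
  filter_upwards [ae_mem_strip] with z hz
  obtain ⟨-, hz1, hz2⟩ := hz
  obtain ⟨-, hx1, hx2⟩ := hx
  have k1 : ker₁ a (z - (x.1, -x.2)) = 0 := by
    refine ker₁_eq_zero (h0.trans (mul_le_mul_of_nonneg_left ?_ ha.le))
    simp only [sqn, Prod.fst_sub, Prod.snd_sub]
    nlinarith
  have k2 : ker₁ a (z - (x.1, 2 * L - x.2)) = 0 := by
    refine ker₁_eq_zero (h1.trans (mul_le_mul_of_nonneg_left ?_ ha.le))
    simp only [sqn, Prod.fst_sub, Prod.snd_sub]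
    nlinarith
  rw [fold, k1, k2, add_zero, add_zero]

/-- At an interior point the reflected kernels eventually leave the strip. The remaining kernel is
at most B a on a square of area 4/a, so the mean deviation is at most 4B times the average of |f -
f(x)|, which tends to zero at Lebesgue points. -/
theorem ae_eq_limit (hf : MemLp f 2 (stripMeasure L)) {l : ℝ × ℝ → ℝ}
    (hl : ∀ z₀ ∈ strip L, Tendsto (fun a => mean L f a z₀) atTop (𝓝 (l z₀))) :
    ∀ᵐ z ∂(stripMeasure L), l z = f z * ∫ w, ker₁ 1 w := by
  obtain ⟨B, hB, hker⟩ := exists_ker_bound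
  set g := (strip L).indicator f with hg
  have hgm : MemLp g 2 volume := (memLp_indicator_iff_restrict measurableSet_strip').2 hf
  have hleb := IsUnifLocDoublingMeasure.ae_tendsto_average_norm_sub (volume : Measure (ℝ × ℝ))
    (hgm.locallyIntegrable one_le_two) 1
  filter_upwards [ae_restrict_of_ae hleb, ae_mem_openStrip] with x hx hxs
  obtain ⟨hx1, hx2⟩ := hxs.2
  have hxs' := openStrip_subset hxs
  have hsq : Tendsto (fun a : ℝ => √(1 / a)) atTop (𝓝[>] 0) := by
    rw [tendsto_nhdsWithin_iff]
    constructor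
    · have h1 : Tendsto (fun a : ℝ => 1 / a) atTop (𝓝 0) := tendsto_const_nhds.div_atTop tendsto_id
      have := (Real.continuous_sqrt.tendsto 0).comp h1
      rwa [Real.sqrt_zero] at this
    · filter_upwards [eventually_gt_atTop 0] with a ha
      exact Real.sqrt_pos.2 (by positivity)
  have h1 := hx (fun _ : ℝ => x) _ hsq (Eventually.of_forall fun a => by
    rw [one_mul]
    exact Metric.mem_closedBall_self (Real.sqrt_nonneg _))
  have h2 := h1.const_mul (4 * B)
  rw [mul_zero] at h2
  refine tendsto_nhds_unique (hl x hxs') ?_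
  rw [tendsto_iff_norm_sub_tendsto_zero]
  refine squeeze_zero' (Eventually.of_forall fun _ => norm_nonneg _) ?_ h2
  have e0 : Tendsto (fun a : ℝ => a * x.2 ^ 2) atTop atTop :=
    tendsto_id.atTop_mul_const (by positivity)
  have e1 : Tendsto (fun a : ℝ => a * (L - x.2) ^ 2) atTop atTop :=
    tendsto_id.atTop_mul_const (by have : 0 < L - x.2 := by linarith
                                   positivity)
  filter_upwards [eventually_gt_atTop 0, e0.eventually_ge_atTop 1, e1.eventually_ge_atTop 1]
    with a ha ha0 ha1
  set δ := √(1 / a) with hδ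
  set k : ℝ × ℝ → ℝ := fun z => ker₁ a (z - x) with hk
  have hkc : Continuous k := (contDiff_ker₁ a).continuous.comp (by fun_prop)
  have hks : HasCompactSupport k :=
    (hasCompactSupport_ker₁ ha).comp_homeomorph (Homeomorph.subRight x)
  have i1 : Integrable (fun z => g z * k z) volume :=
    hgm.integrable_mul (hkc.memLp_of_hasCompactSupport (p := 2) hks)
  have i2 : Integrable (fun z => g x * k z) volume :=
    (hkc.integrable_of_hasCompactSupport hks).const_mul _
  have e2 : mean L f a x - f x * ∫ w, ker₁ 1 w = ∫ z, (g z - g x) * k z := by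
    have e3 : ∫ z, g x * k z = f x * ∫ w, ker₁ 1 w := by
      rw [integral_const_mul, ← integral_ker₁ ha, ← integral_sub_right_eq_self (ker₁ a) x, hg,
        Set.indicator_of_mem hxs']
    rw [mean_eq_integral ha hxs' ha0 ha1, ← e3, ← integral_sub i1 i2]
    simp only [sub_mul, hk]
  have hball : IntegrableOn (fun z => ‖g z - g x‖) (Metric.closedBall x δ) :=
    (((hgm.locallyIntegrable one_le_two).integrableOn_isCompact (isCompact_closedBall _ _)).sub
      (integrableOn_const (isCompact_closedBall _ _).measure_lt_top.ne)).norm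
  rw [e2]
  calc ‖∫ z, (g z - g x) * k z‖ ≤ ∫ z, ‖(g z - g x) * k z‖ := norm_integral_le_integral_norm _
    _ ≤ ∫ z, (Metric.closedBall x δ).indicator (fun z => B * a * ‖g z - g x‖) z := by
        refine integral_mono_of_nonneg (Eventually.of_forall fun z => norm_nonneg _)
          (IntegrableOn.integrable_indicator (hball.const_mul _)
            Metric.isClosed_closedBall.measurableSet) (Eventually.of_forall fun z => ?_)
        dsimp only
        by_cases hz : z ∈ Metric.closedBall x δ
        · rw [Set.indicator_of_mem hz, norm_mul, mul_comm]
          gcongr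
          exact (hker a ha _).2.1
        · rw [Set.indicator_of_notMem hz]
          have hz' : 1 ≤ a * sqn (z - x) := not_lt.1 fun h => hz (disc_subset ha x h)
          simp only [hk, ker₁_eq_zero hz', mul_zero, norm_zero, le_refl]
    _ = B * a * ∫ z in Metric.closedBall x δ, ‖g z - g x‖ := by
        rw [integral_indicator Metric.isClosed_closedBall.measurableSet, integral_const_mul]
    _ = 4 * B * ⨍ z in Metric.closedBall x δ, ‖g z - g x‖ := by
        rw [setAverage_eq, volume_real_closedBall x (Real.sqrt_nonneg _), smul_eq_mul,
          Real.sq_sqrt (by positivity)]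
        field_simp

end Lebesgue

/-! ### Strong maximum principle through monotone means. -/

section Positivity

theorem glue_fold_le {a : ℝ} (ha : 0 < a) (z₀ z : ℝ × ℝ) :
    fold L (ker₀ a) z₀ z ≤ 1 / (2 * a) * fold L (ker₁ a) z₀ z := by
  have h : ∀ w, ker₀ a w ≤ 1 / (2 * a) * ker₁ a w := fun w => by
    have h1 : 1 - a * sqn w ≤ 1 := by linarith [mul_nonneg ha.le (sqn_nonneg w)]
    have e : 1 / (2 * a) * ker₁ a w = glueDeriv (1 - a * sqn w) := by rw [ker₁]; field_simp
    rw [e]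
    exact glue_le_glueDeriv h1
  simp only [fold, mul_add]
  exact add_le_add (add_le_add (h _) (h _)) (h _)

theorem fold_nonneg {K : ℝ × ℝ → ℝ} (hK : ∀ w, 0 ≤ K w) (z₀ z : ℝ × ℝ) : 0 ≤ fold L K z₀ z :=
  add_nonneg (add_nonneg (hK _) (hK _)) (hK _)

theorem ker₀_nonneg (a : ℝ) (w : ℝ × ℝ) : 0 ≤ ker₀ a w := expNegInvGlue.nonneg _

theorem IsNonnegSol.mean_nonneg (h : IsNonnegSol L ω γ r f t) {a : ℝ} (ha : 0 < a) (z₀ : ℝ × ℝ) :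
    0 ≤ mean L f a z₀ :=
  integral_nonneg fun z => mul_nonneg (h.nonneg z) (fold_nonneg (ker₁_nonneg ha) _ _)

/-- For γ < 0 and f ≥ 0 the delta and power terms have the favourable sign. With `ker₀` ≤ `ker₁` /
(2a) this gives M' ≥ -(ω/(4a²)) M for the mean M, and exp(-ω/(4a)) is the integrating factor. -/
theorem IsNonnegSol.monotoneOn (h : IsNonnegSol L ω γ r f t) (hL : 0 < L) (hω : 0 < ω)
    (hγ : γ < 0) {z₀ : ℝ × ℝ} (hz₀ : z₀ ∈ strip L) :
    MonotoneOn (fun a => mean L f a z₀ * Real.exp (-ω / 4 * a⁻¹)) (Set.Ici (1 / L ^ 2)) := by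
  have hpos : 0 < 1 / L ^ 2 := by positivity
  have hd : ∀ a, 1 / L ^ 2 ≤ a → HasDerivAt
      (fun a => mean L f a z₀ * Real.exp (-ω / 4 * a⁻¹)) _ a := fun a ha =>
    (hasDerivAt_mean h.memLp (hpos.trans_le ha) hz₀).mul
      (((hasDerivAt_inv (hpos.trans_le ha).ne').const_mul (-ω / 4)).exp)
  refine monotoneOn_of_deriv_nonneg (convex_Ici _)
    (fun a ha => (hd a ha).continuousAt.continuousWithinAt) (fun a ha => ?_) fun a ha => ?_
  · rw [interior_Ici] at ha
    exact (hd a (le_of_lt ha)).differentiableAt.differentiableWithinAt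
  · rw [interior_Ici] at ha
    have ha' : 1 / L ^ 2 ≤ a := le_of_lt ha
    have ha0 := hpos.trans_le ha'
    have haL : 1 ≤ a * L ^ 2 := by rwa [div_le_iff₀ (by positivity)] at ha'
    rw [(hd a ha').deriv, h.eq_laplacian a ha0 haL z₀ hz₀]
    have c₀ := (contDiff_ker₀ a).continuous
    have s₀ := hasCompactSupport_ker₀ ha0
    set I := ∫ z, f z * fold L (ker₀ a) z₀ z ∂(stripMeasure L) with hI
    have h1 : 0 ≤ ∫ y, t y * fold L (ker₀ a) z₀ (0, y) ∂(sectionMeasure L) :=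
      integral_nonneg fun y => mul_nonneg (h.trace_nonneg y) (fold_nonneg (ker₀_nonneg a) _ _)
    have h2 : 0 ≤ ∫ z, |f z| ^ (r - 2) * f z * fold L (ker₀ a) z₀ z ∂(stripMeasure L) :=
      integral_nonneg fun z => mul_nonneg (mul_nonneg (by positivity) (h.nonneg z))
        (fold_nonneg (ker₀_nonneg a) _ _)
    have h3 : I ≤ 1 / (2 * a) * mean L f a z₀ := by
      rw [hI, mean, ← integral_const_mul]
      refine integral_mono (integrable_mul_fold h.memLp c₀ s₀ z₀)
        ((integrable_mul_fold h.memLp (contDiff_ker₁ a).continuous (hasCompactSupport_ker₁ ha0)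
          z₀).const_mul _) fun z => ?_
      calc f z * fold L (ker₀ a) z₀ z ≤ f z * (1 / (2 * a) * fold L (ker₁ a) z₀ z) :=
            mul_le_mul_of_nonneg_left (glue_fold_le ha0 _ _) (h.nonneg z)
        _ = _ := by ring
    set J := ∫ y, t y * fold L (ker₀ a) z₀ (0, y) ∂(sectionMeasure L)
    set G := ∫ z, |f z| ^ (r - 2) * f z * fold L (ker₀ a) z₀ z ∂(stripMeasure L)
    have h4 : ω * I + γ * J - G ≤ ω * (1 / (2 * a) * mean L f a z₀) := by
      have := mul_le_mul_of_nonneg_left h3 hω.le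
      nlinarith
    have h5 := mul_le_mul_of_nonneg_left h4 (by positivity : 0 ≤ 1 / (2 * a))
    have e : -(1 / (2 * a)) * (ω * I + γ * J - G) * Real.exp (-ω / 4 * a⁻¹) +
        mean L f a z₀ * (Real.exp (-ω / 4 * a⁻¹) * (-ω / 4 * -(a ^ 2)⁻¹)) =
        Real.exp (-ω / 4 * a⁻¹) * (1 / (2 * a) * (ω * (1 / (2 * a) * mean L f a z₀)) -
          1 / (2 * a) * (ω * I + γ * J - G)) := by
      field_simp
      ring
    rw [e]
    exact mul_nonneg (Real.exp_pos _).le (sub_nonneg.2 h5)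

/-- A nondecreasing quantity with limit zero is nonpositive. The value a = 1/L² is that of the
largest admissible radius, L. -/
theorem IsNonnegSol.mean_eq_zero (h : IsNonnegSol L ω γ r f t) (hL : 0 < L) (hω : 0 < ω)
    (hγ : γ < 0) {z₀ : ℝ × ℝ} (hz₀ : z₀ ∈ strip L)
    (hl : Tendsto (fun a => mean L f a z₀) atTop (𝓝 0)) : mean L f (1 / L ^ 2) z₀ = 0 := by
  have hpos : 0 < 1 / L ^ 2 := by positivity
  have h1 : Tendsto (fun a => mean L f a z₀ * Real.exp (-ω / 4 * a⁻¹)) atTop (𝓝 0) := by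
    have h2 : Tendsto (fun a : ℝ => Real.exp (-ω / 4 * a⁻¹)) atTop (𝓝 1) := by
      have := (Real.continuous_exp.tendsto 0).comp
        (by simpa using tendsto_inv_atTop_zero.const_mul (-ω / 4) :
          Tendsto (fun a : ℝ => -ω / 4 * a⁻¹) atTop (𝓝 0))
      rwa [Real.exp_zero] at this
    simpa using hl.mul h2
  have h2 : mean L f (1 / L ^ 2) z₀ * Real.exp (-ω / 4 * (1 / L ^ 2)⁻¹) ≤ 0 := by
    refine ge_of_tendsto h1 ?_
    filter_upwards [eventually_ge_atTop (1 / L ^ 2)] with a ha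
    exact h.monotoneOn hL hω hγ hz₀ (Set.mem_Ici.2 le_rfl) ha ha
  refine le_antisymm ?_ (h.mean_nonneg hpos z₀)
  exact nonpos_of_mul_nonpos_left h2 (Real.exp_pos _)

/-- A vanishing mean of a nonnegative function forces it to vanish almost everywhere on the disc of
radius L around z₀, and this disc contains those of radius L/2 around points closer than L/2. -/
theorem IsNonnegSol.zero_propagates (h : IsNonnegSol L ω γ r f t) (hL : 0 < L) {z₀ z₁ : ℝ × ℝ}
    (hz₁ : z₁ ∈ strip L) (h0 : mean L f (1 / L ^ 2) z₀ = 0) (hd : 4 * sqn (z₁ - z₀) < L ^ 2)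
    {a : ℝ} (ha : 4 / L ^ 2 ≤ a) : mean L f a z₁ = 0 := by
  have hpos : 0 < 1 / L ^ 2 := by positivity
  have ha0 : 0 < a := lt_of_lt_of_le (by positivity) ha
  have hae : ∀ᵐ z ∂(stripMeasure L), f z * fold L (ker₁ (1 / L ^ 2)) z₀ z = 0 :=
    (integral_eq_zero_iff_of_nonneg_ae (Eventually.of_forall fun z =>
      mul_nonneg (h.nonneg z) (fold_nonneg (ker₁_nonneg hpos) _ _))
      (integrable_mul_fold h.memLp (contDiff_ker₁ _).continuous
        (hasCompactSupport_ker₁ hpos) z₀)).1 h0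
  refine integral_eq_zero_of_ae ?_
  filter_upwards [hae, ae_mem_strip] with z hz hzs
  rw [Pi.zero_apply]
  by_cases hc : 1 ≤ a * sqn (z - z₁)
  · rw [fold_eq_zero ha0 (fun _ => ker₁_eq_zero) hzs hz₁ hc, mul_zero]
  · have h1 : sqn (z - z₁) < L ^ 2 / 4 := by
      rw [not_le, mul_comm, ← lt_div_iff₀ ha0] at hc
      refine hc.trans_le ?_
      rw [div_le_iff₀ (by positivity)] at ha
      rw [div_le_div_iff₀ ha0 (by norm_num)]
      linarith
    have h2 : sqn (z - z₀) < L ^ 2 := by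
      have : sqn (z - z₀) ≤ 2 * sqn (z - z₁) + 2 * sqn (z₁ - z₀) := by
        simp only [sqn, Prod.fst_sub, Prod.snd_sub]
        nlinarith [sq_nonneg (z.1 - z₁.1 - (z₁.1 - z₀.1)), sq_nonneg (z.2 - z₁.2 - (z₁.2 - z₀.2))]
      linarith
    have h3 : 0 < fold L (ker₁ (1 / L ^ 2)) z₀ z := by
      have h4 : 0 < ker₁ (1 / L ^ 2) (z - z₀) := by
        refine mul_pos (by positivity) (glueDeriv_pos ?_)
        rw [sub_pos, one_div_mul_eq_div, div_lt_one (by positivity)]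
        exact h2
      have h5 := ker₁_nonneg hpos (z - (z₀.1, -z₀.2))
      have h6 := ker₁_nonneg hpos (z - (z₀.1, 2 * L - z₀.2))
      rw [fold]; linarith
    rw [(mul_eq_zero.1 hz).resolve_right h3.ne', zero_mul]

/-- The zero set of l is closed by continuity and open by `IsNonnegSol.zero_propagates`. The strip
being connected, one zero would force l = 0 and then f = 0 almost everywhere. -/
theorem IsNonnegSol.limit_pos (h : IsNonnegSol L ω γ r f t) (hL : 0 < L) (hω : 0 < ω)
    (hγ : γ < 0) {l : ℝ × ℝ → ℝ} (hc : ContinuousOn l (strip L))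
    (hl : ∀ z₀ ∈ strip L, Tendsto (fun a => mean L f a z₀) atTop (𝓝 (l z₀)))
    (hne : ¬ f =ᵐ[stripMeasure L] 0) : ∀ z ∈ strip L, 0 < l z := by
  have hnn : ∀ z ∈ strip L, 0 ≤ l z := fun z hz => by
    refine ge_of_tendsto (hl z hz) ?_
    filter_upwards [eventually_gt_atTop 0] with a ha
    exact h.mean_nonneg ha z
  have hconn : PreconnectedSpace (strip L) :=
    Subtype.preconnectedSpace ((convex_univ.prod (convex_Icc 0 L)).isPreconnected)
  set Z : Set (strip L) := {z | l z = 0} with hZ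
  have hclosed : IsClosed Z := isClosed_singleton.preimage (continuousOn_iff_continuous_domRestrict.1 hc)
  have hopen : IsOpen Z := by
    rw [isOpen_iff_mem_nhds]
    intro z₀ hz₀
    have hz₀' : l z₀ = 0 := hz₀
    have h0 := h.mean_eq_zero hL hω hγ z₀.2 (hz₀' ▸ hl z₀ z₀.2)
    have hcs : Continuous fun z : strip L => 4 * sqn ((z : ℝ × ℝ) - z₀) :=
      continuous_const.mul (contDiff_sqn.continuous.comp (by fun_prop))
    have hev : ∀ᶠ z : strip L in 𝓝 z₀, 4 * sqn ((z : ℝ × ℝ) - z₀) < L ^ 2 := by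
      refine (hcs.tendsto z₀).eventually_lt_const ?_
      simp only [sub_self, sqn]
      simpa using by positivity
    filter_upwards [hev] with z hz
    refine tendsto_nhds_unique (hl z z.2) (tendsto_const_nhds.congr' ?_)
    filter_upwards [eventually_ge_atTop (4 / L ^ 2)] with a ha
    exact (h.zero_propagates hL z.2 h0 hz ha).symm
  intro z hz
  refine lt_of_le_of_ne (hnn z hz) fun h0 => hne ?_
  have huniv := IsClopen.eq_univ ⟨hclosed, hopen⟩ ⟨⟨z, hz⟩, h0.symm⟩
  filter_upwards [ae_eq_limit h.memLp hl, ae_mem_strip] with w h1 h2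
  have h3 : (⟨w, h2⟩ : strip L) ∈ Z := huniv ▸ Set.mem_univ _
  have h4 : l w = 0 := h3
  rw [h4] at h1
  exact (mul_eq_zero.1 h1.symm).resolve_right integral_ker₁_pos.ne'

/-- A nonnegative solution has a continuous and positive representative. -/
theorem IsNonnegSol.exists_continuous (h : IsNonnegSol L ω γ r f t) (hL : 0 < L) (hω : 0 < ω)
    (hγ : γ < 0) (hne : ¬ f =ᵐ[stripMeasure L] 0) :
    ∃ g : ℝ × ℝ → ℝ, ContinuousOn g (strip L) ∧ (∀ z ∈ strip L, 0 < g z) ∧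
      f =ᵐ[stripMeasure L] g := by
  obtain ⟨C, l, hl⟩ := h.exists_limit hL
  have hc := continuousOn_limit h.memLp hl
  have hlim := fun z hz => tendsto_mean hl (z₀ := z) hz
  refine ⟨fun z => l z / ∫ w, ker₁ 1 w, hc.div_const _,
    fun z hz => div_pos (h.limit_pos hL hω hγ hc hlim hne z hz) integral_ker₁_pos, ?_⟩
  filter_upwards [ae_eq_limit h.memLp hlim] with z hz
  rw [hz, mul_div_cancel_right₀ _ integral_ker₁_pos.ne']

end Positivity

end DeltaStrip

/-! ### The precise representative. -/

namespace DeltaStrip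

variable {L : ℝ}

section Average

theorem stripDisc_subset_closedBall (z : ℝ × ℝ) {r : ℝ} (hr : 0 < r) :
    stripDisc L z r ⊆ Metric.closedBall z r := by
  rintro w ⟨-, hw⟩
  rw [mem_closedBall_iff_norm, Prod.norm_def, Real.norm_eq_abs, Real.norm_eq_abs]
  exact max_le (abs_le_of_sq_le_sq (by simp only [Prod.fst_sub]; nlinarith) hr.le)
    (abs_le_of_sq_le_sq (by simp only [Prod.snd_sub]; nlinarith) hr.le)

/-- The centre may lie on a side; moving it towards the middle line by at most s L/2 < r gives an
interior point, so the set contains a nonempty open set. -/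
theorem volume_stripDisc_ne_zero (hL : 0 < L) {z : ℝ × ℝ} (hz : z ∈ strip L) {r : ℝ} (hr : 0 < r) :
    volume (stripDisc L z r) ≠ 0 := by
  set O : Set (ℝ × ℝ) := openStrip L ∩ {w | (w.1 - z.1) ^ 2 + (w.2 - z.2) ^ 2 < r ^ 2} with hO
  have ho : IsOpen O := isOpen_openStrip.inter (isOpen_lt (by fun_prop) continuous_const)
  have hne : O.Nonempty := by
    obtain ⟨-, h1, h2⟩ := hz
    set s := min 1 (r / L) with hs
    have hs0 : 0 < s := lt_min one_pos (by positivity)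
    have hs1 : s ≤ 1 := min_le_left _ _
    have hs2 : s * L ≤ r := by
      rw [← le_div_iff₀ hL]; exact min_le_right _ _
    refine ⟨(z.1, z.2 + s * (L / 2 - z.2)), ⟨trivial, ?_, ?_⟩, ?_⟩
    · change 0 < z.2 + s * (L / 2 - z.2)
      nlinarith
    · change z.2 + s * (L / 2 - z.2) < L
      nlinarith
    · change (z.1 - z.1) ^ 2 + (z.2 + s * (L / 2 - z.2) - z.2) ^ 2 < r ^ 2
      have h3 : |s * (L / 2 - z.2)| < r := by
        rw [abs_mul, abs_of_pos hs0]
        have : |L / 2 - z.2| ≤ L / 2 := abs_le.2 ⟨by linarith, by linarith⟩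
        nlinarith
      have := sq_lt_sq' (by linarith [(abs_lt.1 h3).1]) (abs_lt.1 h3).2
      nlinarith
  have hsub : O ⊆ stripDisc L z r := fun w hw => ⟨openStrip_subset hw.1, hw.2⟩
  exact ((ho.measure_pos volume hne).trans_le (measure_mono hsub)).ne'

/-- Averages over small discs converge at the points of continuity. -/
theorem tendsto_average_stripDisc (hL : 0 < L) {u g : ℝ × ℝ → ℂ} (hu : MemLp u 2 (stripMeasure L))
    (hg : ContinuousOn g (strip L)) (hug : u =ᵐ[stripMeasure L] g) {z : ℝ × ℝ} (hz : z ∈ strip L) :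
    Tendsto (fun r : ℝ => ⨍ w in stripDisc L z r, u w) (𝓝[>] 0) (𝓝 (g z)) := by
  rw [Metric.tendsto_nhds]
  intro ε hε
  obtain ⟨δ, hδ, hδ'⟩ := Metric.continuousWithinAt_iff.1 (hg z hz) (ε / 2) (half_pos hε)
  filter_upwards [Ioo_mem_nhdsGT hδ] with r hr
  have hsub : stripDisc L z r ⊆ strip L := fun w hw => hw.1
  have hball := stripDisc_subset_closedBall (L := L) z hr.1
  have hmeas : MeasurableSet (stripDisc L z r) :=
    measurableSet_strip'.inter (isOpen_lt (by fun_prop : Continuous fun w : ℝ × ℝ => (w.1 - z.1) ^ 2 + (w.2 - z.2) ^ 2) continuous_const).measurableSet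
  have hae : ∀ᵐ w ∂(volume.restrict (stripDisc L z r)), u w ∈ Metric.closedBall (g z) (ε / 2) := by
    filter_upwards [ae_restrict_of_ae_restrict_of_subset hsub hug, ae_restrict_mem hmeas]
      with w h1 h2
    rw [h1]
    exact (hδ' (hsub h2) ((hball h2).trans_lt hr.2)).le
  have hint : IntegrableOn u (stripDisc L z r) := by
    have h1 : IntegrableOn u (Metric.closedBall z r) (stripMeasure L) :=
      (hu.locallyIntegrable one_le_two).integrableOn_isCompact (isCompact_closedBall _ _)
    rw [IntegrableOn, stripMeasure,
      Measure.restrict_restrict Metric.isClosed_closedBall.measurableSet] at h1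
    exact IntegrableOn.mono_set h1 fun w hw => ⟨hball hw, hsub hw⟩
  have := (convex_closedBall (g z) (ε / 2)).set_average_mem Metric.isClosed_closedBall
    (volume_stripDisc_ne_zero hL hz hr.1)
    ((measure_mono hball).trans_lt measure_closedBall_lt_top).ne hae hint
  exact (Metric.mem_closedBall.1 this).trans_lt (half_lt_self hε)

theorem preciseRep_eq (hL : 0 < L) {u g : ℝ × ℝ → ℂ} (hu : MemLp u 2 (stripMeasure L))
    (hg : ContinuousOn g (strip L)) (hug : u =ᵐ[stripMeasure L] g) {z : ℝ × ℝ} (hz : z ∈ strip L) :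
    preciseRep L u z = g z := by
  have h := tendsto_average_stripDisc hL hu hg hug hz
  have hex : ∃ l : ℂ, Tendsto (fun r : ℝ => ⨍ w in stripDisc L z r, u w) (𝓝[>] 0) (𝓝 l) := ⟨_, h⟩
  rw [preciseRep, dif_pos hex]
  exact tendsto_nhds_unique hex.choose_spec h

end Average

/-! ### Action, Nehari functional and equation expressed in the energy space. -/

section Functionals

variable {ω γ p : ℝ} {V : Quad L} {v : ℝ × ℝ → ℂ}

theorem integral_norm_sq_congr {α : Type*} [MeasurableSpace α] {μ : Measure α} {F : Lp ℂ 2 μ}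
    {f : α → ℂ} (h : F =ᵐ[μ] f) : ∫ z, ‖f z‖ ^ 2 ∂μ = ‖F‖ ^ 2 := by
  rw [norm_sq_eq_integral]
  refine integral_congr_ae ?_
  filter_upwards [h] with z hz
  rw [hz]

theorem gradSq_eq (h2 : V.2.1 =ᵐ[stripMeasure L] weakDeriv L ex v)
    (h3 : V.2.2.1 =ᵐ[stripMeasure L] weakDeriv L ey v) :
    gradSq L v = ‖V.2.1‖ ^ 2 + ‖V.2.2.1‖ ^ 2 := by
  have i2 := (integrable_norm_sq V.2.1).congr (f := fun z => ‖V.2.1 z‖ ^ 2)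
    (g := fun z => ‖weakDeriv L ex v z‖ ^ 2) (h2.mono fun z hz => by simp only [hz])
  have i3 := (integrable_norm_sq V.2.2.1).congr (f := fun z => ‖V.2.2.1 z‖ ^ 2)
    (g := fun z => ‖weakDeriv L ey v z‖ ^ 2) (h3.mono fun z hz => by simp only [hz])
  rw [gradSq, integral_add i2 i3, integral_norm_sq_congr h2, integral_norm_sq_congr h3]

theorem potential_eq (h1 : V.1 =ᵐ[stripMeasure L] v) : potential L p v = pInt (p + 1) V :=
  integral_congr_ae (h1.mono fun z hz => by simp only [hz])

theorem nehari_eq (h1 : V.1 =ᵐ[stripMeasure L] v) (h2 : V.2.1 =ᵐ[stripMeasure L] weakDeriv L ex v)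
    (h3 : V.2.2.1 =ᵐ[stripMeasure L] weakDeriv L ey v)
    (h4 : V.2.2.2 =ᵐ[sectionMeasure L] trace L v) :
    nehari L ω γ p v = qForm ω γ V - pInt (p + 1) V := by
  rw [nehari, gradSq_eq h2 h3, massSq, integral_norm_sq_congr h1, traceSq,
    integral_norm_sq_congr h4, potential_eq h1, qForm]

theorem action_eq (h1 : V.1 =ᵐ[stripMeasure L] v) (h2 : V.2.1 =ᵐ[stripMeasure L] weakDeriv L ex v)
    (h3 : V.2.2.1 =ᵐ[stripMeasure L] weakDeriv L ey v)
    (h4 : V.2.2.2 =ᵐ[sectionMeasure L] trace L v) :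
    action L ω γ p v = 1 / 2 * qForm ω γ V - 1 / (p + 1) * pInt (p + 1) V := by
  rw [action, gradSq_eq h2 h3, massSq, integral_norm_sq_congr h1, traceSq,
    integral_norm_sq_congr h4, potential_eq h1, qForm]
  ring

theorem re_mul_star (a b : ℂ) : (a * star b).re = inner ℝ a b := by
  rw [Complex.inner, Complex.star_def, Complex.mul_re, Complex.mul_re, Complex.conj_re,
    Complex.conj_im, Complex.conj_re, Complex.conj_im]
  ring

theorem integral_re_mul_star {α : Type*} [MeasurableSpace α] {μ : Measure α} {F G : Lp ℂ 2 μ}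
    {f g : α → ℂ} (hf : F =ᵐ[μ] f) (hg : G =ᵐ[μ] g) :
    Integrable (fun z => (f z * star (g z)).re) μ ∧
      ∫ z, (f z * star (g z)).re ∂μ = inner ℝ F G := by
  have h : (fun z => (inner ℝ (F z) (G z) : ℝ)) =ᵐ[μ] fun z => (f z * star (g z)).re := by
    filter_upwards [hf, hg] with z h1 h2
    rw [re_mul_star, h1, h2]
  exact ⟨(L2.integrable_inner (𝕜 := ℝ) F G).congr h, by rw [L2.inner_def, integral_congr_ae h]⟩

end Functionals

section Solution

variable {ω γ r : ℝ} {U : Quad L}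

theorem isNonnegSol_of_euler_lagrange (hL : 0 < L) (hr : 2 < r) (hU : U ∈ energySpace L)
    (h1 : U.1 =ᵐ[stripMeasure L] fun z => ((‖U.1 z‖ : ℝ) : ℂ))
    (h4 : U.2.2.2 =ᵐ[sectionMeasure L] fun y => ((‖U.2.2.2 y‖ : ℝ) : ℂ))
    (hEL : ∀ W ∈ energySpace L, bForm ω γ U W =
        ∫ z, ‖U.1 z‖ ^ (r - 2) * inner ℝ (U.1 z) (W.1 z) ∂(stripMeasure L)) :
    IsNonnegSol L ω γ r (fun z => ‖U.1 z‖) fun y => ‖U.2.2.2 y‖ where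
  nonneg z := norm_nonneg _
  trace_nonneg y := norm_nonneg _
  memLp := (Lp.memLp U.1).norm
  memLp_trace := (Lp.memLp U.2.2.2).norm
  -- The square of this function is |U|^(2(r-1)), integrable because 2(r - 1) ≥ 2.
  memLp_rpow := by
    have hm : AEStronglyMeasurable (fun z => |‖U.1 z‖| ^ (r - 2) * ‖U.1 z‖) (stripMeasure L) := by
      refine AEStronglyMeasurable.mul ?_ (Lp.aestronglyMeasurable U.1).norm
      simp only [abs_norm]
      exact (Real.continuous_rpow_const (by linarith)).comp_aestronglyMeasurable
        (Lp.aestronglyMeasurable U.1).norm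
    rw [memLp_two_iff_integrable_sq hm]
    refine (integrable_rpow hL (r := 2 * (r - 1)) (by linarith) hU).congr
      (Eventually.of_forall fun z => ?_)
    have e : |‖U.1 z‖| ^ (r - 2) * ‖U.1 z‖ = ‖U.1 z‖ ^ (r - 1) := by
      rw [abs_norm, ← Real.rpow_add_one' (norm_nonneg _) (by linarith)]
      congr 1; ring
    simp only [e]
    rw [← Real.rpow_natCast, ← Real.rpow_mul (norm_nonneg _)]
    congr 1; push_cast; ring
  eq_laplacian a ha haL z₀ hz₀ := by
    have := integral_mul_laplacian hL hU h1 h4 hEL (contDiff_fold (L := L) (contDiff_ker₀ a) z₀)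
      (hasCompactSupport_fold (hasCompactSupport_ker₀ ha) z₀)
      (fun x => (neumann_fold ha hL haL hz₀ x).1) (fun x => (neumann_fold ha hL haL hz₀ x).2)
    simp only [laplacian_fold] at this
    exact this

end Solution

end DeltaStrip

/-! ### Conclusion. -/

namespace DeltaStrip

variable {L ω γ p : ℝ}

theorem bForm_self_eq_pInt {r : ℝ} (hr : 2 < r) {U : Quad L} (hU : U ∈ energySpace L)
    (hEL : ∀ W ∈ energySpace L, bForm ω γ U W =
        ∫ z, ‖U.1 z‖ ^ (r - 2) * inner ℝ (U.1 z) (W.1 z) ∂(stripMeasure L)) :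
    qForm ω γ U = pInt r U := by
  rw [← bForm_self, hEL U hU]
  refine integral_congr_ae (Eventually.of_forall fun z => ?_)
  simp only [real_inner_self_eq_norm_sq]
  rw [← Real.rpow_natCast, ← Real.rpow_add' (norm_nonneg _) (by push_cast; linarith)]
  congr 1; push_cast; ring

/-- With q = P the action is a fixed positive multiple of P, so comparing actions on the Nehari set
is comparing potentials. -/
theorem qForm_eq_pInt_of_mem (hL : 0 < L) (hp : 1 < p) {v : ℝ × ℝ → ℂ}
    (hv : v ∈ nehariManifold L ω γ p) : ∃ V ∈ energySpace L, 0 < pInt (p + 1) V ∧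
      qForm ω γ V = pInt (p + 1) V ∧
      action L ω γ p v = (1 / 2 - 1 / (p + 1)) * pInt (p + 1) V := by
  obtain ⟨hv1, hv0, hvN⟩ := hv
  obtain ⟨V, hV, e1, e2, e3, e4⟩ := exists_quad_of_memH1 hL hv1
  have hq : qForm ω γ V = pInt (p + 1) V := by
    rw [nehari_eq e1 e2 e3 e4] at hvN; linarith
  refine ⟨V, hV, (pInt_nonneg _ _).lt_of_ne fun h => hv0 ?_, hq, ?_⟩
  · exact e1.symm.trans (ae_eq_zero_of_pInt hL (by linarith) hV h.symm)
  · rw [action_eq e1 e2 e3 e4, hq]; ring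

/-- The quadruple built from the chosen derivatives and trace has the same first component as U, and
`eq_of_fst_eq` makes the two equal. -/
theorem ae_eq_weakDeriv_trace (hL : 0 < L) {U : Quad L} (hU : U ∈ energySpace L) :
    U.2.1 =ᵐ[stripMeasure L] weakDeriv L ex U.1 ∧ U.2.2.1 =ᵐ[stripMeasure L] weakDeriv L ey U.1 ∧
      U.2.2.2 =ᵐ[sectionMeasure L] trace L U.1 := by
  obtain ⟨V, hV, e1, e2, e3, e4⟩ := exists_quad_of_memH1 hL (memH1_of_mem hU)
  obtain rfl : U = V := eq_of_fst_eq hU hV (Lp.ext e1.symm)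
  exact ⟨e2, e3, e4⟩

theorem isActionGroundState_of_minimal (hL : 0 < L) (hp : 1 < p) {U : Quad L}
    (hU : U ∈ energySpace L) (hpos : 0 < pInt (p + 1) U) (hq : qForm ω γ U = pInt (p + 1) U)
    (hmin : ∀ V ∈ energySpace L, 0 < pInt (p + 1) V → qForm ω γ V = pInt (p + 1) V →
      pInt (p + 1) U ≤ pInt (p + 1) V) : IsActionGroundState L ω γ p U.1 := by
  obtain ⟨e2, e3, e4⟩ := ae_eq_weakDeriv_trace hL hU
  have e1 : U.1 =ᵐ[stripMeasure L] (U.1 : ℝ × ℝ → ℂ) := EventuallyEq.rfl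
  refine ⟨⟨memH1_of_mem hU, fun h => hpos.ne' ?_, ?_⟩, isMinOn_iff.2 fun v hv => ?_⟩
  · rw [pInt, integral_congr_ae (g := fun _ => (0 : ℝ)), integral_zero]
    filter_upwards [h] with z hz
    rw [hz, Pi.zero_apply, norm_zero, Real.zero_rpow (by linarith)]
  · rw [nehari_eq e1 e2 e3 e4, hq, sub_self]
  · obtain ⟨V, hV, hV0, hVq, hVa⟩ := qForm_eq_pInt_of_mem hL hp hv
    rw [hVa, action_eq e1 e2 e3 e4, hq, ← sub_mul]
    refine mul_le_mul_of_nonneg_left (hmin V hV hV0 hVq) ?_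
    rw [sub_nonneg]
    exact one_div_le_one_div_of_le two_pos (by linarith)

theorem isSolution_of_euler_lagrange (hL : 0 < L) {U : Quad L} (hU : U ∈ energySpace L)
    (hEL : ∀ W ∈ energySpace L, bForm ω γ U W =
        ∫ z, ‖U.1 z‖ ^ (p - 1) * inner ℝ (U.1 z) (W.1 z) ∂(stripMeasure L)) :
    IsSolution L ω γ p U.1 := by
  refine ⟨memH1_of_mem hU, fun v hv => ?_⟩
  obtain ⟨e2, e3, e4⟩ := ae_eq_weakDeriv_trace hL hU
  have e1 : U.1 =ᵐ[stripMeasure L] (U.1 : ℝ × ℝ → ℂ) := EventuallyEq.rfl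
  obtain ⟨V, hV, f1, f2, f3, f4⟩ := exists_quad_of_memH1 hL hv
  have i2 := integral_re_mul_star e2 f2
  have i3 := integral_re_mul_star e3 f3
  have hlast : ∫ z, ‖U.1 z‖ ^ (p - 1) * (U.1 z * star (v z)).re ∂(stripMeasure L) =
      bForm ω γ U V := by
    rw [hEL V hV]
    refine integral_congr_ae ?_
    filter_upwards [f1] with z hz
    rw [re_mul_star, hz]
  simp only [Complex.add_re]
  rw [integral_add i2.1 i3.1, i2.2, i3.2, (integral_re_mul_star e1 f1).2,
    (integral_re_mul_star e4 f4).2, hlast, bForm]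
  ring

theorem preciseRep_pos (hL : 0 < L) (hγ : γ < 0) (hω : 0 < ω) {r : ℝ} {U : Quad L}
    (h1 : U.1 =ᵐ[stripMeasure L] fun z => ((‖U.1 z‖ : ℝ) : ℂ))
    (hne : ¬ U.1 =ᵐ[stripMeasure L] 0)
    (hsol : IsNonnegSol L ω γ r (fun z => ‖U.1 z‖) fun y => ‖U.2.2.2 y‖)
    {z : ℝ × ℝ} (hz : z ∈ strip L) :
    (preciseRep L U.1 z).im = 0 ∧ 0 < (preciseRep L U.1 z).re := by
  obtain ⟨g, hg, hgpos, hfg⟩ := hsol.exists_continuous hL hω hγ fun h => hne <| by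
    filter_upwards [h] with z hz using norm_eq_zero.1 hz
  have := preciseRep_eq hL (Lp.memLp U.1) (Complex.continuous_ofReal.comp_continuousOn hg)
    (h1.trans <| hfg.mono fun w hw => by
      simp only [Function.comp_apply]; exact congrArg _ hw) hz
  rw [this]
  exact ⟨Complex.ofReal_im _, hgpos z hz⟩

end DeltaStrip

theorem theorem1 (L γ p ω : ℝ) (hL : 0 < L) (hγ : γ < 0) (hp : 1 < p) (hω : γ ^ 2 / 4 < ω) :
    ∃ u : ℝ × ℝ → ℂ,
      DeltaStrip.IsActionGroundState L ω γ p u ∧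
      (∀ z ∈ DeltaStrip.strip L,
        (DeltaStrip.preciseRep L u z).im = 0 ∧ 0 < (DeltaStrip.preciseRep L u z).re) ∧
      DeltaStrip.IsSolution L ω γ p u := by
  -- The variational part is applied with the exponent r = p + 1 of the potential.
  have hr : 2 < p + 1 := by linarith
  obtain ⟨U, hU, h1, h4, hpos, hEL, hmin⟩ := DeltaStrip.exists_ground_state hL hγ hω hr
  have hground := DeltaStrip.isActionGroundState_of_minimal hL hp hU hpos
    (DeltaStrip.bForm_self_eq_pInt hr hU hEL) hmin
  refine ⟨U.1, hground, fun z hz => ?_, ?_⟩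
  · exact DeltaStrip.preciseRep_pos hL hγ (by nlinarith [sq_nonneg γ]) h1 hground.1.2.1
      (DeltaStrip.isNonnegSol_of_euler_lagrange hL hr hU h1 h4 hEL) hz
  · refine DeltaStrip.isSolution_of_euler_lagrange hL hU fun W hW => ?_
    rw [hEL W hW, show p + 1 - 2 = p - 1 by ring]
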